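/- **Setting.** Let $d\ge 1$ and let $\mathcal A\subseteq\mathbb R^d$ be a nonempty (possibly infinite) action set with $\|a\|_2\le 1$ for all $a\in\mathcal A$. There is an unknown $\theta^\star\in\mathbb R^d$ with $\|\theta^\star\|_2\le 1$. In round $t=1,\dots,T$ the player pulls an arm $a_t\in\mathcal A$ and receives $r_t=\langle\theta^\star,a_t\rangle+\eta_t$, where the $\eta_t$ are independent of each other and of the player's internal randomness, $\mathbf E[\eta_t]=0$ and $\mathbf E[e^{\lambda\eta_t}]\le e^{\lambda^2/2}$ for all $\lambda\in\mathbb R$. A policy chooses $a_t$ as a function of $(a_1,r_1),\dots,(a_{t-1},r_{t-1})$ and an internal random string $\xi$. It is *$\rho$-reproducible* if, for all $\theta^\star$ and all noise laws as above, two executions with the same $\xi$ and independent noise satisfy $\Pr[(a^{(1)}_1,\dots,a^{(1)}_T)=(a^{(2)}_1,\dots,a^{(2)}_T)]\ge 1-\rho$. Its expected regret is $\mathbf E[R_T]=T\sup_{a\in\mathcal A}\langle\theta^\star,a\rangle-\mathbf E\big[\sum_{t=1}^T\langle\theta^\star,a_t\rangle\big]$. A *$1/T$-net* of $\mathcal A$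 is a finite $\mathcal A'\subseteq\mathcal A$ with $|\mathcal A'|\le(3T)^d$ such that every $a\in\mathcal A$ has some $a'\in\mathcal A'$ with $\|a-a'\|_2\le 1/T$. Algorithms are programs of a real random-access machine: exact real arithmetic $+,-,\times,/$ with rational constants, comparisons, natural-number index arithmetic $+,-$, arrays, draws of uniform random numbers from $[0,1]$, and arm pulls, each instruction costing one step. **Theorem.** There are a single program, an absolute constant $C>0$ and a polynomial $p$ such that for all $d\ge 1$, all integers $T\ge 2$, all $\rho\in(0,1]$ and every $\mathcal A$ as above the following holds. The set $\mathcal A$ has a $1/T$-net. For every $1/T$-net $\mathcal A'$ of $\mathcal A$, the program with input $(d,T,\rho,\mathcal A')$ is a $\rho$-reproducible policy that plays $T$ arms, all from $\mathcal A'$; for every random string and every sequence of rewards it halts after at most $p(T^d,1/\rho)$ steps; and for all $\theta^\star$ and all noise laws as above $$\mathbf E[R_T]\le C\cdot\frac{d^4\,L(d)}{\rho^2}\,\sqrt T\,\log^{3/2}(T),$$ where $L(d)=\log d\cdot(\log\log d)^2\cdot\log\log\log d$ for $d\ge 16$, and $L(d)=1$ for $d\le 15$ (where $\log\log\log d$ is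 negative or undefined). -/

import Mathlib

open MeasureTheory ProbabilityTheory

noncomputable section

/-! ### A real random-access machine with coin tosses and arm pulls

Programs are finite texts.  The machine has finitely many named arrays of natural numbers and of
exact real numbers; every executed instruction costs one step.  Index arithmetic has addition and
truncated subtraction only; real arithmetic is `+ - * /` with rational constants and comparisons
(no rounding, no transcendental functions). -/

namespace RealRAM

/-- Natural-number expressions; `read k i` is entry `i` of the natural array `k`. -/
inductive NExpr where
  | const (c : ℕ)
  | read (k : ℕ) (i : NExpr)
  | add (a b : NExpr)
  | sub (a b : NExpr)

/-- Real expressions; `read k i j` is entry `(i, j)` of the real array `k`. -/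
inductive RExpr where
  | const (c : ℚ)
  | ofNat (a : NExpr)
  | read (k : ℕ) (i j : NExpr)
  | add (a b : RExpr)
  | sub (a b : RExpr)
  | mul (a b : RExpr)
  | div (a b : RExpr)

/-- Tests. -/
inductive BExpr where
  | ltN (a b : NExpr)
  | ltR (a b : RExpr)
  | not (b : BExpr)
  | and (a b : BExpr)

/-- Instructions.  `draw` stores a fresh uniform random number of `[0, 1]`; `pull a k i j` pulls the
arm with index `a` and stores the reward in entry `(i, j)` of the real array `k`. -/
inductive Cmd where
  | setN (k : ℕ) (i e : NExpr)
  | setR (k : ℕ) (i j : NExpr) (e : RExpr)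
  | draw (k : ℕ) (i j : NExpr)
  | pull (a : NExpr) (k : ℕ) (i j : NExpr)
  | ite (b : BExpr) (P Q : List Cmd)
  | loop (b : BExpr) (P : List Cmd)

/-- Memory, the number of random numbers used so far, the number of rounds played so far and the
index `arm t` of the arm pulled in round `t` (rounds are counted from `0`). -/
structure State where
  nat : ℕ → ℕ → ℕ
  real : ℕ → ℕ → ℕ → ℝ
  draws : ℕ
  rounds : ℕ
  arm : ℕ → ℕ

/-- Value of a natural-number expression. -/
def NExpr.val (s : State) : NExpr → ℕ
  | .const c => c
  | .read k i => s.nat k (i.val s)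
  | .add a b => a.val s + b.val s
  | .sub a b => a.val s - b.val s

/-- Value of a real expression. -/
def RExpr.val (s : State) : RExpr → ℝ
  | .const c => (c : ℝ)
  | .ofNat a => (a.val s : ℝ)
  | .read k i j => s.real k (i.val s) (j.val s)
  | .add a b => a.val s + b.val s
  | .sub a b => a.val s - b.val s
  | .mul a b => a.val s * b.val s
  | .div a b => a.val s / b.val s

/-- Truth of a test. -/
def BExpr.Holds (s : State) : BExpr → Prop
  | .ltN a b => a.val s < b.val s
  | .ltR a b => a.val s < b.val s
  | .not b => ¬ b.Holds s
  | .and a b => a.Holds s ∧ b.Holds s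

/-- Write into a natural array. -/
def State.writeN (s : State) (k i v : ℕ) : State :=
  { s with nat := fun k' i' => if k' = k ∧ i' = i then v else s.nat k' i' }

/-- Write into a real array. -/
def State.writeR (s : State) (k i j : ℕ) (v : ℝ) : State :=
  { s with real := fun k' i' j' => if k' = k ∧ i' = i ∧ j' = j then v else s.real k' i' j' }

/-- The instructions still to be executed, and the state. -/
structure Config where
  code : List Cmd
  state : State

open Classical in
/-- One step of the machine.  `ξ` is the stream of internal random numbers and `r t a` is the reward
for pulling arm `a` in round `t`; the machine sees `r` only through the arms it pulls. -/
def step (ξ : ℕ → unitInterval) (r : ℕ → ℕ → ℝ) : Config → Config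
  | ⟨[], s⟩ => ⟨[], s⟩
  | ⟨.setN k i e :: R, s⟩ => ⟨R, s.writeN k (i.val s) (e.val s)⟩
  | ⟨.setR k i j e :: R, s⟩ => ⟨R, s.writeR k (i.val s) (j.val s) (e.val s)⟩
  | ⟨.draw k i j :: R, s⟩ =>
      ⟨R, { s.writeR k (i.val s) (j.val s) (ξ s.draws : ℝ) with draws := s.draws + 1 }⟩
  | ⟨.pull a k i j :: R, s⟩ =>
      ⟨R, { s.writeR k (i.val s) (j.val s) (r s.rounds (a.val s)) with
              rounds := s.rounds + 1
              arm := Function.update s.arm s.rounds (a.val s) }⟩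
  | ⟨.ite b P Q :: R, s⟩ => ⟨(if b.Holds s then P else Q) ++ R, s⟩
  | ⟨.loop b P :: R, s⟩ => ⟨if b.Holds s then P ++ .loop b P :: R else R, s⟩

/-- The run from `c` reaches the end of the program after at most `m` steps. -/
def HaltsWithin (ξ : ℕ → unitInterval) (r : ℕ → ℕ → ℝ) (c : Config) (m : ℕ) : Prop :=
  ((step ξ r)^[m] c).code = []

/-- The number of steps until the run from `c` halts (meaningful if it halts). -/
def time (ξ : ℕ → unitInterval) (r : ℕ → ℕ → ℝ) (c : Config) : ℕ :=
  sInf {m | HaltsWithin ξ r c m}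

/-- The state in which the run from `c` halts (meaningful if it halts). -/
def final (ξ : ℕ → unitInterval) (r : ℕ → ℕ → ℝ) (c : Config) : State :=
  ((step ξ r)^[time ξ r c] c).state

end RealRAM

/-! ### Stochastic linear bandits -/

namespace LinearBandit

/-- `x 0, …, x (n - 1)` is a `1/T`-net of the action set `A`, contained in `A` and with at most
`(3T)^d` points (the values `x i` with `n ≤ i` play no role). -/
structure IsNet {d : ℕ} (A : Set (EuclideanSpace ℝ (Fin d))) (T n : ℕ)
    (x : ℕ → EuclideanSpace ℝ (Fin d)) : Prop where
  mem : ∀ i < n, x i ∈ A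
  cover : ∀ a ∈ A, ∃ i < n, ‖a - x i‖ ≤ 1 / (T : ℝ)
  card_le : n ≤ (3 * T) ^ d

/-- The program `P` started on the input `(d, T, n, ρ, x 0, …, x (n - 1))`: the natural array `0`
holds `d, T, n`, entry `(0, 0)` of the real array `0` holds `ρ`, entry `(i, j)` of the real array `1`
holds the `j`-th coordinate of the `i`-th net point, and everything else is `0`. -/
def start {d : ℕ} (P : List RealRAM.Cmd) (T : ℕ) (ρ : ℝ) (n : ℕ)
    (x : ℕ → EuclideanSpace ℝ (Fin d)) : RealRAM.Config where
  code := P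
  state :=
    { nat := fun k i =>
        if k = 0 ∧ i = 0 then d else if k = 0 ∧ i = 1 then T else if k = 0 ∧ i = 2 then n else 0
      real := fun k i j =>
        if k = 0 ∧ i = 0 ∧ j = 0 then ρ
        else if h : k = 1 ∧ i < n ∧ j < d then x i ⟨j, h.2.2⟩ else 0
      draws := 0
      rounds := 0
      arm := fun _ => 0 }

/-- The arm played in round `t` when the unknown parameter is `θ`, the internal randomness is `ξ` and
the noise is `η`: pulling the arm `x i` in round `t` yields the reward `⟪θ, x i⟫ + η t`. -/
def play {d : ℕ} (P : List RealRAM.Cmd) (T : ℕ) (ρ : ℝ) (n : ℕ)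
    (x : ℕ → EuclideanSpace ℝ (Fin d)) (θ : EuclideanSpace ℝ (Fin d))
    (ξ : ℕ → unitInterval) (η : ℕ → ℝ) (t : ℕ) : EuclideanSpace ℝ (Fin d) :=
  x ((RealRAM.final ξ (fun t i => inner ℝ θ (x i) + η t) (start P T ρ n x)).arm t)

/-- The law of the internal randomness: independent uniform numbers in `[0, 1]`. -/
def seedLaw : Measure (ℕ → unitInterval) :=
  Measure.infinitePi fun _ => (volume : Measure unitInterval)

/-- The law of the noise: `η t` has law `ν t`, independently over the rounds. -/
def noiseLaw (ν : ℕ → ProbabilityMeasure ℝ) : Measure (ℕ → ℝ) :=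
  Measure.infinitePi fun t => (ν t : Measure ℝ)

/-- In every round the noise has mean zero and is `1`-subgaussian:
`𝔼 exp (l * η t) ≤ exp (l ^ 2 / 2)` for all real `l`. -/
def IsSubgaussianNoise (ν : ℕ → ProbabilityMeasure ℝ) : Prop :=
  ∀ t, ∫ y, y ∂(ν t : Measure ℝ) = 0 ∧ HasSubgaussianMGF id 1 (ν t : Measure ℝ)

/-- For every seed and every table of rewards, the program halts after at most `bound` steps,
has then pulled exactly `T` arms, and all of them are among `x 0, …, x (n - 1)`. -/
def RunsWithin {d : ℕ} (P : List RealRAM.Cmd) (T : ℕ) (ρ : ℝ) (n : ℕ)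
    (x : ℕ → EuclideanSpace ℝ (Fin d)) (bound : ℝ) : Prop :=
  ∀ (ξ : ℕ → unitInterval) (r : ℕ → ℕ → ℝ),
    (∃ m, RealRAM.HaltsWithin ξ r (start P T ρ n x) m) ∧
    (RealRAM.time ξ r (start P T ρ n x) : ℝ) ≤ bound ∧
    (RealRAM.final ξ r (start P T ρ n x)).rounds = T ∧
    ∀ t < T, (RealRAM.final ξ r (start P T ρ n x)).arm t < n

/-- `ρ`-reproducibility in every linear bandit environment: two executions with shared internal
randomness and independent noise play the same sequence of `T` arms with probability at least
`1 - ρ`. -/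
def IsReproducible {d : ℕ} (P : List RealRAM.Cmd) (T : ℕ) (ρ : ℝ) (n : ℕ)
    (x : ℕ → EuclideanSpace ℝ (Fin d)) : Prop :=
  ∀ θ : EuclideanSpace ℝ (Fin d), ‖θ‖ ≤ 1 → ∀ ν, IsSubgaussianNoise ν →
    MeasurableSet {ω : (ℕ → unitInterval) × (ℕ → ℝ) × (ℕ → ℝ) |
      ∀ t < T, play P T ρ n x θ ω.1 ω.2.1 t = play P T ρ n x θ ω.1 ω.2.2 t} ∧
    1 - ρ ≤ (seedLaw.prod ((noiseLaw ν).prod (noiseLaw ν))).real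
      {ω | ∀ t < T, play P T ρ n x θ ω.1 ω.2.1 t = play P T ρ n x θ ω.1 ω.2.2 t}

/-- The total mean reward `∑ ⟪θ, a_t⟫` over the `T` rounds, as a function of seed and noise. -/
def meanReward {d : ℕ} (P : List RealRAM.Cmd) (T : ℕ) (ρ : ℝ) (n : ℕ)
    (x : ℕ → EuclideanSpace ℝ (Fin d)) (θ : EuclideanSpace ℝ (Fin d))
    (ω : (ℕ → unitInterval) × (ℕ → ℝ)) : ℝ :=
  ∑ t ∈ Finset.range T, inner ℝ θ (play P T ρ n x θ ω.1 ω.2 t)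

/-- The expected regret `T * sup_{a ∈ A} ⟪θ, a⟫ - 𝔼 ∑ ⟪θ, a_t⟫`. -/
def expectedRegret {d : ℕ} (A : Set (EuclideanSpace ℝ (Fin d))) (P : List RealRAM.Cmd) (T : ℕ)
    (ρ : ℝ) (n : ℕ) (x : ℕ → EuclideanSpace ℝ (Fin d)) (θ : EuclideanSpace ℝ (Fin d))
    (ν : ℕ → ProbabilityMeasure ℝ) : ℝ :=
  T * (⨆ a : A, inner ℝ θ (a : EuclideanSpace ℝ (Fin d))) -
    ∫ ω, meanReward P T ρ n x θ ω ∂(seedLaw.prod (noiseLaw ν))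

/-- `log d * (log log d)^2 * log log log d` for `d ≥ 16`.  For `d ≤ 15`, where `log log log d` is
negative or undefined, the factor is `1`. -/
def logFactor (d : ℕ) : ℝ :=
  if 16 ≤ d then
    Real.log d * Real.log (Real.log d) ^ 2 * Real.log (Real.log (Real.log d))
  else 1

end LinearBandit

end

namespace RealRAM

/-! ### Executions of program fragments -/

/-- The fragment `P` started in `s` ends in `s'` after `m` steps, whatever comes after it. -/
def Exec (ξ : ℕ → unitInterval) (r : ℕ → ℕ → ℝ) (P : List Cmd) (s : State) (m : ℕ)
    (s' : State) : Prop :=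
  ∀ R, (step ξ r)^[m] ⟨P ++ R, s⟩ = ⟨R, s'⟩

/-- The fragment `P` started in `s` ends after at most `N` steps in a state satisfying `Q`. -/
def Run (ξ : ℕ → unitInterval) (r : ℕ → ℕ → ℝ) (P : List Cmd) (s : State) (N : ℕ)
    (Q : State → Prop) : Prop :=
  ∃ m ≤ N, ∃ s', Exec ξ r P s m s' ∧ Q s'

variable {ξ : ℕ → unitInterval} {r : ℕ → ℕ → ℝ}

theorem step_iterate_nil (s : State) (m : ℕ) : (step ξ r)^[m] ⟨[], s⟩ = ⟨[], s⟩ :=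
  Function.iterate_fixed rfl m

theorem Run.nil {s : State} {N : ℕ} {Q : State → Prop} (h : Q s) : Run ξ r [] s N Q :=
  ⟨0, Nat.zero_le _, s, fun _ => rfl, h⟩

theorem Run.mono {P : List Cmd} {s : State} {N N' : ℕ} {Q Q' : State → Prop}
    (h : Run ξ r P s N Q) (hN : N ≤ N') (hQ : ∀ s', Q s' → Q' s') : Run ξ r P s N' Q' := by
  obtain ⟨m, hm, s', he, hq⟩ := h
  exact ⟨m, hm.trans hN, s', he, hQ _ hq⟩

theorem Run.cons {c : Cmd} {P L : List Cmd} {s s₁ : State} {N : ℕ} {Q : State → Prop}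
    (hc : ∀ R, step ξ r ⟨c :: R, s⟩ = ⟨L ++ R, s₁⟩) (h : Run ξ r (L ++ P) s₁ N Q) :
    Run ξ r (c :: P) s (N + 1) Q := by
  obtain ⟨m, hm, s', he, hq⟩ := h
  refine ⟨m + 1, by omega, s', fun R => ?_, hq⟩
  rw [Function.iterate_succ_apply, List.cons_append, hc, ← List.append_assoc]
  exact he R

theorem Run.setN {k : ℕ} {i e : NExpr} {P : List Cmd} {s : State} {N : ℕ} {Q : State → Prop}
    (h : Run ξ r P (s.writeN k (i.val s) (e.val s)) N Q) :
    Run ξ r (.setN k i e :: P) s (N + 1) Q :=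
  Run.cons (L := []) (fun _ => rfl) h

theorem Run.setR {k : ℕ} {i j : NExpr} {e : RExpr} {P : List Cmd} {s : State} {N : ℕ}
    {Q : State → Prop} (h : Run ξ r P (s.writeR k (i.val s) (j.val s) (e.val s)) N Q) :
    Run ξ r (.setR k i j e :: P) s (N + 1) Q :=
  Run.cons (L := []) (fun _ => rfl) h

/-- The state after a random number has been drawn. -/
def State.afterDraw (s : State) (u : ℝ) (k i j : ℕ) : State :=
  { s.writeR k i j u with draws := s.draws + 1 }

/-- The state after arm `a` has been pulled. -/
def State.afterPull (s : State) (v : ℝ) (a k i j : ℕ) : State :=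
  { s.writeR k i j v with
      rounds := s.rounds + 1
      arm := Function.update s.arm s.rounds a }

theorem Run.draw {k : ℕ} {i j : NExpr} {P : List Cmd} {s : State} {N : ℕ} {Q : State → Prop}
    (h : Run ξ r P (s.afterDraw (ξ s.draws) k (i.val s) (j.val s)) N Q) :
    Run ξ r (.draw k i j :: P) s (N + 1) Q :=
  Run.cons (L := []) (fun _ => rfl) h

theorem Run.pull {a : NExpr} {k : ℕ} {i j : NExpr} {P : List Cmd} {s : State} {N : ℕ}
    {Q : State → Prop}
    (h : Run ξ r P (s.afterPull (r s.rounds (a.val s)) (a.val s) k (i.val s) (j.val s)) N Q) :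
    Run ξ r (.pull a k i j :: P) s (N + 1) Q :=
  Run.cons (L := []) (fun _ => rfl) h

theorem Run.append {P₁ P₂ : List Cmd} {s : State} {N₁ N₂ : ℕ} {Q₁ Q : State → Prop}
    (h₁ : Run ξ r P₁ s N₁ Q₁) (h₂ : ∀ s', Q₁ s' → Run ξ r P₂ s' N₂ Q) :
    Run ξ r (P₁ ++ P₂) s (N₁ + N₂) Q := by
  obtain ⟨m, hm, s₁, he, hq⟩ := h₁
  obtain ⟨m', hm', s₂, he', hq'⟩ := h₂ _ hq
  refine ⟨m' + m, by omega, s₂, fun R => ?_, hq'⟩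
  rw [Function.iterate_add_apply, List.append_assoc, he, he']

theorem Run.ite {b : BExpr} {P₁ P₂ : List Cmd} {s : State} {N : ℕ}
    {Q : State → Prop} (ht : b.Holds s → Run ξ r P₁ s N Q) (hf : ¬ b.Holds s → Run ξ r P₂ s N Q) :
    Run ξ r [.ite b P₁ P₂] s (N + 1) Q := by
  by_cases hb : b.Holds s
  · exact Run.cons (L := P₁) (s₁ := s) (fun R => by simp [step, hb]) (by simpa using ht hb)
  · exact Run.cons (L := P₂) (s₁ := s) (fun R => by simp [step, hb]) (by simpa using hf hb)

theorem Run.loop {b : BExpr} {P : List Cmd} {N C : ℕ} (Inv : ℕ → State → Prop)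
    (hb : ∀ i s, Inv i s → b.Holds s → i < N ∧ Run ξ r P s C (Inv (i + 1)))
    {s : State} (h0 : Inv 0 s) :
    Run ξ r [.loop b P] s (N * (C + 1) + 1) (fun s' => ¬ b.Holds s' ∧ ∃ i ≤ N, Inv i s') := by
  have key : ∀ k i s, i + k = N → Inv i s →
      Run ξ r [.loop b P] s (k * (C + 1) + 1)
        (fun s' => ¬ b.Holds s' ∧ ∃ i ≤ N, Inv i s') := by
    intro k
    induction k with
    | zero =>
      intro i s hi hs
      have hn : ¬ b.Holds s := fun h => by have := (hb i s hs h).1; omega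
      exact Run.cons (L := []) (fun R => by simp [step, hn]) (Run.nil ⟨hn, i, by omega, hs⟩)
    | succ k ih =>
      intro i s hi hs
      by_cases h : b.Holds s
      · have := Run.append (hb i s hs h).2 (fun s' hs' => ih (i + 1) s' (by omega) hs')
        refine (Run.cons (L := P ++ [.loop b P]) (s₁ := s) (fun R => by simp [step, h])
          (by simpa using this)).mono ?_ (fun _ h => h)
        rw [Nat.succ_mul]; omega
      · exact (Run.cons (L := []) (N := 0) (fun R => by simp [step, h])
          (Run.nil ⟨h, i, by omega, hs⟩)).mono (by omega) (fun _ h => h)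
  exact key N 0 s (by omega) h0

/-! ### Footprints -/

/-- What a fragment may touch: the natural and the real arrays it may write, and whether it may
pull arms or draw random numbers. -/
structure Foot where
  wn : List ℕ
  wr : List ℕ
  pull : Bool
  draw : Bool

mutual
/-- The instruction stays within the footprint. -/
def Cmd.within (w : Foot) : Cmd → Bool
  | .setN k _ _ => decide (k ∈ w.wn)
  | .setR k _ _ _ => decide (k ∈ w.wr)
  | .draw k _ _ => decide (k ∈ w.wr) && w.draw
  | .pull _ k _ _ => decide (k ∈ w.wr) && w.pull
  | .ite _ P Q => within w P && within w Q
  | .loop _ P => within w P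
/-- All instructions stay within the footprint. -/
def within (w : Foot) : List Cmd → Bool
  | [] => true
  | c :: P => c.within w && within w P
end

theorem within_append {w : Foot} {P Q : List Cmd} :
    within w (P ++ Q) = (within w P && within w Q) := by
  induction P with
  | nil => simp [within]
  | cons c P ih => simp [within, ih, Bool.and_assoc]

/-- The states `s` and `s'` differ only within the footprint. -/
structure Fr (w : Foot) (s s' : State) : Prop where
  nat : ∀ k, k ∉ w.wn → s'.nat k = s.nat k
  real : ∀ k, k ∉ w.wr → s'.real k = s.real k
  rounds : w.pull = false → s'.rounds = s.rounds
  arm : w.pull = false → s'.arm = s.arm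
  draws : w.draw = false → s'.draws = s.draws

theorem Fr.refl (w : Foot) (s : State) : Fr w s s :=
  ⟨fun _ _ => rfl, fun _ _ => rfl, fun _ => rfl, fun _ => rfl, fun _ => rfl⟩

theorem Fr.trans {w : Foot} {s₁ s₂ s₃ : State} (h : Fr w s₁ s₂) (h' : Fr w s₂ s₃) : Fr w s₁ s₃ :=
  ⟨fun k hk => (h'.nat k hk).trans (h.nat k hk), fun k hk => (h'.real k hk).trans (h.real k hk),
    fun hp => (h'.rounds hp).trans (h.rounds hp), fun hp => (h'.arm hp).trans (h.arm hp),
    fun hp => (h'.draws hp).trans (h.draws hp)⟩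

theorem Fr.writeN {w : Foot} {s : State} {k i v : ℕ} (hk : k ∈ w.wn) : Fr w s (s.writeN k i v) := by
  refine ⟨fun k' hk' => ?_, fun _ _ => rfl, fun _ => rfl, fun _ => rfl, fun _ => rfl⟩
  have : k' ≠ k := by rintro rfl; exact hk' hk
  ext i'; simp [State.writeN, this]

theorem Fr.writeR {w : Foot} {s : State} {k i j : ℕ} {v : ℝ} (hk : k ∈ w.wr) :
    Fr w s (s.writeR k i j v) := by
  refine ⟨fun _ _ => rfl, fun k' hk' => ?_, fun _ => rfl, fun _ => rfl, fun _ => rfl⟩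
  have : k' ≠ k := by rintro rfl; exact hk' hk
  ext i' j'; simp [State.writeR, this]

theorem step_within {w : Foot} {c : Config} (h : within w c.code = true) :
    within w (step ξ r c).code = true ∧ Fr w c.state (step ξ r c).state := by
  obtain ⟨P, s⟩ := c
  match P, h with
  | [], _ => exact ⟨rfl, Fr.refl _ _⟩
  | .setN k i e :: R, h =>
    simp only [within, Cmd.within, Bool.and_eq_true, decide_eq_true_eq] at h
    exact ⟨h.2, Fr.writeN h.1⟩
  | .setR k i j e :: R, h =>
    simp only [within, Cmd.within, Bool.and_eq_true, decide_eq_true_eq] at h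
    exact ⟨h.2, Fr.writeR h.1⟩
  | .draw k i j :: R, h =>
    simp only [within, Cmd.within, Bool.and_eq_true, decide_eq_true_eq] at h
    have := Fr.writeR (w := w) (s := s) (i := i.val s) (j := j.val s) (v := ξ s.draws) h.1.1
    exact ⟨h.2, this.nat, this.real, fun _ => rfl, fun _ => rfl, fun hd => by simp_all⟩
  | .pull a k i j :: R, h =>
    simp only [within, Cmd.within, Bool.and_eq_true, decide_eq_true_eq] at h
    have := Fr.writeR (w := w) (s := s) (i := i.val s) (j := j.val s)
      (v := r s.rounds (a.val s)) h.1.1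
    exact ⟨h.2, this.nat, this.real, fun hd => by simp_all, fun hd => by simp_all, fun _ => rfl⟩
  | .ite b P Q :: R, h =>
    simp only [within, Cmd.within, Bool.and_eq_true] at h
    refine ⟨?_, Fr.refl _ _⟩
    by_cases hb : b.Holds s <;> simp [step, hb, within_append, h]
  | .loop b P :: R, h =>
    simp only [within, Cmd.within, Bool.and_eq_true] at h
    refine ⟨?_, Fr.refl _ _⟩
    by_cases hb : b.Holds s <;> simp [step, hb, within_append, within, Cmd.within, h]

theorem iterate_within {w : Foot} {c : Config} (h : within w c.code = true) (m : ℕ) :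
    within w ((step ξ r)^[m] c).code = true ∧ Fr w c.state ((step ξ r)^[m] c).state := by
  induction m with
  | zero => exact ⟨h, Fr.refl _ _⟩
  | succ m ih =>
    rw [Function.iterate_succ_apply']
    exact ⟨(step_within ih.1).1, ih.2.trans (step_within ih.1).2⟩

theorem Exec.frame {w : Foot} {P : List Cmd} {s s' : State} {m : ℕ} (h : Exec ξ r P s m s')
    (hw : within w P = true) : Fr w s s' := by
  have := (iterate_within (ξ := ξ) (r := r) (c := ⟨P ++ [], s⟩) (by simpa using hw) m).2
  rwa [h []] at this

theorem Run.frame {w : Foot} {P : List Cmd} {s : State} {N : ℕ} {Q : State → Prop}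
    (h : Run ξ r P s N Q) (hw : within w P = true) :
    Run ξ r P s N (fun s' => Fr w s s' ∧ Q s') := by
  obtain ⟨m, hm, s', he, hq⟩ := h
  exact ⟨m, hm, s', he, he.frame hw, hq⟩

/-- A fragment without pulls and draws does not depend on the rewards and random numbers. -/
theorem step_eq_of_within {w : Foot} (hp : w.pull = false) (hd : w.draw = false) {c : Config}
    (h : within w c.code = true) (ξ' : ℕ → unitInterval) (r' : ℕ → ℕ → ℝ) :
    step ξ' r' c = step ξ r c := by
  obtain ⟨P, s⟩ := c
  match P, h with
  | [], _ => rfl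
  | .setN k i e :: R, _ => rfl
  | .setR k i j e :: R, _ => rfl
  | .draw k i j :: R, h => simp [within, Cmd.within, hd] at h
  | .pull a k i j :: R, h => simp [within, Cmd.within, hp] at h
  | .ite b P Q :: R, _ => rfl
  | .loop b P :: R, _ => rfl

theorem step_append (c : Cmd) (P R : List Cmd) (s : State) :
    step ξ r ⟨c :: P ++ R, s⟩ =
      ⟨(step ξ r ⟨c :: P, s⟩).code ++ R, (step ξ r ⟨c :: P, s⟩).state⟩ := by
  cases c with
  | ite b P₁ P₂ => simp [step]
  | loop b P₁ => by_cases h : b.Holds s <;> simp [step, h]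
  | _ => rfl

theorem Exec.of_nil {P : List Cmd} {s s' : State} {m : ℕ}
    (h : (step ξ r)^[m] ⟨P, s⟩ = ⟨[], s'⟩) : ∃ m' ≤ m, Exec ξ r P s m' s' := by
  induction m generalizing P s with
  | zero =>
    obtain ⟨rfl, rfl⟩ := Config.mk.inj h
    exact ⟨0, le_rfl, fun _ => rfl⟩
  | succ m ih =>
    cases P with
    | nil =>
      rw [step_iterate_nil] at h
      obtain ⟨-, rfl⟩ := Config.mk.inj h
      exact ⟨0, by omega, fun _ => rfl⟩
    | cons c P =>
      rw [Function.iterate_succ_apply] at h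
      obtain ⟨m', hm', he⟩ := ih h
      refine ⟨m' + 1, by omega, fun R => ?_⟩
      rw [Function.iterate_succ_apply, step_append]
      exact he R

theorem Exec.congr {w : Foot} (hp : w.pull = false) (hd : w.draw = false) {P : List Cmd}
    (hw : within w P = true) {s s' : State} {m : ℕ} (h : Exec ξ r P s m s')
    (ξ' : ℕ → unitInterval) (r' : ℕ → ℕ → ℝ) : ∃ m' ≤ m, Exec ξ' r' P s m' s' := by
  have key : ∀ (m : ℕ) (c : Config), within w c.code = true →
      (step ξ' r')^[m] c = (step ξ r)^[m] c := by
    intro m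
    induction m with
    | zero => intro c _; rfl
    | succ m ih =>
      intro c hc
      rw [Function.iterate_succ_apply, Function.iterate_succ_apply,
        step_eq_of_within (ξ := ξ) (r := r) hp hd hc ξ' r', ih _ (step_within hc).1]
  have h' := h []
  rw [List.append_nil, ← key m _ hw] at h'
  exact Exec.of_nil h'

/-! ### Final states -/

theorem Exec.haltsWithin {P : List Cmd} {s s' : State} {m : ℕ} (h : Exec ξ r P s m s') :
    HaltsWithin ξ r ⟨P, s⟩ m := by
  have := h []
  rw [List.append_nil] at this
  rw [HaltsWithin, this]

theorem final_eq_of_haltsWithin {c : Config} {m : ℕ} (h : HaltsWithin ξ r c m) :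
    time ξ r c ≤ m ∧ final ξ r c = ((step ξ r)^[m] c).state := by
  have hle : time ξ r c ≤ m := Nat.sInf_le h
  refine ⟨hle, ?_⟩
  have ht : HaltsWithin ξ r c (time ξ r c) := Nat.sInf_mem (s := {m | HaltsWithin ξ r c m}) ⟨m, h⟩
  obtain ⟨k, hk⟩ := Nat.exists_eq_add_of_le' hle
  have hc : (step ξ r)^[time ξ r c] c = ⟨[], ((step ξ r)^[time ξ r c] c).state⟩ := by
    rw [HaltsWithin] at ht
    rw [← ht]
  rw [hk, Function.iterate_add_apply, hc, step_iterate_nil]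
  rfl

theorem Exec.final_eq {P : List Cmd} {s s' : State} {m : ℕ} (h : Exec ξ r P s m s') :
    final ξ r ⟨P, s⟩ = s' := by
  have := h []
  rw [List.append_nil] at this
  rw [(final_eq_of_haltsWithin h.haltsWithin).2, this]

theorem Run.final {P : List Cmd} {s : State} {N : ℕ} {Q : State → Prop} (h : Run ξ r P s N Q) :
    Q (final ξ r ⟨P, s⟩) := by
  obtain ⟨m, -, s', he, hq⟩ := h
  rwa [he.final_eq]

theorem Run.haltsWithin {P : List Cmd} {s : State} {N : ℕ} {Q : State → Prop}
    (h : Run ξ r P s N Q) : HaltsWithin ξ r ⟨P, s⟩ N := by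
  obtain ⟨m, hm, s', he, -⟩ := h
  have h1 := he []
  rw [List.append_nil] at h1
  obtain ⟨k, rfl⟩ := Nat.exists_eq_add_of_le' hm
  rw [HaltsWithin, Function.iterate_add_apply, h1, step_iterate_nil]

/-! ### Scalars and counting loops -/

/-- The natural scalar stored in array `k`. -/
abbrev nv (k : ℕ) : NExpr := .read k (.const 0)

/-- The real scalar stored in array `k`. -/
abbrev rv (k : ℕ) : RExpr := .read k (.const 0) (.const 0)

/-- `for k = 0, …, e - 1 do P`. -/
def forTo (k : ℕ) (e : NExpr) (P : List Cmd) : List Cmd :=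
  [.setN k (.const 0) (.const 0),
    .loop (.ltN (nv k) e) (P ++ [.setN k (.const 0) (.add (nv k) (.const 1))])]

theorem Run.forTo {k : ℕ} {e : NExpr} {P : List Cmd} {w : Foot} (hk : k ∈ w.wn)
    (hw : within w P = true) {s₀ : State} {N C : ℕ} (Inv : ℕ → State → Prop)
    (he : ∀ s, Fr w s₀ s → e.val s = N)
    (h0 : Inv 0 (s₀.writeN k 0 0))
    (hb : ∀ i < N, ∀ s, Fr w s₀ s → s.nat k 0 = i → Inv i s →
      Run ξ r P s C (fun s' => s'.nat k 0 = i ∧ Inv (i + 1) (s'.writeN k 0 (i + 1)))) :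
    Run ξ r (forTo k e P) s₀ (N * (C + 2) + 2)
      (fun s' => Fr w s₀ s' ∧ s'.nat k 0 = N ∧ Inv N s') := by
  refine Run.setN ?_
  have := Run.loop (ξ := ξ) (r := r) (b := .ltN (nv k) e)
    (P := P ++ [.setN k (.const 0) (.add (nv k) (.const 1))]) (N := N) (C := C + 1)
    (fun i s => i ≤ N ∧ Fr w s₀ s ∧ s.nat k 0 = i ∧ Inv i s) ?_
    (s := s₀.writeN k 0 0) ⟨Nat.zero_le _, Fr.writeN hk, by simp [State.writeN], h0⟩
  · refine this.mono (by ring_nf; omega) ?_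
    rintro s' ⟨hn, i, hi, -, hf, hki, hI⟩
    have : i = N := by
      simp only [BExpr.Holds, NExpr.val, he s' hf, hki] at hn
      omega
    subst this
    exact ⟨hf, hki, hI⟩
  · rintro i s ⟨hi, hf, hki, hI⟩ hlt
    have hlt : i < N := by simpa only [BExpr.Holds, NExpr.val, he s hf, hki] using hlt
    refine ⟨hlt, Run.append ((hb i hlt s hf hki hI).frame hw) ?_⟩
    rintro s' ⟨hf', hki', hI'⟩
    refine Run.setN (Run.nil ?_)
    simp only [NExpr.val, hki']
    exact ⟨hlt, (hf.trans hf').trans (Fr.writeN hk), by simp [State.writeN], hI'⟩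

end RealRAM

/-! ### The spanner block -/

namespace LinearBandit
open RealRAM

/-- The dimension. -/
abbrev vd : NExpr := .read 0 (.const 0)
/-- The horizon. -/
abbrev vT : NExpr := .read 0 (.const 1)
/-- The number of net points. -/
abbrev vn : NExpr := .read 0 (.const 2)

/-- Start with the basis of small multiples of the unit vectors. -/
def initBasis : List Cmd :=
  forTo 10 vd [.setN 2 (nv 10) (nv 7), .setR 3 (nv 10) (.const 0) (.const 0)]

/-- The coordinates of the net points in the initial basis. -/
def initTab : List Cmd :=
  forTo 9 vn (forTo 10 vd [.setR 2 (nv 9) (nv 10) (.div (.read 1 (nv 9) (nv 10)) (rv 6))])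

/-- Exchange basis vector number `nv 10` for the net point `nv 9`. -/
def pivot : List Cmd :=
  .setR 11 (.const 0) (.const 0) (.read 2 (nv 9) (nv 10)) ::
  (forTo 12 vd [.setR 12 (nv 12) (.const 0) (.read 2 (nv 9) (nv 12))] ++
  (forTo 11 vn
    (.setR 13 (.const 0) (.const 0) (.div (.read 2 (nv 11) (nv 10)) (rv 11)) ::
      (forTo 12 vd [.setR 2 (nv 11) (nv 12)
        (.sub (.read 2 (nv 11) (nv 12)) (.mul (rv 13) (.read 12 (nv 12) (.const 0))))] ++
      [.setR 2 (nv 11) (nv 10) (rv 13)])) ++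
  [.setN 2 (nv 10) (nv 9), .setR 3 (nv 10) (.const 0) (.const 1), .setN 8 (.const 0) (.const 1)]))

/-- The footprint of the spanner block. -/
def spanFoot : Foot := ⟨[2, 8, 9, 10, 11, 12], [2, 3, 11, 12, 13], false, false⟩

variable {ξ : ℕ → unitInterval} {r : ℕ → ℕ → ℝ}

theorem run_initBasis {d : ℕ} (s : State) (hd : s.nat 0 0 = d) :
    Run ξ r initBasis s (d * 4 + 2) (fun s' => Fr ⟨[2, 10], [3], false, false⟩ s s' ∧
      ∀ j < d, s'.nat 2 j = s.nat 7 0 ∧ s'.real 3 j 0 = 0) := by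
  refine (Run.forTo (w := ⟨[2, 10], [3], false, false⟩) (C := 2) (N := d) (by simp) rfl
    (fun i s' => ∀ j < i, s'.nat 2 j = s.nat 7 0 ∧ s'.real 3 j 0 = 0) ?_ ?_ ?_).mono le_rfl
    (fun s' h => ⟨h.1, h.2.2⟩)
  · intro s' hf
    simp [NExpr.val, hf.nat 0 (by simp), hd]
  · simp
  · intro i hi s' hf hk hI
    refine Run.setN (Run.setR (Run.nil ⟨by simp [State.writeN, State.writeR, hk], ?_⟩))
    intro j hj
    have h7 := hf.nat 7 (by simp)
    by_cases hji : j = i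
    · subst hji
      simp [State.writeN, State.writeR, NExpr.val, RExpr.val, hk, h7]
    · have := hI j (by omega)
      simp [State.writeN, State.writeR, NExpr.val, hk, hji, this]

theorem run_initTab {d n : ℕ} (s : State) (hd : s.nat 0 0 = d) (hn : s.nat 0 2 = n) :
    Run ξ r initTab s (n * (d * 3 + 4) + 2) (fun s' => Fr ⟨[9, 10], [2], false, false⟩ s s' ∧
      ∀ a < n, ∀ j < d, s'.real 2 a j = s.real 1 a j / s.real 6 0 0) := by
  refine (Run.forTo (w := ⟨[9, 10], [2], false, false⟩) (C := d * 3 + 2) (N := n) (by simp) rfl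
    (fun i s' => ∀ a < i, ∀ j < d, s'.real 2 a j = s.real 1 a j / s.real 6 0 0) ?_ ?_ ?_).mono le_rfl
    (fun s' h => ⟨h.1, h.2.2⟩)
  · intro s' hf
    simp [NExpr.val, hf.nat 0 (by simp), hn]
  · simp
  · intro i hi s' hf hk hI
    refine (Run.forTo (w := ⟨[10], [2], false, false⟩) (C := 1) (N := d) (by simp) rfl
      (fun l s'' => (∀ a < i, ∀ j < d, s''.real 2 a j = s.real 1 a j / s.real 6 0 0) ∧
        ∀ j < l, s''.real 2 i j = s.real 1 i j / s.real 6 0 0) ?_ ?_ ?_).mono le_rfl ?_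
    · intro s'' hf'
      simp [NExpr.val, hf.nat 0 (by simp), hf'.nat 0 (by simp), hd]
    · exact ⟨hI, by simp⟩
    · intro l hl s'' hf' hk' hI'
      have h9 : s''.nat 9 0 = i := by rw [hf'.nat 9 (by simp), hk]
      have h1 : s''.real 1 = s.real 1 := by rw [hf'.real 1 (by simp), hf.real 1 (by simp)]
      have h6 : s''.real 6 = s.real 6 := by rw [hf'.real 6 (by simp), hf.real 6 (by simp)]
      refine Run.setR (Run.nil ⟨by simp [State.writeR, hk'], ?_, ?_⟩)
      · intro a ha j hj
        simpa [State.writeN, State.writeR, NExpr.val, RExpr.val, h9, hk', ha.ne] using hI'.1 a ha j hj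
      · intro j hj
        by_cases hjl : j = l
        · subst hjl
          simp [State.writeN, State.writeR, NExpr.val, RExpr.val, h9, hk', h1, h6]
        · simpa [State.writeN, State.writeR, NExpr.val, RExpr.val, h9, hk', hjl] using
            hI'.2 j (by omega)
    · rintro s'' ⟨hf', -, h1, h2⟩
      refine ⟨by rw [hf'.nat 9 (by simp), hk], fun a ha j hj => ?_⟩
      rcases Nat.lt_succ_iff_lt_or_eq.1 ha with h | rfl
      · exact h1 a h j hj
      · exact h2 j hj

/-- The tableau after an exchange. -/
noncomputable def pivoted (c : ℕ → ℕ → ℝ) (a₀ j₀ a i : ℕ) : ℝ :=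
  if i = j₀ then c a j₀ / c a₀ j₀ else c a i - c a j₀ / c a₀ j₀ * c a₀ i

theorem run_pivot {d n a₀ j₀ : ℕ} (s : State) (hd : s.nat 0 0 = d) (hn : s.nat 0 2 = n)
    (ha : s.nat 9 0 = a₀) (hj : s.nat 10 0 = j₀) (hjd : j₀ < d) :
    Run ξ r pivot s (n * (d * 3 + 6) + d * 3 + 8) (fun s' =>
      Fr ⟨[2, 8, 11, 12], [2, 3, 11, 12, 13], false, false⟩ s s' ∧
      (∀ a < n, ∀ i < d, s'.real 2 a i = pivoted (s.real 2) a₀ j₀ a i) ∧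
      (∀ i, s'.nat 2 i = if i = j₀ then a₀ else s.nat 2 i) ∧
      (∀ i, s'.real 3 i 0 = if i = j₀ then 1 else s.real 3 i 0) ∧ s'.nat 8 0 = 1) := by
  refine Run.frame (w := ⟨[2, 8, 11, 12], [2, 3, 11, 12, 13], false, false⟩)
    (Run.mono (N := (d * 3 + 2) + ((n * (d * 3 + 6) + 2) + 3) + 1) ?_ (by omega) (fun _ h => h)) rfl
  refine Run.setR ?_
  refine Run.append (Run.forTo (w := ⟨[12], [12], false, false⟩) (C := 1) (N := d) (by simp) rfl
    (fun l s' => ∀ i < l, s'.real 12 i 0 = s.real 2 a₀ i) ?_ (by simp) ?_) ?_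
  · intro s' hf
    simp [NExpr.val, hf.nat 0 (by simp), hd, State.writeR]
  · intro l hl s' hf hk hI
    refine Run.setR (Run.nil ⟨by simp [State.writeR, hk], fun i hi => ?_⟩)
    have h9 : s'.nat 9 0 = a₀ := by rw [hf.nat 9 (by simp)]; exact ha
    have h2 : s'.real 2 = s.real 2 := by
      rw [hf.real 2 (by simp)]; simp [State.writeR]
    by_cases hil : i = l
    · subst hil
      simp [State.writeN, State.writeR, NExpr.val, RExpr.val, h9, h2, hk]
    · simpa [State.writeN, State.writeR, NExpr.val, RExpr.val, h9, h2, hk, hil] using hI i (by omega)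
  rintro s₁ ⟨hf₁, -, h12⟩
  have e0 : s₁.nat 0 = s.nat 0 := by rw [hf₁.nat 0 (by simp)]; rfl
  have e9 : s₁.nat 9 0 = a₀ := by rw [hf₁.nat 9 (by simp)]; exact ha
  have e10 : s₁.nat 10 0 = j₀ := by rw [hf₁.nat 10 (by simp)]; exact hj
  have en2 : s₁.nat 2 = s.nat 2 := by rw [hf₁.nat 2 (by simp)]; rfl
  have e2 : s₁.real 2 = s.real 2 := by rw [hf₁.real 2 (by simp)]; simp [State.writeR]
  have e3 : s₁.real 3 = s.real 3 := by rw [hf₁.real 3 (by simp)]; simp [State.writeR]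
  have e11 : s₁.real 11 0 0 = s.real 2 a₀ j₀ := by
    rw [hf₁.real 11 (by simp)]; simp [State.writeR, RExpr.val, NExpr.val, ha, hj]
  clear hf₁
  refine Run.append (Run.forTo (w := ⟨[11, 12], [2, 13], false, false⟩) (C := d * 3 + 4) (N := n)
    (by simp) rfl (fun l s' => (∀ a < l, ∀ i < d, s'.real 2 a i = pivoted (s.real 2) a₀ j₀ a i) ∧
      ∀ a, l ≤ a → ∀ i, s'.real 2 a i = s.real 2 a i) ?_ (by simp [State.writeN, e2]) ?_) ?_
  · intro s' hf
    simp [NExpr.val, hf.nat 0 (by simp), hn, e0]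
  · rintro l hl s' hf hk ⟨hI₁, hI₂⟩
    refine (Run.setR (N := (d * 3 + 2) + 1) ?_).mono (by omega) (fun _ h => h)
    have e10' : s'.nat 10 0 = j₀ := by rw [hf.nat 10 (by simp), e10]
    have e11' : s'.real 11 0 0 = s.real 2 a₀ j₀ := by rw [hf.real 11 (by simp), e11]
    have e12' : ∀ i < d, s'.real 12 i 0 = s.real 2 a₀ i := by
      rw [hf.real 12 (by simp)]; exact h12
    refine Run.append (Run.forTo (w := ⟨[12], [2], false, false⟩) (C := 1) (N := d) (by simp) rfl
      (fun m s'' => (∀ a < l, ∀ i < d, s''.real 2 a i = pivoted (s.real 2) a₀ j₀ a i) ∧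
        (∀ a, l < a → ∀ i, s''.real 2 a i = s.real 2 a i) ∧
        (∀ i < m, s''.real 2 l i = s.real 2 l i - s.real 2 l j₀ / s.real 2 a₀ j₀ * s.real 2 a₀ i) ∧
        (∀ i, m ≤ i → s''.real 2 l i = s.real 2 l i)) ?_ ?_ ?_) ?_
    · intro s'' hf'
      rw [NExpr.val, hf'.nat 0 (by simp)]
      change s'.nat 0 0 = d
      rw [hf.nat 0 (by simp), e0, hd]
    · simp only [State.writeN, State.writeR]
      refine ⟨by simpa using hI₁, ?_, by simp, ?_⟩
      · intro a ha' i; simpa using hI₂ a ha'.le i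
      · intro i _; simpa using hI₂ l le_rfl i
    · rintro m hm s'' hf' hk' ⟨h1, h2, h3, h4⟩
      have f11 : s''.nat 11 0 = l := by rw [hf'.nat 11 (by simp)]; exact hk
      have f12 : s''.real 12 m 0 = s.real 2 a₀ m := by
        rw [hf'.real 12 (by simp)]; simpa [State.writeR] using e12' m hm
      have f13 : s''.real 13 0 0 = s.real 2 l j₀ / s.real 2 a₀ j₀ := by
        rw [hf'.real 13 (by simp)]
        simp [State.writeR, RExpr.val, NExpr.val, hk, e10', e11', hI₂ l le_rfl]
      refine Run.setR (Run.nil ⟨by simp [State.writeR, hk'], ?_⟩)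
      simp only [State.writeN, State.writeR, NExpr.val, RExpr.val, f11, hk', f12, f13, h4 m le_rfl]
      refine ⟨fun a ha' i hi => ?_, fun a ha' i => ?_, fun i hi => ?_, fun i hi => ?_⟩
      · simpa [ha'.ne] using h1 a ha' i hi
      · simpa [ha'.ne'] using h2 a ha' i
      · by_cases him : i = m
        · subst him; simp
        · simpa [him] using h3 i (by omega)
      · have : i ≠ m := by omega
        simpa [this] using h4 i (by omega)
    · rintro s'' ⟨hf', -, h1, h2, h3, -⟩
      have f11 : s''.nat 11 0 = l := by rw [hf'.nat 11 (by simp)]; exact hk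
      have f10 : s''.nat 10 0 = j₀ := by rw [hf'.nat 10 (by simp)]; exact e10'
      have f13 : s''.real 13 0 0 = s.real 2 l j₀ / s.real 2 a₀ j₀ := by
        rw [hf'.real 13 (by simp)]
        simp [State.writeR, RExpr.val, NExpr.val, hk, e10', e11', hI₂ l le_rfl]
      refine Run.setR (Run.nil ⟨by simp [State.writeR, f11], ?_⟩)
      simp only [State.writeN, State.writeR, NExpr.val, RExpr.val, f11, f10, f13]
      refine ⟨fun a ha' i hi => ?_, fun a ha' i => ?_⟩
      · rcases Nat.lt_succ_iff_lt_or_eq.1 ha' with h | rfl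
        · simpa [h.ne] using h1 a h i hi
        · by_cases hij : i = j₀
          · subst hij; simp [pivoted]
          · simpa [hij, pivoted] using h3 i hi
      · have : a ≠ l := by omega
        simpa [this] using h2 a (by omega) i
  · rintro s₂ ⟨hf, -, h1, -⟩
    have f10 : s₂.nat 10 0 = j₀ := by rw [hf.nat 10 (by simp), e10]
    have f9 : s₂.nat 9 0 = a₀ := by rw [hf.nat 9 (by simp), e9]
    have g2 : s₂.nat 2 = s.nat 2 := by rw [hf.nat 2 (by simp), en2]
    have g3 : s₂.real 3 = s.real 3 := by rw [hf.real 3 (by simp), e3]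
    refine Run.setN (Run.setR (Run.setN (Run.nil ?_)))
    simp only [State.writeN, State.writeR, NExpr.val, RExpr.val, f10, f9, g2, g3]
    refine ⟨?_, ?_, ?_, ?_⟩
    · simpa using h1
    · simp
    · simp
    · simp

end LinearBandit

namespace LinearBandit
open RealRAM

/-- One pass through the tableau, exchanging at every active point with a large coordinate. -/
def scan : List Cmd :=
  forTo 9 vn (forTo 10 vd
    [.ite (.and (.ltN (.const 0) (.read 1 (nv 9)))
        (.ltR (.const 4) (.mul (.read 2 (nv 9) (nv 10)) (.read 2 (nv 9) (nv 10))))) pivot []])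

/-- Compute a set of at most `d` active points with respect to which, together with small multiples
of unit vectors, all active points have coordinates in `[-2, 2]`. -/
def spanner : List Cmd :=
  initBasis ++ (initTab ++
    [.setN 8 (.const 0) (.const 1),
      .loop (.ltN (.const 0) (nv 8)) (.setN 8 (.const 0) (.const 0) :: scan)])

/-- The tableau holds the coordinates of the points `x` in the basis `b`; basis vector `i` is an
active point (flag `1`) or `eps` times a unit vector (flag `0`). -/
structure TabInv {d : ℕ} (n : ℕ) (x : ℕ → Fin d → ℝ) (act : ℕ → ℕ) (champ : ℕ) (eps : ℝ)
    (s : State) (b : Matrix (Fin d) (Fin d) ℝ) : Prop where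
  rep : ∀ a < n, x a = ∑ i : Fin d, s.real 2 a i • b i
  slot : ∀ i : Fin d,
    (s.real 3 i 0 = 1 ∧ s.nat 2 i < n ∧ 0 < act (s.nat 2 i) ∧ b i = x (s.nat 2 i)) ∨
    (s.real 3 i 0 = 0 ∧ s.nat 2 i = champ ∧ b i = Pi.single i eps)

theorem sum_pivoted {d : ℕ} {c : ℕ → ℕ → ℝ} {a₀ : ℕ} {j₀ : Fin d} (hp : c a₀ j₀ ≠ 0)
    {b : Matrix (Fin d) (Fin d) ℝ} {v₀ v : Fin d → ℝ} {a : ℕ}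
    (h₀ : v₀ = ∑ i : Fin d, c a₀ i • b i) (h : v = ∑ i : Fin d, c a i • b i) :
    v = ∑ i : Fin d, pivoted c a₀ j₀ a i • b.updateRow j₀ v₀ i := by
  have h₁ : ∀ i ∈ Finset.univ.erase j₀, pivoted c a₀ j₀ a i • b.updateRow j₀ v₀ i =
      c a i • b i - (c a j₀ / c a₀ j₀) • (c a₀ i • b i) := by
    intro i hi
    have hi : i ≠ j₀ := by simpa using hi
    have hi' : (i : ℕ) ≠ j₀ := fun h => hi (Fin.ext h)
    rw [Matrix.updateRow_ne hi, pivoted, if_neg hi', sub_smul, smul_smul]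
  rw [← Finset.add_sum_erase _ _ (Finset.mem_univ j₀)] at h₀ h ⊢
  rw [Finset.sum_congr rfl h₁, Finset.sum_sub_distrib, ← Finset.smul_sum, Matrix.updateRow_self]
  rw [eq_sub_iff_add_eq'.2 h₀.symm, eq_sub_iff_add_eq'.2 h.symm]
  simp only [pivoted, if_true, smul_sub, smul_smul]
  rw [div_mul_cancel₀ _ hp]
  abel

theorem det_exchange {d : ℕ} {c : Fin d → ℝ} {j₀ : Fin d} {b : Matrix (Fin d) (Fin d) ℝ}
    {v₀ : Fin d → ℝ} (h₀ : v₀ = ∑ i : Fin d, c i • b i) :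
    (b.updateRow j₀ v₀).det = c j₀ * b.det := by
  rw [h₀, Matrix.det_updateRow_sum, smul_eq_mul]

variable {ξ : ℕ → unitInterval} {r : ℕ → ℕ → ℝ}

theorem TabInv.pivot {d n : ℕ} {x : ℕ → Fin d → ℝ} {act : ℕ → ℕ} {champ : ℕ} {eps : ℝ}
    {s s' : State} {b : Matrix (Fin d) (Fin d) ℝ} (h : TabInv n x act champ eps s b) {a₀ : ℕ}
    {j₀ : Fin d} (ha : a₀ < n) (hact : 0 < act a₀) (hp : s.real 2 a₀ j₀ ≠ 0)
    (h2 : ∀ a < n, ∀ i < d, s'.real 2 a i = pivoted (s.real 2) a₀ j₀ a i)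
    (hn : ∀ i, s'.nat 2 i = if i = j₀ then a₀ else s.nat 2 i)
    (h3 : ∀ i, s'.real 3 i 0 = if i = j₀ then 1 else s.real 3 i 0) :
    TabInv n x act champ eps s' (b.updateRow j₀ (x a₀)) := by
  refine ⟨fun a ha' => ?_, fun i => ?_⟩
  · rw [sum_pivoted hp (h.rep a₀ ha) (h.rep a ha')]
    exact Finset.sum_congr rfl fun i _ => by rw [h2 a ha' i i.2]
  · by_cases hi : i = j₀
    · subst hi
      left
      simp [hn, h3, ha, hact]
    · have hi' : (i : ℕ) ≠ j₀ := fun h => hi (Fin.ext h)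
      rw [hn, h3, if_neg hi', if_neg hi', Matrix.updateRow_ne hi]
      exact h.slot i

theorem TabInv.congr {d n : ℕ} {x : ℕ → Fin d → ℝ} {act : ℕ → ℕ} {champ : ℕ} {eps : ℝ}
    {s s' : State} {b : Matrix (Fin d) (Fin d) ℝ} (h : TabInv n x act champ eps s b)
    (h2 : s'.real 2 = s.real 2) (h3 : s'.real 3 = s.real 3) (hn : s'.nat 2 = s.nat 2) :
    TabInv n x act champ eps s' b :=
  ⟨by rw [h2]; exact h.rep, by rw [h3, hn]; exact h.slot⟩

/-- The tableau belongs to a basis whose determinant is at least `eps ^ d * 2 ^ k`. -/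
def Grown {d : ℕ} (n : ℕ) (x : ℕ → Fin d → ℝ) (act : ℕ → ℕ) (champ : ℕ) (eps : ℝ) (k : ℕ)
    (s : State) : Prop :=
  ∃ b : Matrix (Fin d) (Fin d) ℝ, TabInv n x act champ eps s b ∧ eps ^ d * 2 ^ k ≤ |b.det|

theorem Grown.congr {d n : ℕ} {x : ℕ → Fin d → ℝ} {act : ℕ → ℕ} {champ : ℕ} {eps : ℝ} {k : ℕ}
    {s s' : State} (h : Grown n x act champ eps k s)
    (h2 : s'.real 2 = s.real 2) (h3 : s'.real 3 = s.real 3) (hn : s'.nat 2 = s.nat 2) :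
    Grown n x act champ eps k s' := by
  obtain ⟨b, hb, hk⟩ := h
  exact ⟨b, hb.congr h2 h3 hn, hk⟩

/-- The state of a pass: nothing exchanged yet, and the pairs seen so far are fine, or some exchange
has taken place. -/
def ScanInv {d : ℕ} (n : ℕ) (x : ℕ → Fin d → ℝ) (act : ℕ → ℕ) (champ : ℕ) (eps : ℝ) (k : ℕ)
    (S : ℕ → ℕ → Prop) (s : State) : Prop :=
  (s.nat 8 0 = 0 ∧ Grown n x act champ eps k s ∧
    ∀ a < n, ∀ j < d, S a j → 0 < act a → s.real 2 a j * s.real 2 a j ≤ 4) ∨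
  (s.nat 8 0 = 1 ∧ Grown n x act champ eps (k + 1) s)

theorem ScanInv.congr {d n : ℕ} {x : ℕ → Fin d → ℝ} {act : ℕ → ℕ} {champ : ℕ} {eps : ℝ} {k : ℕ}
    {S S' : ℕ → ℕ → Prop} {s s' : State} (h : ScanInv n x act champ eps k S s)
    (h8 : s'.nat 8 = s.nat 8) (h2 : s'.real 2 = s.real 2) (h3 : s'.real 3 = s.real 3)
    (hn : s'.nat 2 = s.nat 2) (hS : ∀ a < n, ∀ j < d, S' a j → S a j) :
    ScanInv n x act champ eps k S' s' := by
  rcases h with ⟨h, hg, ha⟩ | ⟨h, hg⟩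
  · exact .inl ⟨by rw [h8, h], hg.congr h2 h3 hn, fun a han j hj hs => by
      rw [h2]; exact ha a han j hj (hS a han j hj hs)⟩
  · exact .inr ⟨by rw [h8, h], hg.congr h2 h3 hn⟩

theorem run_scan {d n : ℕ} (x : ℕ → Fin d → ℝ) (champ : ℕ) (eps : ℝ) (heps : 0 ≤ eps) (k : ℕ)
    (s : State) (hd : s.nat 0 0 = d) (hn : s.nat 0 2 = n) (h8 : s.nat 8 0 = 0)
    (hg : Grown n x (s.nat 1) champ eps k s) :
    Run ξ r scan s (n * (d * (n * (d * 3 + 6) + d * 3 + 11) + 4) + 2) (fun s' =>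
      ScanInv n x (s.nat 1) champ eps k (fun _ _ => True) s') := by
  refine (Run.forTo (w := spanFoot) (N := n) (C := d * (n * (d * 3 + 6) + d * 3 + 11) + 2)
    (by simp [spanFoot]) rfl
    (fun l s' => ScanInv n x (s.nat 1) champ eps k (fun a _ => a < l) s') ?_ ?_ ?_).mono le_rfl ?_
  · intro s' hf
    simp [NExpr.val, hf.nat 0 (by simp [spanFoot]), hn]
  · refine .inl ⟨by simp [State.writeN, h8], hg.congr rfl rfl ?_, by simp⟩
    simp [State.writeN]
  · intro l hl s' hf hk hI
    have e0 : s'.nat 0 = s.nat 0 := hf.nat 0 (by simp [spanFoot])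
    have e1 : s'.nat 1 = s.nat 1 := hf.nat 1 (by simp [spanFoot])
    refine (Run.forTo (w := ⟨[2, 8, 10, 11, 12], [2, 3, 11, 12, 13], false, false⟩) (N := d)
      (C := n * (d * 3 + 6) + d * 3 + 9) (by simp) rfl
      (fun m s' => ScanInv n x (s.nat 1) champ eps k (fun a j => a < l ∨ (a = l ∧ j < m)) s')
      ?_ ?_ ?_).mono le_rfl ?_
    · intro s'' hf'
      simp [NExpr.val, hf'.nat 0 (by simp), e0, hd]
    · refine hI.congr ?_ rfl rfl ?_ ?_ <;> simp [State.writeN]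
    · intro m hm s'' hf' hk' hI'
      have f9 : s''.nat 9 0 = l := by rw [hf'.nat 9 (by simp), hk]
      have f0 : s''.nat 0 = s.nat 0 := by rw [hf'.nat 0 (by simp), e0]
      have f1 : s''.nat 1 = s.nat 1 := by rw [hf'.nat 1 (by simp), e1]
      refine Run.ite (N := n * (d * 3 + 6) + d * 3 + 8) (fun hb => ?_) (fun hb => ?_)
      · simp only [BExpr.Holds, NExpr.val, RExpr.val, f9, hk', f1] at hb
        obtain ⟨hact, hbig⟩ := hb
        refine (run_pivot s'' (by rw [f0, hd]) (by rw [f0, hn]) f9 hk' hm).mono le_rfl ?_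
        rintro t ⟨hft, h2, hn2, h3, h8⟩
        refine ⟨by rw [hft.nat 10 (by simp), hk'], .inr ⟨by simp [State.writeN, h8], ?_⟩⟩
        have hp : s''.real 2 l ((⟨m, hm⟩ : Fin d) : ℕ) ≠ 0 := by
          intro h0
          simp only at h0
          rw [h0] at hbig
          norm_num at hbig
        have hG : Grown n x (s.nat 1) champ eps k s'' := by
          have hmono : ∀ b : Matrix (Fin d) (Fin d) ℝ, eps ^ d * 2 ^ (k + 1) ≤ |b.det| →
              eps ^ d * 2 ^ k ≤ |b.det| := fun b hb => by
            refine le_trans ?_ hb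
            have : (2 : ℝ) ^ k ≤ 2 ^ (k + 1) := pow_le_pow_right₀ (by norm_num) (by omega)
            gcongr
          rcases hI' with ⟨-, h, -⟩ | ⟨-, b, h, h'⟩
          · exact h
          · exact ⟨b, h, hmono b h'⟩
        obtain ⟨b, hb, hdet⟩ := hG
        have key := hb.pivot (s' := t) (a₀ := l) (j₀ := ⟨m, hm⟩) hl hact hp h2 hn2 h3
        refine ⟨_, key.congr rfl rfl (by simp [State.writeN]), ?_⟩
        rw [det_exchange (c := fun i => s''.real 2 l i) (hb.rep l hl), abs_mul, pow_succ, ← mul_assoc,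
          mul_comm]
        have h2' : (2 : ℝ) ≤ |s''.real 2 l m| := by
          by_contra hlt
          push Not at hlt
          have := mul_self_lt_mul_self (abs_nonneg _) hlt
          rw [abs_mul_abs_self] at this
          have h4 : ((4 : ℚ) : ℝ) = 4 := by norm_num
          rw [h4] at hbig
          linarith
        gcongr
      · refine Run.nil ⟨hk', ?_⟩
        rcases hI' with ⟨h, hg', ha⟩ | ⟨h, hg'⟩
        · refine .inl ⟨by simp [State.writeN, h], hg'.congr rfl rfl (by simp [State.writeN]), ?_⟩
          intro a han j hj hs hact
          change s''.real 2 a j * s''.real 2 a j ≤ 4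
          by_cases hc : a = l ∧ j = m
          · obtain ⟨rfl, rfl⟩ := hc
            simp only [BExpr.Holds, NExpr.val, RExpr.val, f9, hk', f1, not_and, not_lt] at hb
            simpa using hb hact
          · exact ha a han j hj (by omega) hact
        · exact .inr ⟨by simp [State.writeN, h], hg'.congr rfl rfl (by simp [State.writeN])⟩
    · rintro s'' ⟨hf', -, hI'⟩
      refine ⟨by rw [hf'.nat 9 (by simp), hk], ?_⟩
      refine hI'.congr ?_ rfl rfl ?_ ?_
      · simp [State.writeN]
      · simp [State.writeN]
      · intro a _ j hj h; omega
  · rintro s' ⟨-, -, h⟩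
    exact h.congr rfl rfl rfl rfl (fun a ha _ _ _ => ha)

theorem pow_le_of_det {d B k : ℕ} {b : Matrix (Fin d) (Fin d) ℝ} (hb : ∀ i j, |b i j| ≤ 1)
    (h : ((1 / 2 : ℝ) ^ B) ^ d * 2 ^ k ≤ |b.det|) : k ≤ d * (d + B) := by
  have h1 : |b.det| ≤ d.factorial := by
    have := Matrix.det_le (A := b) (abv := IsAbsoluteValue.toAbsoluteValue (abs : ℝ → ℝ)) (x := 1)
      (fun i j => hb i j)
    simpa using this
  have h2 : (d.factorial : ℝ) ≤ 2 ^ (d * d) := by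
    have h3 : d.factorial ≤ 2 ^ (d * d) :=
      (Nat.factorial_le_pow d).trans (by
        rw [pow_mul]; exact Nat.pow_le_pow_left (Nat.lt_two_pow_self).le d)
    exact_mod_cast h3
  have h3 : (2 : ℝ) ^ k ≤ 2 ^ (d * (d + B)) := by
    have h4 : ((1 / 2 : ℝ) ^ B) ^ d * 2 ^ (B * d) = 1 := by
      rw [← pow_mul, ← mul_pow]; norm_num
    calc (2 : ℝ) ^ k = ((1 / 2 : ℝ) ^ B) ^ d * 2 ^ k * 2 ^ (B * d) := by
          rw [mul_right_comm, h4, one_mul]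
      _ ≤ 2 ^ (d * d) * 2 ^ (B * d) := by gcongr; exact (h.trans h1).trans h2
      _ = 2 ^ (d * (d + B)) := by rw [← pow_add]; ring_nf
  exact (pow_le_pow_iff_right₀ (by norm_num)).1 h3

theorem run_spanner {d n B : ℕ} (x : ℕ → Fin d → ℝ) (s : State) (hd : s.nat 0 0 = d)
    (hn : s.nat 0 2 = n) (hx : ∀ a < n, ∀ j : Fin d, s.real 1 a j = x a j)
    (hx1 : ∀ a < n, ∀ j, |x a j| ≤ 1) (heps : s.real 6 0 0 = (1 / 2) ^ B) :
    Run ξ r spanner s (d * 4 + 2 + (n * (d * 3 + 4) + 2 +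
        ((d * (d + B) + 1) * (n * (d * (n * (d * 3 + 6) + d * 3 + 11) + 4) + 4) + 2))) (fun s' =>
      Fr spanFoot s s' ∧ ∃ b : Matrix (Fin d) (Fin d) ℝ,
        TabInv n x (s.nat 1) (s.nat 7 0) ((1 / 2) ^ B) s' b ∧
        ∀ a < n, ∀ j < d, 0 < s.nat 1 a → s'.real 2 a j * s'.real 2 a j ≤ 4) := by
  refine Run.frame ?_ rfl
  refine Run.append (run_initBasis s hd) ?_
  rintro s₁ ⟨hf₁, hb⟩
  have a0 : s₁.nat 0 = s.nat 0 := hf₁.nat 0 (by simp)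
  refine Run.append (run_initTab (d := d) (n := n) s₁ (by rw [a0, hd]) (by rw [a0, hn])) ?_
  rintro s₂ ⟨hf₂, ht⟩
  have b0 : s₂.nat 0 = s.nat 0 := by rw [hf₂.nat 0 (by simp), a0]
  have b1 : s₂.nat 1 = s.nat 1 := by rw [hf₂.nat 1 (by simp), hf₁.nat 1 (by simp)]
  have b2 : ∀ j < d, s₂.nat 2 j = s.nat 7 0 := by
    rw [hf₂.nat 2 (by simp)]; exact fun j hj => (hb j hj).1
  have b3 : ∀ j < d, s₂.real 3 j 0 = 0 := by
    rw [hf₂.real 3 (by simp)]; exact fun j hj => (hb j hj).2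
  rw [hf₁.real 1 (by simp), hf₁.real 6 (by simp), heps] at ht
  clear hf₁ hf₂ hb
  set eps : ℝ := (1 / 2) ^ B with he
  have hpos : 0 < eps := by positivity
  have hle : eps ≤ 1 := pow_le_one₀ (by norm_num) (by norm_num)
  refine (Run.setN (N := _ + 1) (Run.loop (N := d * (d + B) + 1)
    (C := n * (d * (n * (d * 3 + 6) + d * 3 + 11) + 4) + 3)
    (fun k s' => Fr spanFoot s₂ s' ∧ ((s'.nat 8 0 = 1 ∧ Grown n x (s.nat 1) (s.nat 7 0) eps k s') ∨
      (s'.nat 8 0 = 0 ∧ ∃ b : Matrix (Fin d) (Fin d) ℝ, TabInv n x (s.nat 1) (s.nat 7 0) eps s' b ∧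
        ∀ a < n, ∀ j < d, 0 < s.nat 1 a → s'.real 2 a j * s'.real 2 a j ≤ 4))) ?_
    ?_)).mono (by ring_nf; omega) ?_
  · rintro k t ⟨hf, hI⟩ hlt
    simp only [BExpr.Holds, NExpr.val] at hlt
    rcases hI with ⟨h8, b, hb, hdet⟩ | ⟨h8, -⟩
    swap
    · omega
    have hbd : ∀ i j, |b i j| ≤ 1 := by
      intro i j
      rcases hb.slot i with ⟨-, hl, -, h⟩ | ⟨-, -, h⟩
      · rw [h]; exact hx1 _ hl j
      · rw [h]
        by_cases hij : j = i
        · subst hij; simp [abs_of_pos hpos, hle]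
        · simp [hij]
    have hk : k ≤ d * (d + B) := pow_le_of_det hbd (by rw [← he]; exact hdet)
    refine ⟨by omega, ?_⟩
    have hfw : Fr spanFoot s₂ (t.writeN 8 0 0) := hf.trans (Fr.writeN (by simp [spanFoot]))
    have c0 : (t.writeN 8 0 0).nat 0 = s.nat 0 := by
      rw [hfw.nat 0 (by simp [spanFoot]), b0]
    have c1 : (t.writeN 8 0 0).nat 1 = s.nat 1 := by
      rw [hfw.nat 1 (by simp [spanFoot]), b1]
    refine Run.setN ?_
    refine ((run_scan x (s.nat 7 0) eps hpos.le k (t.writeN 8 0 0) (by rw [c0, hd]) (by rw [c0, hn])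
      (by simp [State.writeN]) ?_).frame (w := spanFoot) rfl).mono le_rfl ?_
    · rw [c1]
      exact ⟨b, hb.congr rfl rfl (by simp [State.writeN]), hdet⟩
    · rintro t' ⟨hft, h⟩
      rw [c1] at h
      refine ⟨hfw.trans hft, ?_⟩
      rcases h with ⟨h, ⟨b, hb, -⟩, ha⟩ | h
      · exact .inr ⟨h, b, hb, fun a ha' j hj => ha a ha' j hj trivial⟩
      · exact .inl h
  · refine ⟨Fr.writeN (by simp [spanFoot]), .inl ⟨by simp [State.writeN, NExpr.val], ?_⟩⟩
    refine ⟨Matrix.diagonal fun _ => eps, ⟨fun a ha => ?_, fun i => .inr ⟨?_, ?_, ?_⟩⟩, ?_⟩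
    · ext j
      rw [Finset.sum_apply, Finset.sum_eq_single j]
      · change x a j = s₂.real 2 a j * Matrix.diagonal (fun _ => eps) j j
        rw [ht a ha j j.2, hx a ha, Matrix.diagonal_apply_eq, div_mul_cancel₀ _ hpos.ne']
      · intro i _ hij
        change _ * Matrix.diagonal (fun _ => eps) i j = 0
        rw [Matrix.diagonal_apply_ne _ hij, mul_zero]
      · simp
    · exact b3 i i.2
    · simpa [State.writeN] using b2 i i.2
    · ext j
      by_cases hij : i = j
      · subst hij; simp
      · simp [hij, Ne.symm hij]
    · rw [Matrix.det_diagonal]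
      simp [abs_of_pos hpos]
  · rintro s' ⟨hn8, k, -, -, h⟩
    rcases h with ⟨h8, -⟩ | ⟨-, h⟩
    · simp [BExpr.Holds, NExpr.val, h8] at hn8
    · exact h

end LinearBandit

namespace RealRAM

theorem State.ext {s s' : State} (h₁ : ∀ k i, s.nat k i = s'.nat k i)
    (h₂ : ∀ k i j, s.real k i j = s'.real k i j) (h₃ : s.draws = s'.draws)
    (h₄ : s.rounds = s'.rounds) (h₅ : ∀ t, s.arm t = s'.arm t) : s = s' := by
  obtain ⟨_, _, _, _, _⟩ := s
  obtain ⟨_, _, _, _, _⟩ := s'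
  simp only [State.mk.injEq]
  exact ⟨by ext; apply h₁, by ext; apply h₂, h₃, h₄, by ext; apply h₅⟩

end RealRAM

namespace LinearBandit
open RealRAM

/-! ### The estimation block -/

/-- The width `ell * d * eps / ρ` of the rounding grid. -/
def alphaE : RExpr := .div (.mul (.mul (.ofNat (nv 4)) (.ofNat vd)) (rv 6)) (rv 0)

/-- The width of the rounding grid in state `s`. -/
noncomputable def alpha (s : State) : ℝ := s.nat 4 0 * s.nat 0 0 * s.real 6 0 0 / s.real 0 0 0

theorem val_alphaE (s : State) : alphaE.val s = alpha s := rfl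

/-- Pull basis arm `nv 10` `nv 5` times, round the mean reward up to the shifted grid, and clear the
unrounded data. -/
def slot : List Cmd :=
  .setR 8 (.const 0) (.const 0) (.const 0) ::
  (forTo 12 (nv 5) [.pull (.read 2 (nv 10)) 9 (.const 0) (.const 0),
    .setR 8 (.const 0) (.const 0) (.add (rv 8) (rv 9))] ++
  (.setR 10 (.const 0) (.const 0) (.sub (.sub (.mul alphaE (rv 7)) alphaE) (.const 2)) ::
  ([.loop (.and (.ltR (rv 10) (.div (rv 8) (.ofNat (nv 5)))) (.ltR (rv 10) (.const 2)))
      [.setR 10 (.const 0) (.const 0) (.add (rv 10) alphaE)]] ++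
  [.setR 4 (nv 10) (.const 0) (rv 10),
    .setR 8 (.const 0) (.const 0) (.const 0),
    .setR 9 (.const 0) (.const 0) (.const 0),
    .setN 6 (.const 0) (.add (nv 6) (nv 5))])))

/-- `slot` for all basis vectors. -/
def slots : List Cmd := forTo 10 vd slot

/-- The number of grid steps until `y` or `2` is reached. -/
noncomputable def gridSteps (z₀ α y : ℝ) : ℕ := sInf {k : ℕ | ¬ (z₀ + k * α < y ∧ z₀ + k * α < 2)}

/-- `y` rounded up to the grid `z₀ + ℕ α` (not beyond `2`). -/
noncomputable def gridRound (z₀ α y : ℝ) : ℝ := z₀ + gridSteps z₀ α y * α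

theorem gridRound_congr {z₀ α y y' : ℝ} (h : ∀ k : ℕ, z₀ + k * α < y ↔ z₀ + k * α < y') :
    gridRound z₀ α y = gridRound z₀ α y' := by
  simp only [gridRound, gridSteps, h]

theorem gridSteps_spec {z₀ α y : ℝ} (hα : 0 < α) :
    ¬ (z₀ + gridSteps z₀ α y * α < y ∧ z₀ + gridSteps z₀ α y * α < 2) := by
  have hne : {k : ℕ | ¬ (z₀ + k * α < y ∧ z₀ + k * α < 2)}.Nonempty := by
    obtain ⟨k, hk⟩ := exists_nat_gt ((2 - z₀) / α)
    refine ⟨k, fun h => ?_⟩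
    rw [div_lt_iff₀ hα] at hk
    linarith [h.2]
  exact Nat.sInf_mem hne

theorem lt_of_lt_gridSteps {z₀ α y : ℝ} {k : ℕ} (hk : k < gridSteps z₀ α y) :
    z₀ + k * α < y ∧ z₀ + k * α < 2 := by
  by_contra h
  exact absurd (Nat.sInf_le (s := {k : ℕ | ¬ (z₀ + k * α < y ∧ z₀ + k * α < 2)}) h) (by
    rw [not_le]; exact hk)

theorem abs_gridRound_sub_le {z₀ α y : ℝ} (hα : 0 < α) (h₀ : z₀ ≤ y) (hy : y ≤ 2) :
    |gridRound z₀ α y - y| ≤ α := by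
  have h1 : y ≤ gridRound z₀ α y := by
    have := gridSteps_spec (z₀ := z₀) (y := y) hα
    by_contra hlt
    push Not at hlt
    exact this ⟨hlt, hlt.trans_le hy⟩
  rw [abs_of_nonneg (by linarith)]
  rcases Nat.eq_zero_or_pos (gridSteps z₀ α y) with h | h
  · simp only [gridRound, h, Nat.cast_zero, zero_mul]; linarith
  · have := (lt_of_lt_gridSteps (show gridSteps z₀ α y - 1 < gridSteps z₀ α y by omega)).1
    rw [Nat.cast_sub h, Nat.cast_one] at this
    simp only [gridRound]
    linarith

/-- The mean reward in slot `nv 10`. -/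
noncomputable def slotMean (r : ℕ → ℕ → ℝ) (s : State) : ℝ :=
  (∑ i ∈ Finset.range (s.nat 5 0), r (s.rounds + i) (s.nat 2 (s.nat 10 0))) / s.nat 5 0

/-- The first grid point. -/
noncomputable def gridStart (s : State) : ℝ := alpha s * s.real 7 0 0 - alpha s - 2

/-- The state during the pulls of a slot. -/
def pullState (s : State) (i : ℕ) (S v : ℝ) : State :=
  { ((s.writeN 12 0 i).writeR 8 0 0 S).writeR 9 0 0 v with
    rounds := s.rounds + i
    arm := fun t => if s.rounds ≤ t ∧ t < s.rounds + i then s.nat 2 (s.nat 10 0) else s.arm t }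

/-- The state after a slot with rounded mean `z`. -/
def slotOut (s : State) (z : ℝ) : State :=
  (((((pullState s (s.nat 5 0) 0 0).writeR 10 0 0 z).writeR 4 (s.nat 10 0) 0 z).writeR 8 0 0 0).writeR
    9 0 0 0).writeN 6 0 (s.nat 6 0 + s.nat 5 0)

variable {ξ : ℕ → unitInterval} {r : ℕ → ℕ → ℝ}

theorem run_slot (s : State) {N : ℕ} (hα : 0 < alpha s) (hu : 0 ≤ s.real 7 0 0)
    (hN : 4 + alpha s ≤ N * alpha s) :
    Run ξ r slot s (s.nat 5 0 * 4 + N * 2 + 9)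
      (fun s' => s' = slotOut s (gridRound (gridStart s) (alpha s) (slotMean r s))) := by
  refine (Run.setR (N := (s.nat 5 0 * 4 + 2) + (((N * 2 + 1) + 4) + 1)) ?_).mono (by omega)
    (fun _ h => h)
  refine Run.append (Run.forTo (w := ⟨[12], [8, 9], true, false⟩) (N := s.nat 5 0) (C := 2)
    (by simp) rfl (fun i s' => ∃ v, s' = pullState s i
      (∑ l ∈ Finset.range i, r (s.rounds + l) (s.nat 2 (s.nat 10 0))) v) ?_ ?_ ?_) ?_
  · intro s' hf
    rw [NExpr.val, hf.nat 5 (by simp)]; rfl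
  · refine ⟨s.real 9 0 0, State.ext ?_ ?_ rfl rfl ?_⟩
    · intro k i; simp [pullState, State.writeN, State.writeR]
    · intro k i j
      simp only [pullState, State.writeN, State.writeR, NExpr.val, RExpr.val]
      by_cases h8 : k = 8
      · subst h8; simp
      · by_cases h9 : k = 9
        · subst h9; simp +contextual
        · simp [h8, h9]
    · intro t
      simp only [pullState, State.writeN, State.writeR]
      rw [if_neg (by omega)]
  · rintro i hi s' hf hk ⟨v, rfl⟩
    refine Run.pull (Run.setR (Run.nil ⟨?_, ?_⟩))
    · simp [pullState, State.writeN, State.writeR, State.afterPull]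
    · refine ⟨r (s.rounds + i) (s.nat 2 (s.nat 10 0)), State.ext ?_ ?_ rfl
        (by simp only [pullState, State.writeN, State.writeR, State.afterPull]; omega) ?_⟩
      · intro k j
        simp only [pullState, State.writeN, State.writeR, State.afterPull]
        split_ifs <;> rfl
      · intro k j l
        simp only [pullState, State.writeN, State.writeR, State.afterPull, NExpr.val, RExpr.val,
          Finset.sum_range_succ]
        by_cases h8 : k = 8
        · subst h8; simp; split_ifs <;> rfl
        · by_cases h9 : k = 9
          · subst h9; simp; split_ifs <;> simp_all
          · simp [h8, h9]
      · intro t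
        simp only [pullState, State.writeN, State.writeR, State.afterPull, NExpr.val,
          Function.update_apply]
        simp only [show ∀ x : ℕ, ¬ (2 = 12 ∧ x = 0) by simp,
          if_false]
        by_cases h : t = s.rounds + i
        · simp [h]
        · rw [if_neg h]
          congr 1
          simp only [eq_iff_iff]
          omega
  rintro s₁ ⟨-, -, v, rfl⟩
  set S := ∑ l ∈ Finset.range (s.nat 5 0), r (s.rounds + l) (s.nat 2 (s.nat 10 0)) with hS
  refine Run.setR ?_
  set s₁ := pullState s (s.nat 5 0) S v with hs₁
  have hal : alpha s₁ = alpha s := by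
    simp [alpha, hs₁, pullState, State.writeN, State.writeR]
  have hval : RExpr.val s₁ (.sub (.sub (.mul alphaE (rv 7)) alphaE) (.const 2)) = gridStart s := by
    simp only [RExpr.val, val_alphaE, hal, gridStart]
    simp [hs₁, pullState, State.writeN, State.writeR, NExpr.val]
  rw [hval]
  simp only [NExpr.val]
  have hw : ∀ z, alpha (s₁.writeR 10 0 0 z) = alpha s := by
    intro z
    rw [← hal]
    simp [alpha, State.writeR]
  have hz : ∀ z, (s₁.writeR 10 0 0 z).real 10 0 0 = z := fun z => by simp [State.writeR]
  have hmean : ∀ z, (s₁.writeR 10 0 0 z).real 8 0 0 / (s₁.writeR 10 0 0 z).nat 5 0 = slotMean r s := by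
    intro z
    simp [slotMean, hs₁, hS, pullState, State.writeN, State.writeR]
  change Run ξ r _ _ (N * 2 + 1 + 4) _
  refine Run.append (Run.loop (N := N) (C := 1) (fun i s' => i ≤ gridSteps (gridStart s) (alpha s)
    (slotMean r s) ∧ s' = s₁.writeR 10 0 0 (gridStart s + i * alpha s)) ?_ ?_) ?_
  · rintro i s' ⟨hi, rfl⟩ hb
    have hb' : gridStart s + i * alpha s < slotMean r s ∧ gridStart s + i * alpha s < 2 := by
      simpa only [BExpr.Holds, RExpr.val, NExpr.val, hz, hmean, Rat.cast_ofNat] using hb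
    refine ⟨?_, Run.setR (Run.nil ⟨?_, ?_⟩)⟩
    · by_contra hn
      have h1 : (N : ℝ) * alpha s ≤ i * alpha s := by gcongr; omega
      have h2 : -2 - alpha s ≤ gridStart s := by
        have := mul_nonneg hα.le hu
        rw [gridStart]; linarith
      linarith [hb'.2]
    · refine lt_of_le_of_ne hi fun h => ?_
      exact gridSteps_spec hα (h ▸ hb')
    · simp only [RExpr.val, NExpr.val, val_alphaE, hw, hz]
      refine State.ext (fun _ _ => rfl) ?_ rfl rfl (fun _ => rfl)
      intro k i' j'
      simp only [State.writeR]
      split_ifs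
      · push_cast; ring
      · rfl
  · exact ⟨Nat.zero_le _, by simp⟩
  · rintro s₂ ⟨hnb, i, -, hi, rfl⟩
    have hi' : i = gridSteps (gridStart s) (alpha s) (slotMean r s) := by
      refine le_antisymm hi (Nat.sInf_le ?_)
      change ¬ (gridStart s + i * alpha s < slotMean r s ∧ gridStart s + i * alpha s < 2)
      simpa only [BExpr.Holds, RExpr.val, NExpr.val, hz, hmean, Rat.cast_ofNat] using hnb
    rw [hi']
    change Run ξ r _ (s₁.writeR 10 0 0 (gridRound (gridStart s) (alpha s) (slotMean r s))) _ _
    generalize gridRound (gridStart s) (alpha s) (slotMean r s) = z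
    refine Run.setR (Run.setR (Run.setR (Run.setN (Run.nil ?_))))
    refine State.ext ?_ ?_ rfl rfl (fun _ => rfl)
    · intro k i
      simp [slotOut, hs₁, pullState, State.writeN, State.writeR, NExpr.val]
    · intro k i j
      simp only [slotOut, hs₁, pullState, State.writeN, State.writeR, NExpr.val, RExpr.val]
      by_cases h4 : k = 4
      · subst h4; simp
      · by_cases h8 : k = 8
        · subst h8; simp; split_ifs <;> simp_all
        · by_cases h9 : k = 9
          · subst h9; simp; split_ifs <;> simp_all
          · simp [h4, h8, h9]

/-- The state before slot `j`. -/
noncomputable def slotIter (r : ℕ → ℕ → ℝ) (s : State) : ℕ → State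
  | 0 => s.writeN 10 0 0
  | j + 1 => (slotOut (slotIter r s j) (gridRound (gridStart (slotIter r s j))
      (alpha (slotIter r s j)) (slotMean r (slotIter r s j)))).writeN 10 0 (j + 1)

/-- The rounded mean reward of slot `j`. -/
noncomputable def slotVal (r : ℕ → ℕ → ℝ) (s : State) (j : ℕ) : ℝ :=
  gridRound (gridStart s) (alpha s)
    ((∑ i ∈ Finset.range (s.nat 5 0), r (s.rounds + j * s.nat 5 0 + i) (s.nat 2 j)) / s.nat 5 0)

theorem slotIter_spec (r : ℕ → ℕ → ℝ) (s : State) (j : ℕ) :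
    (∀ k, k ≠ 6 → k ≠ 10 → k ≠ 12 → (slotIter r s j).nat k = s.nat k) ∧
    (∀ k, k ≠ 4 → k ≠ 8 → k ≠ 9 → k ≠ 10 → (slotIter r s j).real k = s.real k) ∧
    (slotIter r s j).nat 10 0 = j ∧
    (slotIter r s j).nat 6 0 = s.nat 6 0 + j * s.nat 5 0 ∧
    (slotIter r s j).rounds = s.rounds + j * s.nat 5 0 ∧
    (slotIter r s j).draws = s.draws ∧
    (∀ t, t < s.rounds → (slotIter r s j).arm t = s.arm t) ∧
    (∀ l < j, ∀ i < s.nat 5 0, (slotIter r s j).arm (s.rounds + l * s.nat 5 0 + i) = s.nat 2 l) ∧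
    (∀ l < j, (slotIter r s j).real 4 l 0 = slotVal r s l) := by
  induction j with
  | zero =>
    refine ⟨fun k _ h _ => ?_, fun k _ _ _ _ => rfl, ?_, ?_, ?_, rfl, fun _ _ => rfl, ?_, ?_⟩
    · ext; simp [slotIter, State.writeN, h]
    all_goals simp [slotIter, State.writeN]
  | succ j ih =>
    obtain ⟨h1, h2, h3, h4, h5, h6, h7, h8, h9⟩ := ih
    have hval : gridRound (gridStart (slotIter r s j)) (alpha (slotIter r s j))
        (slotMean r (slotIter r s j)) = slotVal r s j := by
      simp [slotVal, gridStart, alpha, slotMean, h1, h2, h5, h3]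
    rw [slotIter, hval]
    have h5' : (slotIter r s j).nat 5 = s.nat 5 := h1 5 (by simp) (by simp) (by simp)
    have h2' : (slotIter r s j).nat 2 = s.nat 2 := h1 2 (by simp) (by simp) (by simp)
    refine ⟨fun k a b c => ?_, fun k a b c e => ?_, ?_, ?_, ?_, h6, fun t ht => ?_,
      fun l hl i hi => ?_, fun l hl => ?_⟩
    · ext i
      simp [slotOut, pullState, State.writeN, State.writeR, a, b, c, h1]
    · ext i i'
      simp [slotOut, pullState, State.writeN, State.writeR, a, b, c, e, h2]
    · simp [State.writeN]
    · simp [slotOut, pullState, State.writeN, State.writeR, h4, h5']; ring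
    · simp [slotOut, pullState, State.writeN, State.writeR, h5, h5']; ring
    · simp only [slotOut, pullState, State.writeN, State.writeR, h5]
      rw [if_neg (by omega)]
      exact h7 t ht
    · simp only [slotOut, pullState, State.writeN, State.writeR, h5, h5', h2', h3]
      rcases Nat.lt_succ_iff_lt_or_eq.1 hl with h | rfl
      · have : (l + 1) * s.nat 5 0 ≤ j * s.nat 5 0 := Nat.mul_le_mul_right _ h
        rw [Nat.succ_mul] at this
        rw [if_neg (by omega)]
        exact h8 l h i hi
      · rw [if_pos (by omega)]
    · simp only [slotOut, pullState, State.writeN, State.writeR, h3]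
      rcases Nat.lt_succ_iff_lt_or_eq.1 hl with h | rfl
      · simpa [h.ne] using h9 l h
      · simp

theorem slotIter_congr {r r' : ℕ → ℕ → ℝ} {s : State} {j : ℕ}
    (h : ∀ l < j, slotVal r s l = slotVal r' s l) : slotIter r s j = slotIter r' s j := by
  have hval : ∀ r j, gridRound (gridStart (slotIter r s j)) (alpha (slotIter r s j))
      (slotMean r (slotIter r s j)) = slotVal r s j := by
    intro r j
    obtain ⟨h1, h2, h3, h4, h5, -⟩ := slotIter_spec r s j
    simp [slotVal, gridStart, alpha, slotMean, h1, h2, h5, h3]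
  induction j with
  | zero => rfl
  | succ j ih =>
    rw [slotIter, slotIter, hval, hval, ih fun l hl => h l (by omega), h j (by omega)]

theorem run_slots (s : State) {N : ℕ} (hα : 0 < alpha s) (hu : 0 ≤ s.real 7 0 0)
    (hN : 4 + alpha s ≤ N * alpha s) :
    Run ξ r slots s (s.nat 0 0 * (s.nat 5 0 * 4 + N * 2 + 11) + 2)
      (fun s' => s' = slotIter r s (s.nat 0 0)) := by
  refine (Run.forTo (w := ⟨[6, 10, 12], [4, 8, 9, 10], true, false⟩) (N := s.nat 0 0)
    (C := s.nat 5 0 * 4 + N * 2 + 9) (by simp) rfl (fun j s' => s' = slotIter r s j) ?_ rfl ?_).mono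
    le_rfl (fun _ h => h.2.2)
  · intro s' hf
    rw [NExpr.val, hf.nat 0 (by simp)]; rfl
  · rintro j hj s' - - rfl
    obtain ⟨h1, h2, h3, h4, h5, -⟩ := slotIter_spec r s j
    have hal : alpha (slotIter r s j) = alpha s := by simp [alpha, h1, h2]
    have h5' : (slotIter r s j).nat 5 = s.nat 5 := h1 5 (by simp) (by simp) (by simp)
    refine (run_slot (slotIter r s j) (N := N) (by rwa [hal]) (by simpa [h2] using hu)
      (by rwa [hal])).mono (by rw [h5']) ?_
    rintro s' rfl
    refine ⟨?_, rfl⟩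
    simp [slotOut, pullState, State.writeN, State.writeR, h3]

/-! ### The elimination block -/

/-- Estimate the mean rewards of all points. -/
def estimate : List Cmd :=
  forTo 9 vn (.setR 14 (.const 0) (.const 0) (.const 0) ::
    (forTo 10 vd [.setR 14 (.const 0) (.const 0) (.add (rv 14)
      (.mul (.read 3 (nv 10) (.const 0)) (.mul (.read 2 (nv 9) (nv 10)) (.read 4 (nv 10) (.const 0)))))] ++
    [.setR 5 (nv 9) (.const 0) (rv 14)]))

/-- Find the best active point. -/
def findBest : List Cmd :=
  forTo 9 vn [.ite (.and (.ltN (.const 0) (.read 1 (nv 9)))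
    (.ltR (.read 5 (nv 7) (.const 0)) (.read 5 (nv 9) (.const 0)))) [.setN 7 (.const 0) (nv 9)] []]

/-- Deactivate the points that are much worse than the best one. -/
def discard : List Cmd :=
  forTo 9 vn [.ite (.ltR (.add (.read 5 (nv 9) (.const 0)) (.mul (.mul (.const 8) (.ofNat vd)) alphaE))
    (.read 5 (nv 7) (.const 0))) [.setN 1 (nv 9) (.const 0)] []]

/-- Elimination, and the parameters of the next batch. -/
def eliminate : List Cmd :=
  estimate ++ (findBest ++ (discard ++
    [.setR 6 (.const 0) (.const 0) (.div (rv 6) (.const 2)),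
      .setN 5 (.const 0) (.add (.add (nv 5) (nv 5)) (.add (nv 5) (nv 5)))]))

/-- The estimated mean reward of point `a`. -/
noncomputable def est (s : State) (d a : ℕ) : ℝ :=
  ∑ j ∈ Finset.range d, s.real 3 j 0 * (s.real 2 a j * s.real 4 j 0)

theorem run_estimate {d n : ℕ} (s : State) (hd : s.nat 0 0 = d) (hn : s.nat 0 2 = n) :
    Run ξ r estimate s (n * (d * 3 + 6) + 2) (fun s' => Fr ⟨[9, 10], [5, 14], false, false⟩ s s' ∧
      ∀ a < n, s'.real 5 a 0 = est s d a) := by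
  refine (Run.forTo (w := ⟨[9, 10], [5, 14], false, false⟩) (C := d * 3 + 4) (N := n) (by simp) rfl
    (fun i s' => ∀ a < i, s'.real 5 a 0 = est s d a) ?_ (by simp) ?_).mono le_rfl
    (fun s' h => ⟨h.1, h.2.2⟩)
  · intro s' hf
    simp [NExpr.val, hf.nat 0 (by simp), hn]
  · intro i hi s' hf hk hI
    refine (Run.setR (N := (d * 3 + 2) + 1) ?_).mono (by omega) (fun _ h => h)
    refine Run.append (Run.forTo (w := ⟨[10], [14], false, false⟩) (C := 1) (N := d) (by simp) rfl
      (fun l s'' => s''.real 14 0 0 =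
        ∑ j ∈ Finset.range l, s.real 3 j 0 * (s.real 2 i j * s.real 4 j 0)) ?_ ?_ ?_) ?_
    · intro s'' hf'
      rw [NExpr.val, hf'.nat 0 (by simp)]
      change s'.nat 0 0 = d
      rw [hf.nat 0 (by simp), hd]
    · simp [State.writeN, State.writeR, RExpr.val, NExpr.val]
    · intro l hl s'' hf' hk' hI'
      have h9 : s''.nat 9 0 = i := by rw [hf'.nat 9 (by simp)]; exact hk
      have hr : ∀ k, k ≠ 5 → k ≠ 14 → s''.real k = s.real k := by
        intro k h5 h14
        rw [hf'.real k (by simp [h14]), ← hf.real k (by simp [h5, h14])]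
        simp [State.writeR, h14]
      refine Run.setR (Run.nil ⟨by simp [State.writeR, hk'], ?_⟩)
      simp [State.writeN, State.writeR, RExpr.val, NExpr.val, hI', hk', h9, Finset.sum_range_succ,
        hr 2, hr 3, hr 4]
    · rintro s'' ⟨hf', -, hI'⟩
      have h9 : s''.nat 9 0 = i := by rw [hf'.nat 9 (by simp)]; exact hk
      have h5 : s''.real 5 = s'.real 5 := by
        rw [hf'.real 5 (by simp)]; simp [State.writeR]
      refine Run.setR (Run.nil ⟨by simp [State.writeR, h9], ?_⟩)
      intro a ha
      simp only [State.writeN, State.writeR, NExpr.val, RExpr.val, h9, hI', h5]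
      rcases Nat.lt_succ_iff_lt_or_eq.1 ha with h | rfl
      · simpa [h.ne] using hI a h
      · simp [est]

theorem run_findBest {n : ℕ} (s : State) (hn : s.nat 0 2 = n) (hc : s.nat 7 0 < n)
    (hc' : 0 < s.nat 1 (s.nat 7 0)) :
    Run ξ r findBest s (n * 4 + 2) (fun s' => Fr ⟨[7, 9], [], false, false⟩ s s' ∧
      s'.nat 7 0 < n ∧ 0 < s.nat 1 (s'.nat 7 0) ∧
      ∀ a < n, 0 < s.nat 1 a → s.real 5 a 0 ≤ s.real 5 (s'.nat 7 0) 0) := by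
  refine (Run.forTo (w := ⟨[7, 9], [], false, false⟩) (C := 2) (N := n) (by simp) rfl
    (fun i s' => s'.nat 7 0 < n ∧ 0 < s.nat 1 (s'.nat 7 0) ∧
      ∀ a < i, 0 < s.nat 1 a → s.real 5 a 0 ≤ s.real 5 (s'.nat 7 0) 0) ?_ ?_ ?_).mono le_rfl
    (fun s' h => ⟨h.1, h.2.2⟩)
  · intro s' hf
    simp [NExpr.val, hf.nat 0 (by simp), hn]
  · simp [State.writeN, hc, hc']
  · rintro i hi s' hf hk ⟨h1, h2, h3⟩
    have e1 : s'.nat 1 = s.nat 1 := hf.nat 1 (by simp)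
    have e5 : s'.real 5 = s.real 5 := hf.real 5 (by simp)
    refine Run.ite (N := 1) (fun hb => Run.setN (Run.nil ?_)) (fun hb => Run.nil ?_) <;>
    simp only [BExpr.Holds, NExpr.val, RExpr.val, e1, e5, hk] at hb
    · refine ⟨by simp [State.writeN, hk], ?_⟩
      simp only [State.writeN, NExpr.val, hk]
      refine ⟨by simpa using hi, by simpa using hb.1, fun a ha hact => ?_⟩
      simp only [and_self, if_true]
      rcases Nat.lt_succ_iff_lt_or_eq.1 ha with h | rfl
      · exact (h3 a h hact).trans hb.2.le
      · exact le_rfl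
    · refine ⟨hk, ?_⟩
      simp only [State.writeN, Nat.reduceEqDiff, false_and, if_false]
      refine ⟨h1, h2, fun a ha hact => ?_⟩
      rcases Nat.lt_succ_iff_lt_or_eq.1 ha with h | rfl
      · exact h3 a h hact
      · push Not at hb
        exact hb hact

theorem run_discard {n : ℕ} (s : State) (hn : s.nat 0 2 = n) :
    Run ξ r discard s (n * 4 + 2) (fun s' => Fr ⟨[1, 9], [], false, false⟩ s s' ∧
      ∀ a < n, s'.nat 1 a = if s.real 5 a 0 + 8 * s.nat 0 0 * alpha s < s.real 5 (s.nat 7 0) 0 then 0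
        else s.nat 1 a) := by
  refine (Run.forTo (w := ⟨[1, 9], [], false, false⟩) (C := 2) (N := n) (by simp) rfl
    (fun i s' => (∀ a < i, s'.nat 1 a =
      if s.real 5 a 0 + 8 * s.nat 0 0 * alpha s < s.real 5 (s.nat 7 0) 0 then 0 else s.nat 1 a) ∧
      ∀ a, i ≤ a → s'.nat 1 a = s.nat 1 a) ?_ ?_ ?_).mono le_rfl
    (fun s' h => ⟨h.1, h.2.2.1⟩)
  · intro s' hf
    simp [NExpr.val, hf.nat 0 (by simp), hn]
  · simp [State.writeN]
  · rintro i hi s' hf hk ⟨h1, h2⟩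
    have hal : alpha s' = alpha s := by
      simp [alpha, hf.nat 4, hf.nat 0, hf.real]
    have e5 : s'.real 5 = s.real 5 := hf.real 5 (by simp)
    have e7 : s'.nat 7 = s.nat 7 := hf.nat 7 (by simp)
    have e0 : s'.nat 0 = s.nat 0 := hf.nat 0 (by simp)
    refine Run.ite (N := 1) (fun hb => Run.setN (Run.nil ?_)) (fun hb => Run.nil ?_) <;>
    simp only [BExpr.Holds, NExpr.val, RExpr.val, val_alphaE, hal, e5, e7, e0, hk,
      Rat.cast_ofNat] at hb
    · refine ⟨by simp [State.writeN, hk], fun a ha => ?_, fun a ha => ?_⟩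
      · rcases Nat.lt_succ_iff_lt_or_eq.1 ha with h | rfl
        · simpa [State.writeN, NExpr.val, hk, h.ne] using h1 a h
        · simp [State.writeN, NExpr.val, hk, hb]
      · have : a ≠ i := by omega
        simpa [State.writeN, NExpr.val, hk, this] using h2 a (by omega)
    · refine ⟨hk, fun a ha => ?_, fun a ha => ?_⟩
      · rcases Nat.lt_succ_iff_lt_or_eq.1 ha with h | rfl
        · simpa [State.writeN] using h1 a h
        · rw [if_neg hb]
          simpa [State.writeN] using h2 a le_rfl
      · simpa [State.writeN] using h2 a (by omega)

/-- The footprint of the elimination block. -/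
def elimFoot : Foot := ⟨[1, 5, 7, 9, 10], [5, 6, 14], false, false⟩

theorem run_eliminate {d n : ℕ} (s : State) (hd : s.nat 0 0 = d) (hn : s.nat 0 2 = n)
    (hc : s.nat 7 0 < n) (hc' : 0 < s.nat 1 (s.nat 7 0)) :
    Run ξ r eliminate s (n * (d * 3 + 6) + 2 + (n * 4 + 2 + (n * 4 + 2 + 2))) (fun s' =>
      Fr elimFoot s s' ∧ s'.nat 7 0 < n ∧ 0 < s.nat 1 (s'.nat 7 0) ∧
      (∀ a < n, 0 < s.nat 1 a → est s d a ≤ est s d (s'.nat 7 0)) ∧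
      (∀ a < n, s'.nat 1 a = if est s d a + 8 * d * alpha s < est s d (s'.nat 7 0) then 0
        else s.nat 1 a) ∧
      s'.real 6 0 0 = s.real 6 0 0 / 2 ∧ s'.nat 5 0 = 4 * s.nat 5 0) := by
  refine Run.frame ?_ rfl
  refine Run.append (run_estimate s hd hn) ?_
  rintro s₁ ⟨f₁, h₁⟩
  have a1 : s₁.nat 1 = s.nat 1 := f₁.nat 1 (by simp)
  have a7 : s₁.nat 7 = s.nat 7 := f₁.nat 7 (by simp)
  refine Run.append (run_findBest s₁ (by rw [f₁.nat 0 (by simp), hn]) (by rw [a7]; exact hc)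
    (by rw [a1, a7]; exact hc')) ?_
  rintro s₂ ⟨f₂, h₂, h₂', h₂''⟩
  rw [a1] at h₂' h₂''
  have b5 : s₂.real 5 = s₁.real 5 := f₂.real 5 (by simp)
  have b0 : s₂.nat 0 = s.nat 0 := by rw [f₂.nat 0 (by simp), f₁.nat 0 (by simp)]
  have b1 : s₂.nat 1 = s.nat 1 := by rw [f₂.nat 1 (by simp), a1]
  have hal : alpha s₂ = alpha s := by
    simp [alpha, b0, f₂.nat 4, f₁.nat 4, f₂.real, f₁.real]
  refine Run.append (run_discard (n := n) s₂ (by rw [b0, hn])) ?_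
  rintro s₃ ⟨f₃, h₃⟩
  refine Run.setR (Run.setN (Run.nil ?_))
  have c7 : s₃.nat 7 = s₂.nat 7 := f₃.nat 7 (by simp)
  simp only [State.writeN, State.writeR, NExpr.val, RExpr.val]
  simp only [Nat.reduceEqDiff, false_and, if_false, c7]
  refine ⟨h₂, h₂', fun a ha hact => ?_, fun a ha => ?_, ?_, ?_⟩
  · rw [← h₁ a ha, ← h₁ _ h₂]; exact h₂'' a ha hact
  · rw [h₃ a ha, b5, h₁ a ha, h₁ _ h₂, b1, hal, b0, hd]
  · rw [f₃.real 6 (by simp), f₂.real 6 (by simp), f₁.real 6 (by simp)]; simp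
  · rw [f₃.nat 5 (by simp), f₂.nat 5 (by simp), f₁.nat 5 (by simp)]; simp; omega

end LinearBandit

namespace LinearBandit
open RealRAM

/-! ### The program -/

/-- One batch. -/
def batch : List Cmd :=
  spanner ++ ([.draw 7 (.const 0) (.const 0)] ++ (slots ++ eliminate))

/-- Set the parameters of the first batch and activate all points. -/
def setup : List Cmd :=
  .setN 3 (.const 0) (.const 1) ::
  ([.loop (.ltN (nv 3) vT) [.setN 3 (.const 0) (.add (nv 3) (nv 3)),
    .setN 4 (.const 0) (.add (nv 4) (.const 16))]] ++
  (.setN 5 (.const 0) (nv 4) :: .setR 6 (.const 0) (.const 0) (.const 1) ::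
  forTo 9 vn [.setN 1 (nv 9) (.const 1)]))

/-- Whether there is time for another batch. -/
def another : BExpr :=
  .and (.not (.ltR (.mul (rv 0) (.ofNat vT)) (.const 1)))
    (.not (.ltR (.ofNat vT) (.add (.ofNat (nv 6)) (.mul (.ofNat vd) (.ofNat (nv 5))))))

/-- Play the best point in the remaining rounds. -/
def commit : List Cmd :=
  [.loop (.ltN (nv 6) vT) [.pull (nv 7) 9 (.const 0) (.const 0),
    .setN 6 (.const 0) (.add (nv 6) (.const 1))]]

/-- Phased elimination with randomly shifted rounding. -/
def phasedElimination : List Cmd := setup ++ ([.loop another batch] ++ commit)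

/-! ### The schedule -/

/-- The number of pulls per slot in the first batch. -/
def ell (T : ℕ) : ℕ := 16 * Nat.clog 2 T

/-- The number of pulls per slot in batch `b`. -/
def slotLen (T b : ℕ) : ℕ := ell T * 4 ^ b

/-- The round in which batch `b` starts. -/
def batchStart (d T b : ℕ) : ℕ := ∑ i ∈ Finset.range b, d * slotLen T i

/-- The number of batches. -/
noncomputable def numBatches (d T : ℕ) (ρ : ℝ) : ℕ :=
  sInf {b | ¬ (1 ≤ ρ * T ∧ batchStart d T (b + 1) ≤ T)}

theorem batchStart_succ (d T b : ℕ) :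
    batchStart d T (b + 1) = batchStart d T b + d * slotLen T b :=
  Finset.sum_range_succ _ _

theorem batchStart_mono (d T : ℕ) : Monotone (batchStart d T) :=
  monotone_nat_of_le_succ fun b => by rw [batchStart_succ]; omega

theorem clog_pos {T : ℕ} (hT : 2 ≤ T) : 0 < Nat.clog 2 T := Nat.clog_pos (by norm_num) hT

theorem ell_pos {T : ℕ} (hT : 2 ≤ T) : 16 ≤ ell T := by
  have := clog_pos hT
  unfold ell; omega

theorem slotLen_pos {T : ℕ} (hT : 2 ≤ T) (b : ℕ) : 0 < slotLen T b :=
  Nat.mul_pos (by have := ell_pos hT; omega) (by positivity)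

theorem le_batchStart {d T : ℕ} (hT : 2 ≤ T) (b : ℕ) : d * b ≤ batchStart d T b := by
  induction b with
  | zero => simp
  | succ b ih =>
    rw [batchStart_succ, Nat.mul_succ]
    have := Nat.mul_le_mul_left d (slotLen_pos hT b)
    omega

theorem numBatches_spec {d T : ℕ} {ρ : ℝ} (hd : 1 ≤ d) (hT : 2 ≤ T) :
    ¬ (1 ≤ ρ * T ∧ batchStart d T (numBatches d T ρ + 1) ≤ T) := by
  refine Nat.sInf_mem (s := {b | ¬ (1 ≤ ρ * T ∧ batchStart d T (b + 1) ≤ T)}) ⟨T, fun h => ?_⟩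
  have h1 := le_batchStart (d := d) hT (T + 1)
  have h2 : 1 * (T + 1) ≤ d * (T + 1) := Nat.mul_le_mul_right _ hd
  have := h.2
  omega

theorem of_lt_numBatches {d T b : ℕ} {ρ : ℝ} (h : b < numBatches d T ρ) :
    1 ≤ ρ * T ∧ batchStart d T (b + 1) ≤ T := by
  by_contra hn
  exact absurd (Nat.sInf_le (s := {b | ¬ (1 ≤ ρ * T ∧ batchStart d T (b + 1) ≤ T)}) hn)
    (not_le.2 h)

theorem batchStart_numBatches_le {d T : ℕ} {ρ : ℝ} : batchStart d T (numBatches d T ρ) ≤ T := by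
  rcases Nat.eq_zero_or_pos (numBatches d T ρ) with h | h
  · simp [h, batchStart]
  · have := (of_lt_numBatches (show numBatches d T ρ - 1 < numBatches d T ρ by omega)).2
    rwa [Nat.sub_add_cancel h] at this

theorem slotLen_le {d T b : ℕ} {ρ : ℝ} (hd : 1 ≤ d) (h : b < numBatches d T ρ) :
    slotLen T b ≤ T := by
  have := (of_lt_numBatches h).2
  rw [batchStart_succ] at this
  have := Nat.le_mul_of_pos_left (slotLen T b) hd
  omega

/-! ### What holds in every run -/

/-- What holds before batch `b` in every run. -/
structure Base {d : ℕ} (T : ℕ) (ρ : ℝ) (n : ℕ) (x : ℕ → EuclideanSpace ℝ (Fin d)) (b : ℕ)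
    (s : State) : Prop where
  dim : s.nat 0 0 = d
  horizon : s.nat 0 1 = T
  card : s.nat 0 2 = n
  rho : s.real 0 0 0 = ρ
  rho_pos : 0 < ρ
  pts : ∀ a < n, ∀ j : Fin d, s.real 1 a j = x a j
  len : s.nat 4 0 = ell T
  slotLen : s.nat 5 0 = slotLen T b
  time : s.nat 6 0 = batchStart d T b
  rounds : s.rounds = batchStart d T b
  draws : s.draws = b
  best_lt : s.nat 7 0 < n
  best_act : 0 < s.nat 1 (s.nat 7 0)
  eps : s.real 6 0 0 = (1 / 2) ^ b
  arms : ∀ t < batchStart d T b, s.arm t < n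

/-- The state after the spanner block. -/
noncomputable def spanned (s : State) : State := final (fun _ => 0) (fun _ _ => 0) ⟨spanner, s⟩

/-- The state after the elimination block. -/
noncomputable def eliminated (s : State) : State := final (fun _ => 0) (fun _ _ => 0) ⟨eliminate, s⟩

/-- The state before the pulls of a batch. -/
noncomputable def prepared (u : ℝ) (s : State) : State := (spanned s).afterDraw u 7 0 0

/-- The state before elimination. -/
noncomputable def measured (r : ℕ → ℕ → ℝ) (u : ℝ) (s : State) : State :=
  slotIter r (prepared u s) (s.nat 0 0)

/-- The state after a batch. -/
noncomputable def batchOut (r : ℕ → ℕ → ℝ) (u : ℝ) (s : State) : State :=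
  eliminated (measured r u s)

variable {ξ : ℕ → unitInterval} {r : ℕ → ℕ → ℝ} {d T n b : ℕ} {ρ : ℝ}
  {x : ℕ → EuclideanSpace ℝ (Fin d)} {s : State}

/-- Steps of the spanner block in a batch with `d + b ≤ B`. -/
def spanTime (d n B : ℕ) : ℕ :=
  d * 4 + 2 + (n * (d * 3 + 4) + 2 +
    ((d * B + 1) * (n * (d * (n * (d * 3 + 6) + d * 3 + 11) + 4) + 4) + 2))

/-- Steps of the elimination block. -/
def elimTime (d n : ℕ) : ℕ := n * (d * 3 + 6) + 2 + (n * 4 + 2 + (n * 4 + 2 + 2))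

theorem abs_coord_le {v : EuclideanSpace ℝ (Fin d)} (h : ‖v‖ ≤ 1) (j : Fin d) : |v j| ≤ 1 :=
  (PiLp.norm_apply_le v j).trans h

theorem Base.run_spanner (hs : Base T ρ n x b s) (hx : ∀ a < n, ‖x a‖ ≤ 1) :
    Run ξ r spanner s (spanTime d n (d + b)) (fun s' => s' = spanned s ∧ Fr spanFoot s s' ∧
      ∃ b' : Matrix (Fin d) (Fin d) ℝ,
        TabInv n (fun a j => x a j) (s.nat 1) (s.nat 7 0) ((1 / 2) ^ b) s' b' ∧
        ∀ a < n, ∀ j < d, 0 < s.nat 1 a → s'.real 2 a j * s'.real 2 a j ≤ 4) := by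
  have key := fun ξ r => LinearBandit.run_spanner (ξ := ξ) (r := r) (fun a j => x a j) s hs.dim
    hs.card hs.pts (fun a ha j => abs_coord_le (hx a ha) j) hs.eps
  obtain ⟨m, hm, s', he, hq⟩ := key (fun _ => 0) (fun _ _ => 0)
  obtain ⟨m', hm', he'⟩ := he.congr (w := spanFoot) rfl rfl rfl ξ r
  exact ⟨m', hm'.trans hm, s', he', he.final_eq.symm, hq⟩

theorem Base.spanned (hs : Base T ρ n x b s) (hx : ∀ a < n, ‖x a‖ ≤ 1) :
    Fr spanFoot s (spanned s) ∧ ∃ b' : Matrix (Fin d) (Fin d) ℝ,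
      TabInv n (fun a j => x a j) (s.nat 1) (s.nat 7 0) ((1 / 2) ^ b) (spanned s) b' ∧
      ∀ a < n, ∀ j < d, 0 < s.nat 1 a →
        (LinearBandit.spanned s).real 2 a j * (LinearBandit.spanned s).real 2 a j ≤ 4 :=
  (hs.run_spanner (ξ := fun _ => 0) (r := fun _ _ => 0) hx).final.2

/-- What holds before the pulls of batch `b` in every run. -/
theorem Base.prepared (hs : Base T ρ n x b s) (hx : ∀ a < n, ‖x a‖ ≤ 1) (u : ℝ) :
    (∀ k, k ∉ spanFoot.wn → (prepared u s).nat k = s.nat k) ∧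
    (∀ k, k ∉ spanFoot.wr → k ≠ 7 → (LinearBandit.prepared u s).real k = s.real k) ∧
    (LinearBandit.prepared u s).real 7 0 0 = u ∧
    (LinearBandit.prepared u s).rounds = s.rounds ∧ (LinearBandit.prepared u s).arm = s.arm ∧
    (LinearBandit.prepared u s).draws = b + 1 ∧
    (LinearBandit.prepared u s).nat 2 = (LinearBandit.spanned s).nat 2 ∧
    (∀ j < d, (LinearBandit.spanned s).nat 2 j < n ∧
      0 < s.nat 1 ((LinearBandit.spanned s).nat 2 j)) := by
  obtain ⟨hf, b', hb', -⟩ := hs.spanned hx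
  refine ⟨hf.nat, fun k hk h7 => ?_, ?_, hf.rounds rfl, hf.arm rfl, ?_, rfl, fun j hj => ?_⟩
  · rw [← hf.real k hk]; ext; simp [LinearBandit.prepared, State.afterDraw, State.writeR, h7]
  · simp [LinearBandit.prepared, State.afterDraw, State.writeR]
  · simp [LinearBandit.prepared, State.afterDraw, hf.draws rfl, hs.draws]
  · rcases hb'.slot ⟨j, hj⟩ with ⟨-, h, h', -⟩ | ⟨-, h, -⟩
    · exact ⟨h, h'⟩
    · simp only at h
      rw [h]; exact ⟨hs.best_lt, hs.best_act⟩

theorem Base.alpha_prepared (hs : Base T ρ n x b s) (hx : ∀ a < n, ‖x a‖ ≤ 1) (u : ℝ) :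
    alpha (LinearBandit.prepared u s) = ell T * d * (1 / 2) ^ b / ρ := by
  obtain ⟨h1, h2, -⟩ := hs.prepared hx u
  rw [alpha, h1 4 (by simp [spanFoot]), h1 0 (by simp [spanFoot]), h2 6 (by simp [spanFoot]) (by simp),
    h2 0 (by simp [spanFoot]) (by simp), hs.len, hs.dim, hs.eps, hs.rho]

/-- What holds before the elimination of batch `b` in every run. -/
theorem Base.measured (hs : Base T ρ n x b s) (hx : ∀ a < n, ‖x a‖ ≤ 1) (u : ℝ) (r : ℕ → ℕ → ℝ) :
    (∀ k, k ∉ spanFoot.wn → k ≠ 6 → (measured r u s).nat k = s.nat k) ∧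
    (LinearBandit.measured r u s).nat 2 = (LinearBandit.spanned s).nat 2 ∧
    (∀ k, k ∉ spanFoot.wr → k ≠ 4 → k ≠ 7 → k ≠ 8 → k ≠ 9 → k ≠ 10 →
      (LinearBandit.measured r u s).real k = s.real k) ∧
    (LinearBandit.measured r u s).real 2 = (LinearBandit.spanned s).real 2 ∧
    (LinearBandit.measured r u s).real 3 = (LinearBandit.spanned s).real 3 ∧
    (∀ j < d, (LinearBandit.measured r u s).real 4 j 0 = slotVal r (LinearBandit.prepared u s) j) ∧
    (LinearBandit.measured r u s).nat 6 0 = batchStart d T (b + 1) ∧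
    (LinearBandit.measured r u s).rounds = batchStart d T (b + 1) ∧
    (LinearBandit.measured r u s).draws = b + 1 ∧
    (∀ t < batchStart d T b, (LinearBandit.measured r u s).arm t = s.arm t) ∧
    (∀ j < d, ∀ i < LinearBandit.slotLen T b,
      (LinearBandit.measured r u s).arm (batchStart d T b + j * LinearBandit.slotLen T b + i) =
        (LinearBandit.spanned s).nat 2 j) := by
  obtain ⟨h1, h2, h3, h4, h5, h6, h7, h8⟩ := hs.prepared hx u
  obtain ⟨g1, g2, g3, g4, g5, g6, g7, g8, g9⟩ := slotIter_spec r (LinearBandit.prepared u s) d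
  have e5 : (LinearBandit.prepared u s).nat 5 0 = LinearBandit.slotLen T b := by
    rw [h1 5 (by simp [spanFoot]), hs.slotLen]
  have e6 : (LinearBandit.prepared u s).nat 6 0 = batchStart d T b := by
    rw [h1 6 (by simp [spanFoot]), hs.time]
  rw [h4, hs.rounds, e5] at g8
  rw [h4, hs.rounds] at g7
  unfold LinearBandit.measured
  rw [hs.dim]
  refine ⟨fun k hk hk' => ?_, ?_, fun k hk a1 a2 a3 a4 a5 => ?_, ?_, ?_, g9, ?_, ?_, ?_, ?_, ?_⟩
  · simp only [spanFoot, List.mem_cons, List.not_mem_nil, or_false, not_or] at hk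
    rw [g1 k hk' hk.2.2.2.1 hk.2.2.2.2.2, h1 k (by simp [spanFoot, hk])]
  · rw [g1 2 (by simp) (by simp) (by simp), h7]
  · rw [g2 k a1 a3 a4 a5, h2 k hk a2]
  · rw [g2 2 (by simp) (by simp) (by simp) (by simp)]
    ext; simp [LinearBandit.prepared, State.afterDraw, State.writeR]
  · rw [g2 3 (by simp) (by simp) (by simp) (by simp)]
    ext; simp [LinearBandit.prepared, State.afterDraw, State.writeR]
  · rw [g4, e6, e5, batchStart_succ]
  · rw [g5, h4, hs.rounds, e5, batchStart_succ]
  · rw [g6, h6]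
  · intro t ht; rw [g7 t ht, h5]
  · intro j hj i hi; rw [g8 j hj i hi, h7]

theorem Base.run_eliminate (hs : Base T ρ n x b s) (hx : ∀ a < n, ‖x a‖ ≤ 1) (u : ℝ)
    (r' : ℕ → ℕ → ℝ) :
    Run ξ r eliminate (LinearBandit.measured r' u s) (elimTime d n) (fun s' =>
      s' = batchOut r' u s ∧ Fr elimFoot (LinearBandit.measured r' u s) s' ∧
      s'.nat 7 0 < n ∧ 0 < s.nat 1 (s'.nat 7 0) ∧
      (∀ a < n, 0 < s.nat 1 a → est (LinearBandit.measured r' u s) d a ≤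
        est (LinearBandit.measured r' u s) d (s'.nat 7 0)) ∧
      (∀ a < n, s'.nat 1 a = if est (LinearBandit.measured r' u s) d a +
          8 * d * (ell T * d * (1 / 2) ^ b / ρ) <
          est (LinearBandit.measured r' u s) d (s'.nat 7 0) then 0 else s.nat 1 a) ∧
      s'.real 6 0 0 = (1 / 2) ^ (b + 1) ∧ s'.nat 5 0 = LinearBandit.slotLen T (b + 1)) := by
  obtain ⟨h1, -, h2, -⟩ := hs.measured hx u r'
  have e0 := h1 0 (by simp [spanFoot]) (by simp)
  have e1 := h1 1 (by simp [spanFoot]) (by simp)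
  have e7 := h1 7 (by simp [spanFoot]) (by simp)
  have hal : alpha (LinearBandit.measured r' u s) = ell T * d * (1 / 2) ^ b / ρ := by
    rw [alpha, h1 4 (by simp [spanFoot]) (by simp), e0, h2 6, h2 0, hs.len, hs.dim, hs.eps, hs.rho] <;>
      simp [spanFoot]
  have key := fun ξ r => LinearBandit.run_eliminate (ξ := ξ) (r := r) (d := d) (n := n)
    (LinearBandit.measured r' u s) (by rw [e0, hs.dim]) (by rw [e0, hs.card])
    (by rw [e7]; exact hs.best_lt) (by rw [e1, e7]; exact hs.best_act)
  obtain ⟨m, hm, s', he, hq⟩ := key (fun _ => 0) (fun _ _ => 0)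
  obtain ⟨m', hm', he'⟩ := he.congr (w := elimFoot) rfl rfl rfl ξ r
  refine ⟨m', hm'.trans hm, s', he', he.final_eq.symm, ?_⟩
  rw [e1, hal] at hq
  obtain ⟨q1, q2, q3, q4, q5, q6, q7⟩ := hq
  refine ⟨q1, q2, q3, q4, q5, ?_, ?_⟩
  · rw [q6, h2 6 (by simp [spanFoot]) (by simp) (by simp) (by simp) (by simp) (by simp), hs.eps, pow_succ]
    ring
  · rw [q7, h1 5 (by simp [spanFoot]) (by simp), hs.slotLen, LinearBandit.slotLen,
      LinearBandit.slotLen, pow_succ]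
    ring

/-- What holds after batch `b` in every run. -/
theorem Base.batchOut (hs : Base T ρ n x b s) (hx : ∀ a < n, ‖x a‖ ≤ 1) (u : ℝ) (r : ℕ → ℕ → ℝ) :
    Base T ρ n x (b + 1) (batchOut r u s) ∧
    (∀ t < batchStart d T b, (LinearBandit.batchOut r u s).arm t = s.arm t) ∧
    (∀ j < d, ∀ i < LinearBandit.slotLen T b,
      (LinearBandit.batchOut r u s).arm (batchStart d T b + j * LinearBandit.slotLen T b + i) =
        (LinearBandit.spanned s).nat 2 j) := by
  obtain ⟨-, -, -, -, -, -, -, hsp⟩ := hs.prepared hx u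
  obtain ⟨g1, -, g2, -, -, -, g3, g4, g5, g6, g7⟩ := hs.measured hx u r
  obtain ⟨-, -, s', -, rfl, hf, q1, q2, q3, q4, q5, q6⟩ :=
    hs.run_eliminate (ξ := fun _ => 0) (r := fun _ _ => 0) hx u r
  have ha := hf.arm rfl
  rw [ha]
  refine ⟨?_, g6, g7⟩
  have hn : ∀ k, k ∉ elimFoot.wn → k ∉ spanFoot.wn → k ≠ 6 →
      (LinearBandit.batchOut r u s).nat k = s.nat k := fun k a b c => by
    rw [hf.nat k a, g1 k b c]
  refine ⟨?_, ?_, ?_, ?_, hs.rho_pos, ?_, ?_, q6, ?_, ?_, ?_, q1, ?_, q5, ?_⟩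
  · rw [hn 0 (by simp [elimFoot]) (by simp [spanFoot]) (by simp), hs.dim]
  · rw [hn 0 (by simp [elimFoot]) (by simp [spanFoot]) (by simp), hs.horizon]
  · rw [hn 0 (by simp [elimFoot]) (by simp [spanFoot]) (by simp), hs.card]
  · rw [hf.real 0 (by simp [elimFoot]), g2 0 (by simp [spanFoot]) (by simp) (by simp) (by simp)
      (by simp) (by simp), hs.rho]
  · rw [hf.real 1 (by simp [elimFoot]), g2 1 (by simp [spanFoot]) (by simp) (by simp) (by simp)
      (by simp) (by simp)]
    exact hs.pts
  · rw [hn 4 (by simp [elimFoot]) (by simp [spanFoot]) (by simp), hs.len]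
  · rw [hf.nat 6 (by simp [elimFoot]), g3]
  · rw [hf.rounds rfl, g4]
  · rw [hf.draws rfl, g5]
  · have := hs.rho_pos
    rw [q4 _ q1, if_neg]
    · exact q2
    · rw [not_lt, le_add_iff_nonneg_right]; positivity
  · intro t ht
    rw [ha]
    by_cases h : t < batchStart d T b
    · rw [g6 t h]; exact hs.arms t h
    · rw [batchStart_succ] at ht
      obtain ⟨c, rfl⟩ := Nat.exists_eq_add_of_le (not_lt.1 h)
      have hL : 0 < LinearBandit.slotLen T b := by
        by_contra h0
        have : LinearBandit.slotLen T b = 0 := by omega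
        rw [this] at ht; omega
      have hj : c / LinearBandit.slotLen T b < d := by
        rw [Nat.div_lt_iff_lt_mul hL]; omega
      have := g7 _ hj (c % LinearBandit.slotLen T b) (Nat.mod_lt _ hL)
      rw [add_assoc, Nat.div_add_mod'] at this
      rw [this]
      exact (hsp _ hj).1

end LinearBandit

namespace LinearBandit
open RealRAM

variable {ξ : ℕ → unitInterval} {r : ℕ → ℕ → ℝ} {d T n b : ℕ} {ρ : ℝ}
  {x : ℕ → EuclideanSpace ℝ (Fin d)} {s : State}

/-- Steps of a batch. -/
def batchTime (d T n : ℕ) : ℕ :=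
  spanTime d n (d + T) + (1 + ((d * (T * 4 + (4 * T + 1) * 2 + 11) + 2) + elimTime d n))

theorem le_of_lt_numBatches (hd : 1 ≤ d) (hT : 2 ≤ T) (hb : b < numBatches d T ρ) : b ≤ T := by
  have h1 := le_batchStart (d := d) hT (b + 1)
  have h2 := Nat.le_mul_of_pos_left (b + 1) hd
  have := (of_lt_numBatches hb).2
  omega

theorem alpha_ge (hd : 1 ≤ d) (hT : 2 ≤ T) (hρ : 0 < ρ) (hρ1 : ρ ≤ 1) :
    (1 / 2 : ℝ) ^ b ≤ ell T * d * (1 / 2) ^ b / ρ := by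
  have h1 : (1 : ℝ) ≤ ell T := by
    have := ell_pos hT
    exact_mod_cast (by omega : 1 ≤ ell T)
  have h2 : (1 : ℝ) ≤ d := by exact_mod_cast hd
  rw [le_div_iff₀ hρ]
  have h3 : (0 : ℝ) < (1 / 2) ^ b := by positivity
  calc (1 / 2 : ℝ) ^ b * ρ ≤ (1 / 2) ^ b * 1 := by gcongr
    _ ≤ (1 / 2) ^ b * (ell T * d) := by gcongr; nlinarith
    _ = _ := by ring

theorem one_le_mul_eps (hd : 1 ≤ d) (hT : 2 ≤ T) (hb : b < numBatches d T ρ) :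
    1 ≤ (T : ℝ) * (1 / 2) ^ b := by
  have h1 : 2 ^ b ≤ T := by
    refine le_trans ?_ (slotLen_le hd hb)
    rw [slotLen]
    calc 2 ^ b ≤ 4 ^ b := Nat.pow_le_pow_left (by norm_num) b
      _ ≤ ell T * 4 ^ b := Nat.le_mul_of_pos_left _ (by have := ell_pos hT; omega)
  rw [one_div, inv_pow, ← div_eq_mul_inv, one_le_div (by positivity)]
  exact_mod_cast h1

theorem Base.run_batch (hs : Base T ρ n x b s) (hx : ∀ a < n, ‖x a‖ ≤ 1) (hd : 1 ≤ d) (hT : 2 ≤ T)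
    (hρ1 : ρ ≤ 1) (hb : b < numBatches d T ρ) :
    Run ξ r batch s (batchTime d T n) (fun s' => s' = LinearBandit.batchOut r (ξ b) s) := by
  have hbT := le_of_lt_numBatches hd hT hb
  refine Run.append ((hs.run_spanner hx).mono (N' := spanTime d n (d + T)) ?_ (fun _ h => h)) ?_
  · unfold spanTime
    gcongr
  rintro s₁ ⟨rfl, hf, -⟩
  refine Run.append (Q₁ := fun s' => s' = LinearBandit.prepared (ξ b) s) (Run.draw (N := 0) (Run.nil ?_)) ?_
  · rw [LinearBandit.prepared, hf.draws rfl, hs.draws]; rfl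
  rintro s₂ rfl
  obtain ⟨h1, h2, h3, -⟩ := hs.prepared hx (ξ b)
  have e0 : (LinearBandit.prepared (ξ b) s).nat 0 0 = d := by
    rw [h1 0 (by simp [spanFoot]), hs.dim]
  have e5 : (LinearBandit.prepared (ξ b) s).nat 5 0 = LinearBandit.slotLen T b := by
    rw [h1 5 (by simp [spanFoot]), hs.slotLen]
  have hge := alpha_ge (b := b) hd hT hs.rho_pos hρ1
  have hpos : (0 : ℝ) < (1 / 2) ^ b := by positivity
  refine Run.append ((run_slots (LinearBandit.prepared (ξ b) s) (N := 4 * T + 1) ?_ ?_ ?_).mono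
    ?_ (fun _ h => h)) ?_
  · rw [hs.alpha_prepared hx]; linarith
  · rw [h3]; exact (ξ b).2.1
  · rw [hs.alpha_prepared hx]
    have := one_le_mul_eps hd hT hb
    have h4 : (T : ℝ) * (1 / 2) ^ b ≤ T * (ell T * d * (1 / 2) ^ b / ρ) := by gcongr
    push_cast
    linarith
  · rw [e0, e5]
    have := slotLen_le hd hb
    gcongr
  rintro s₃ rfl
  have : slotIter r (LinearBandit.prepared (ξ b) s) ((LinearBandit.prepared (ξ b) s).nat 0 0) =
      LinearBandit.measured r (ξ b) s := by
    rw [LinearBandit.measured, e0, hs.dim]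
  rw [this]
  exact (hs.run_eliminate hx (ξ b) r).mono le_rfl (fun _ h => h.1)

/-- The state before batch `b`. -/
noncomputable def traj (ξ : ℕ → unitInterval) (r : ℕ → ℕ → ℝ) (s : State) : ℕ → State
  | 0 => s
  | b + 1 => batchOut r (ξ b) (traj ξ r s b)

theorem traj_congr {ξ' : ℕ → unitInterval} (h : ∀ i < b, ξ i = ξ' i) :
    traj ξ r s b = traj ξ' r s b := by
  induction b with
  | zero => rfl
  | succ b ih => rw [traj, traj, ih fun i hi => h i (by omega), h b (by omega)]

theorem base_traj (hs : Base T ρ n x 0 s) (hx : ∀ a < n, ‖x a‖ ≤ 1) (b : ℕ) :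
    Base T ρ n x b (traj ξ r s b) := by
  induction b with
  | zero => exact hs
  | succ b ih => exact (ih.batchOut hx _ _).1

theorem arm_traj (hs : Base T ρ n x 0 s) (hx : ∀ a < n, ‖x a‖ ≤ 1) {c : ℕ} (hbc : b ≤ c) {t : ℕ}
    (ht : t < batchStart d T b) : (traj ξ r s c).arm t = (traj ξ r s b).arm t := by
  induction c, hbc using Nat.le_induction with
  | base => rfl
  | succ c hc ih =>
    rw [traj, ((base_traj hs hx c).batchOut hx _ _).2.1 t (ht.trans_le (batchStart_mono d T hc)), ih]

theorem slot_arm_traj (hs : Base T ρ n x 0 s) (hx : ∀ a < n, ‖x a‖ ≤ 1) {c : ℕ} (hbc : b < c)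
    {j i : ℕ} (hj : j < d) (hi : i < slotLen T b) :
    (traj ξ r s c).arm (batchStart d T b + j * slotLen T b + i) =
      (spanned (traj ξ r s b)).nat 2 j := by
  rw [arm_traj hs hx (b := b + 1) hbc, traj]
  · exact ((base_traj hs hx b).batchOut hx _ _).2.2 j hj i hi
  · rw [batchStart_succ]
    have := Nat.mul_le_mul_right (slotLen T b) (show j + 1 ≤ d from hj)
    rw [Nat.succ_mul] at this
    omega

theorem run_batches (hs : Base T ρ n x 0 s) (hx : ∀ a < n, ‖x a‖ ≤ 1) (hd : 1 ≤ d) (hT : 2 ≤ T)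
    (hρ1 : ρ ≤ 1) :
    Run ξ r [.loop another batch] s (numBatches d T ρ * (batchTime d T n + 1) + 1)
      (fun s' => s' = traj ξ r s (numBatches d T ρ)) := by
  have hh : ∀ i, another.Holds (traj ξ r s i) ↔ 1 ≤ ρ * T ∧ batchStart d T (i + 1) ≤ T := by
    intro i
    have hB := base_traj (ξ := ξ) (r := r) hs hx i
    simp only [another, BExpr.Holds, RExpr.val, NExpr.val, hB.rho, hB.horizon, hB.time, hB.dim,
      hB.slotLen, not_lt, Rat.cast_one]
    rw [batchStart_succ]
    norm_cast
  refine (Run.loop (fun i s' => i ≤ numBatches d T ρ ∧ s' = traj ξ r s i) ?_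
    ⟨Nat.zero_le _, rfl⟩).mono le_rfl ?_
  · rintro i s' ⟨hi, rfl⟩ hb
    rw [hh] at hb
    have hlt : i < numBatches d T ρ := by
      refine lt_of_le_of_ne hi ?_
      rintro rfl
      exact numBatches_spec hd hT hb
    refine ⟨hlt, ((base_traj hs hx i).run_batch hx hd hT hρ1 hlt).mono le_rfl ?_⟩
    rintro s' rfl
    exact ⟨hlt, rfl⟩
  · rintro s' ⟨hn, i, -, hi, rfl⟩
    rw [hh] at hn
    rcases hi.lt_or_eq with h | rfl
    · exact absurd (of_lt_numBatches h) hn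
    · rfl

theorem Base.run_commit (hs : Base T ρ n x b s) (hb : batchStart d T b ≤ T) :
    Run ξ r commit s (T * 3 + 1) (fun s' => s'.rounds = T ∧
      ∀ t < T, s'.arm t = if t < batchStart d T b then s.arm t else s.nat 7 0) := by
  set t₀ := batchStart d T b with ht₀
  refine (Run.loop (N := T - t₀) (C := 2) (fun i s' => s'.nat 6 0 = t₀ + i ∧ s'.rounds = t₀ + i ∧
    s'.nat 0 1 = T ∧ s'.nat 7 0 = s.nat 7 0 ∧
    ∀ t < t₀ + i, s'.arm t = if t < t₀ then s.arm t else s.nat 7 0) ?_ ?_).mono (by gcongr; omega) ?_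
  · rintro i s' ⟨h6, hr, h0, h7, ha⟩ hlt
    simp only [BExpr.Holds, NExpr.val, h6, h0] at hlt
    refine ⟨by omega, Run.pull (Run.setN (Run.nil ⟨?_, ?_, ?_, ?_, ?_⟩))⟩
    · simp [State.writeN, State.afterPull, State.writeR, NExpr.val, h6, add_assoc]
    · simp [State.writeN, State.afterPull, hr, add_assoc]
    · simp [State.writeN, State.afterPull, State.writeR, h0]
    · simp [State.writeN, State.afterPull, State.writeR, h7]
    · intro t ht
      simp only [State.writeN, State.afterPull, hr, NExpr.val, h7, Function.update_apply]
      by_cases h : t = t₀ + i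
      · rw [if_pos h, if_neg (by omega)]
      · rw [if_neg h, ha t (by omega)]
  · exact ⟨hs.time, hs.rounds, hs.horizon, rfl, fun t ht => by rw [if_pos (by omega)]⟩
  · rintro s' ⟨hn, i, hi, h6, hr, h0, -, ha⟩
    simp only [BExpr.Holds, NExpr.val, h6, h0] at hn
    have : t₀ + i = T := by omega
    rw [this] at hr ha
    exact ⟨hr, ha⟩

theorem clog_le (T : ℕ) : Nat.clog 2 T ≤ T :=
  Nat.clog_le_of_le_pow Nat.lt_two_pow_self.le

theorem run_setup (hn : 1 ≤ n) (hρ : 0 < ρ) :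
    Run ξ r setup (start [] T ρ n x).state (T * 3 + 1 + 1 + (n * 3 + 2 + 2)) (fun s' =>
      Base T ρ n x 0 s' ∧ (∀ a < n, 0 < s'.nat 1 a) ∧ s'.nat 7 0 = 0) := by
  have hc := clog_le T
  refine (Run.setN (N := (Nat.clog 2 T * 3 + 1) + (n * 3 + 2 + 1 + 1)) ?_).mono (by omega)
    (fun _ h => h)
  set s₀ := (start [] T ρ n x).state with hs₀
  have f₀ : Fr ⟨[3], [], false, false⟩ s₀ (s₀.writeN 3 0 1) := Fr.writeN (by simp)
  refine Run.append (Run.loop (N := Nat.clog 2 T) (C := 2) (fun i s' =>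
    Fr ⟨[3, 4], [], false, false⟩ s₀ s' ∧ i ≤ Nat.clog 2 T ∧ s'.nat 3 0 = 2 ^ i ∧
      s'.nat 4 0 = 16 * i) ?_ ?_) ?_
  · rintro i s' ⟨hf, hi, h3, h4⟩ hlt
    have h0 : s'.nat 0 1 = T := by rw [hf.nat 0 (by simp)]; simp [hs₀, start]
    simp only [BExpr.Holds, NExpr.val, h0, h3] at hlt
    have hlt' : i < Nat.clog 2 T := by
      rw [Nat.lt_clog_iff_pow_lt (by norm_num)]; exact hlt
    refine ⟨hlt', Run.setN (Run.setN (Run.nil ⟨?_, hlt', ?_, ?_⟩))⟩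
    · exact (hf.trans (Fr.writeN (by simp))).trans (Fr.writeN (by simp))
    · simp [State.writeN, NExpr.val, h3, pow_succ]; omega
    · simp [State.writeN, NExpr.val, h4]; omega
  · exact ⟨Fr.writeN (by simp), Nat.zero_le _, by simp [State.writeN, NExpr.val], by
      simp [State.writeN, NExpr.val, hs₀, start]⟩
  · rintro s₁ ⟨hnb, i, -, hf, hi, h3, h4⟩
    have h0 : s₁.nat 0 1 = T := by rw [hf.nat 0 (by simp)]; simp [hs₀, start]
    simp only [BExpr.Holds, NExpr.val, h0, h3, not_lt] at hnb
    have hi' : i = Nat.clog 2 T := le_antisymm hi (Nat.clog_le_of_le_pow hnb)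
    subst hi'
    refine Run.setN (Run.setR ?_)
    set s₂ := (s₁.writeN 5 (NExpr.val s₁ (.const 0)) (NExpr.val s₁ (nv 4))).writeR 6
      (NExpr.val (s₁.writeN 5 (NExpr.val s₁ (.const 0)) (NExpr.val s₁ (nv 4))) (.const 0))
      (NExpr.val (s₁.writeN 5 (NExpr.val s₁ (.const 0)) (NExpr.val s₁ (nv 4))) (.const 0))
      (RExpr.val (s₁.writeN 5 (NExpr.val s₁ (.const 0)) (NExpr.val s₁ (nv 4))) (.const 1)) with hs₂
    have hf₂ : Fr ⟨[3, 4, 5], [6], false, false⟩ s₀ s₂ := by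
      refine Fr.trans (Fr.trans ⟨fun k hk => hf.nat k (fun h => hk ?_), fun k hk => hf.real k (by simp),
        hf.rounds, hf.arm, hf.draws⟩ (Fr.writeN (by simp))) (Fr.writeR (by simp))
      simp only [List.mem_cons, List.not_mem_nil, or_false] at h ⊢
      omega
    have g4 : s₂.nat 4 0 = ell T := by simp [hs₂, State.writeN, State.writeR, h4, ell]
    have g5 : s₂.nat 5 0 = ell T := by
      simp [hs₂, State.writeN, State.writeR, h4, ell, NExpr.val]
    have g6 : s₂.real 6 0 0 = 1 := by
      simp [hs₂, State.writeN, State.writeR, NExpr.val, RExpr.val]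
    clear_value s₂
    refine (Run.forTo (w := ⟨[1, 9], [], false, false⟩) (C := 1) (N := n) (by simp) rfl
      (fun i s' => ∀ a < i, 0 < s'.nat 1 a) ?_ (by simp) ?_).mono le_rfl ?_
    · intro s' hf'
      rw [NExpr.val, hf'.nat 0 (by simp), hf₂.nat 0 (by simp)]
      simp [hs₀, start, NExpr.val]
    · intro i hi s' hf' hk hI
      refine Run.setN (Run.nil ⟨by simp [State.writeN, hk], fun a ha => ?_⟩)
      by_cases hai : a = i
      · simp [State.writeN, NExpr.val, hk, hai]
      · simpa [State.writeN, NExpr.val, hk, hai] using hI a (by omega)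
    · rintro s' ⟨hf', -, hI⟩
      have k0 : s'.nat 0 = s₀.nat 0 := by rw [hf'.nat 0 (by simp), hf₂.nat 0 (by simp)]
      have k7 : s'.nat 7 0 = 0 := by
        rw [hf'.nat 7 (by simp), hf₂.nat 7 (by simp)]; simp [hs₀, start]
      refine ⟨⟨?_, ?_, ?_, ?_, hρ, ?_, ?_, ?_, ?_, ?_, ?_, ?_, ?_, ?_, ?_⟩, hI, k7⟩
      · rw [k0]; simp [hs₀, start]
      · rw [k0]; simp [hs₀, start]
      · rw [k0]; simp [hs₀, start]
      · rw [hf'.real 0 (by simp), hf₂.real 0 (by simp)]; simp [hs₀, start]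
      · intro a ha j
        rw [hf'.real 1 (by simp), hf₂.real 1 (by simp)]; simp [hs₀, start, ha]
      · rw [hf'.nat 4 (by simp), g4]
      · rw [hf'.nat 5 (by simp), g5]; simp [slotLen]
      · rw [hf'.nat 6 (by simp), hf₂.nat 6 (by simp)]; simp [hs₀, start, batchStart]
      · rw [hf'.rounds rfl, hf₂.rounds rfl]; simp [hs₀, start, batchStart]
      · rw [hf'.draws rfl, hf₂.draws rfl]; simp [hs₀, start]
      · omega
      · exact hI _ (by omega)
      · rw [hf'.real 6 (by simp), g6]; simp
      · simp [batchStart]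

/-- The state before the first batch. -/
noncomputable def initial {d : ℕ} (T : ℕ) (ρ : ℝ) (n : ℕ) (x : ℕ → EuclideanSpace ℝ (Fin d)) : State :=
  final (fun _ => 0) (fun _ _ => 0) ⟨setup, (start [] T ρ n x).state⟩

theorem initial_spec (hn : 1 ≤ n) (hρ : 0 < ρ) : Base T ρ n x 0 (initial T ρ n x) ∧
    (∀ a < n, 0 < (initial T ρ n x).nat 1 a) ∧ (initial T ρ n x).nat 7 0 = 0 :=
  (run_setup hn hρ).final

/-- Steps of the program. -/
def programTime (d T n : ℕ) : ℕ :=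
  (T * 3 + 1 + 1 + (n * 3 + 2 + 2)) + ((T * (batchTime d T n + 1) + 1) + (T * 3 + 1))

theorem numBatches_le (hd : 1 ≤ d) (hT : 2 ≤ T) : numBatches d T ρ ≤ T := by
  have h1 := le_batchStart (d := d) hT (numBatches d T ρ)
  have h2 := Nat.le_mul_of_pos_left (numBatches d T ρ) hd
  have := batchStart_numBatches_le (d := d) (T := T) (ρ := ρ)
  omega

/-- The arm played in round `t`. -/
noncomputable def armAt (ξ : ℕ → unitInterval) (r : ℕ → ℕ → ℝ) (T : ℕ) (ρ : ℝ) (n : ℕ)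
    (x : ℕ → EuclideanSpace ℝ (Fin d)) (t : ℕ) : ℕ :=
  if t < batchStart d T (numBatches d T ρ) then
    (traj ξ r (initial T ρ n x) (numBatches d T ρ)).arm t
  else (traj ξ r (initial T ρ n x) (numBatches d T ρ)).nat 7 0

theorem run_phasedElimination (hn : 1 ≤ n) (hρ : 0 < ρ) (hx : ∀ a < n, ‖x a‖ ≤ 1) (hd : 1 ≤ d)
    (hT : 2 ≤ T) (hρ1 : ρ ≤ 1) :
    Run ξ r phasedElimination (start [] T ρ n x).state (programTime d T n) (fun s' =>
      s'.rounds = T ∧ ∀ t < T, s'.arm t = armAt ξ r T ρ n x t) := by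
  have hB := (initial_spec (T := T) (x := x) hn hρ).1
  obtain ⟨m, hm, s', he, hq⟩ := run_setup (ξ := fun _ => 0) (r := fun _ _ => 0) (T := T) (x := x) hn hρ
  obtain ⟨m', hm', he'⟩ := he.congr (w := ⟨[1, 3, 4, 5, 9], [6], false, false⟩) rfl rfl rfl ξ r
  have hi : initial T ρ n x = s' := he.final_eq
  refine Run.append (Q₁ := fun s' => s' = initial T ρ n x) ⟨m', hm'.trans hm, s', he', hi.symm⟩ ?_
  rintro _ rfl
  refine Run.append ((run_batches hB hx hd hT hρ1).mono
    (Nat.add_le_add_right (Nat.mul_le_mul_right _ (numBatches_le hd hT)) 1) (fun _ h => h)) ?_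
  rintro _ rfl
  exact (base_traj hB hx _).run_commit batchStart_numBatches_le

theorem armAt_lt (hn : 1 ≤ n) (hρ : 0 < ρ) (hx : ∀ a < n, ‖x a‖ ≤ 1) (t : ℕ) :
    armAt ξ r T ρ n x t < n := by
  have hB := base_traj (ξ := ξ) (r := r) (initial_spec (T := T) (x := x) hn hρ).1 hx (numBatches d T ρ)
  unfold armAt
  split_ifs with h
  · exact hB.arms t h
  · exact hB.best_lt

end LinearBandit

namespace LinearBandit
open RealRAM

variable {ξ : ℕ → unitInterval} {d T n b : ℕ} {ρ : ℝ}
  {x : ℕ → EuclideanSpace ℝ (Fin d)} {s : State} {θ : EuclideanSpace ℝ (Fin d)} {η : ℕ → ℝ}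

/-! ### Correctness when the noise averages are small -/

/-- The rewards with parameter `θ` and noise `η`. -/
noncomputable def reward {d : ℕ} (θ : EuclideanSpace ℝ (Fin d)) (x : ℕ → EuclideanSpace ℝ (Fin d)) (η : ℕ → ℝ) :
    ℕ → ℕ → ℝ :=
  fun t i => inner ℝ θ (x i) + η t

/-- The width of the grid in batch `b`. -/
noncomputable def gridWidth (d T : ℕ) (ρ : ℝ) (b : ℕ) : ℝ := ell T * d * (1 / 2) ^ b / ρ

/-- The total noise of slot `j` of batch `b`. -/
def slotNoise (d T : ℕ) (η : ℕ → ℝ) (b j : ℕ) : ℝ :=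
  ∑ i ∈ Finset.range (slotLen T b), η (batchStart d T b + j * slotLen T b + i)

/-- The noise average of every slot of batch `b` is at most `2 ^ (-b)`. -/
def QuietBatch (d T : ℕ) (η : ℕ → ℝ) (b : ℕ) : Prop :=
  ∀ j < d, |slotNoise d T η b j| ≤ slotLen T b * (1 / 2) ^ b

theorem slotVal_eq (hs : Base T ρ n x b s) (hx : ∀ a < n, ‖x a‖ ≤ 1) (hT : 2 ≤ T) (u : ℝ) (j : ℕ) :
    slotVal (reward θ x η) (prepared u s) j =
      gridRound (gridWidth d T ρ b * u - gridWidth d T ρ b - 2) (gridWidth d T ρ b)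
        (inner ℝ θ (x ((spanned s).nat 2 j)) + slotNoise d T η b j / slotLen T b) := by
  obtain ⟨h1, h2, h3, h4, -, -, h7, -⟩ := hs.prepared hx u
  have hm : (slotLen T b : ℝ) ≠ 0 := by
    have := slotLen_pos hT b
    positivity
  rw [slotVal, gridStart, hs.alpha_prepared hx, h3, h4, hs.rounds, h1 5 (by simp [spanFoot]), hs.slotLen,
    h7]
  simp only [reward, slotNoise, gridWidth, Finset.sum_add_distrib, Finset.sum_const, Finset.card_range,
    nsmul_eq_mul]
  rw [add_div, mul_div_cancel_left₀ _ hm]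

theorem abs_inner_le {v w : EuclideanSpace ℝ (Fin d)} (hv : ‖v‖ ≤ 1) (hw : ‖w‖ ≤ 1) :
    |inner ℝ v w| ≤ 1 :=
  (abs_real_inner_le_norm v w).trans (mul_le_one₀ hv (norm_nonneg _) hw)

theorem QuietBatch.div_le (hη : QuietBatch d T η b) (hT : 2 ≤ T) {j : ℕ} (hj : j < d) :
    |slotNoise d T η b j / slotLen T b| ≤ (1 / 2) ^ b := by
  have := slotLen_pos hT b
  rw [abs_div, Nat.abs_cast, div_le_iff₀ (by positivity), mul_comm]
  exact hη j hj

theorem Base.abs_slotVal_sub_le (hs : Base T ρ n x b s) (hx : ∀ a < n, ‖x a‖ ≤ 1) (hd : 1 ≤ d)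
    (hT : 2 ≤ T) (hρ1 : ρ ≤ 1) (hθ : ‖θ‖ ≤ 1) (hη : QuietBatch d T η b) {u : ℝ} (hu : u ≤ 1)
    {j : ℕ} (hj : j < d) :
    |slotVal (reward θ x η) (LinearBandit.prepared u s) j -
      inner ℝ θ (x ((LinearBandit.spanned s).nat 2 j))| ≤ 2 * gridWidth d T ρ b := by
  rw [slotVal_eq hs hx hT]
  have hlt := ((hs.prepared hx u).2.2.2.2.2.2.2 j hj).1
  have hin := abs_le.1 (abs_inner_le hθ (hx _ hlt))
  have hno := abs_le.1 (hη.div_le hT hj)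
  have hge : (1 / 2 : ℝ) ^ b ≤ gridWidth d T ρ b := alpha_ge hd hT hs.rho_pos hρ1
  have hpos : (0 : ℝ) < (1 / 2) ^ b := by positivity
  have hle : (1 / 2 : ℝ) ^ b ≤ 1 := pow_le_one₀ (by norm_num) (by norm_num)
  have hu' : gridWidth d T ρ b * u ≤ gridWidth d T ρ b * 1 := by gcongr; linarith
  have := abs_le.1 (abs_gridRound_sub_le (z₀ := gridWidth d T ρ b * u - gridWidth d T ρ b - 2)
    (α := gridWidth d T ρ b) (y := inner ℝ θ (x ((LinearBandit.spanned s).nat 2 j)) +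
      slotNoise d T η b j / LinearBandit.slotLen T b) (by linarith) (by linarith) (by linarith))
  rw [abs_le]
  constructor <;> linarith

theorem inner_eq_dotProduct (v w : EuclideanSpace ℝ (Fin d)) :
    inner ℝ v w = (fun i => w i) ⬝ᵥ (fun i => v i) := by
  simp [PiLp.inner_apply, dotProduct]

theorem Base.abs_est_sub_le (hs : Base T ρ n x b s) (hx : ∀ a < n, ‖x a‖ ≤ 1) (hd : 1 ≤ d)
    (hT : 2 ≤ T) (hρ1 : ρ ≤ 1) (hθ : ‖θ‖ ≤ 1) (hη : QuietBatch d T η b) {u : ℝ} (hu : u ≤ 1)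
    {a : ℕ} (ha : a < n) (hact : 0 < s.nat 1 a) :
    |est (LinearBandit.measured (reward θ x η) u s) d a - inner ℝ θ (x a)| ≤
      4 * d * gridWidth d T ρ b := by
  obtain ⟨-, b', hb', hc⟩ := hs.spanned hx
  obtain ⟨-, -, -, g2, g3, g4, -⟩ := hs.measured hx u (reward θ x η)
  have hge : (1 / 2 : ℝ) ^ b ≤ gridWidth d T ρ b := alpha_ge hd hT hs.rho_pos hρ1
  have hpos : (0 : ℝ) < (1 / 2) ^ b := by positivity
  have hμ : inner ℝ θ (x a) =
      ∑ i : Fin d, (LinearBandit.spanned s).real 2 a i * (b' i ⬝ᵥ fun k => θ k) := by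
    rw [inner_eq_dotProduct, hb'.rep a ha, sum_dotProduct]
    simp only [smul_dotProduct, smul_eq_mul]
  have he : est (LinearBandit.measured (reward θ x η) u s) d a =
      ∑ i : Fin d, (LinearBandit.spanned s).real 3 i 0 * ((LinearBandit.spanned s).real 2 a i *
        slotVal (reward θ x η) (LinearBandit.prepared u s) i) := by
    rw [est, Finset.sum_range]
    refine Finset.sum_congr rfl fun i _ => ?_
    rw [g2, g3, g4 i i.2]
  rw [hμ, he, ← Finset.sum_sub_distrib]
  refine (Finset.abs_sum_le_sum_abs _ _).trans ?_
  have : ∑ _i : Fin d, 4 * gridWidth d T ρ b = 4 * d * gridWidth d T ρ b := by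
    simp; ring
  rw [← this]
  refine Finset.sum_le_sum fun i _ => ?_
  have h2 : |(LinearBandit.spanned s).real 2 a i| ≤ 2 := by
    have := hc a ha i i.2 hact
    rw [← abs_mul_abs_self] at this
    by_contra h
    push Not at h
    nlinarith
  rcases hb'.slot i with ⟨hf, hl, -, hbi⟩ | ⟨hf, -, hbi⟩
  · have h1 := hs.abs_slotVal_sub_le hx hd hT hρ1 hθ hη hu i.2
    rw [inner_eq_dotProduct] at h1
    rw [hf, hbi, one_mul, ← mul_sub, abs_mul]
    calc _ ≤ 2 * (2 * gridWidth d T ρ b) := by gcongr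
      _ = _ := by ring
  · have h1 : |θ i| ≤ 1 := abs_coord_le hθ i
    rw [hf, hbi, zero_mul, zero_sub, abs_neg, single_dotProduct, abs_mul, abs_mul, abs_of_pos hpos]
    calc _ ≤ 2 * ((1 / 2) ^ b * 1) := by gcongr
      _ ≤ 4 * gridWidth d T ρ b := by linarith

/-- A bound for the gaps of the active points in batch `b`. -/
noncomputable def gapBound (d T : ℕ) (ρ : ℝ) (b : ℕ) : ℝ := 32 * d * gridWidth d T ρ b

/-- The point `a₀` is active, and all active points are nearly as good. -/
def Accurate {d : ℕ} (T : ℕ) (ρ : ℝ) (n : ℕ) (x : ℕ → EuclideanSpace ℝ (Fin d))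
    (θ : EuclideanSpace ℝ (Fin d)) (a₀ b : ℕ) (s : State) : Prop :=
  0 < s.nat 1 a₀ ∧ ∀ a < n, 0 < s.nat 1 a →
    inner ℝ θ (x a₀) - inner ℝ θ (x a) ≤ gapBound d T ρ b

theorem Base.accurate_batchOut (hs : Base T ρ n x b s) (hx : ∀ a < n, ‖x a‖ ≤ 1) (hd : 1 ≤ d)
    (hT : 2 ≤ T) (hρ1 : ρ ≤ 1) (hθ : ‖θ‖ ≤ 1) (hη : QuietBatch d T η b) {u : ℝ} (hu : u ≤ 1) {a₀ : ℕ}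
    (ha₀ : a₀ < n) (hbest : ∀ a < n, inner ℝ θ (x a) ≤ inner ℝ θ (x a₀))
    (hacc : Accurate T ρ n x θ a₀ b s) :
    Accurate T ρ n x θ a₀ (b + 1) (LinearBandit.batchOut (reward θ x η) u s) := by
  obtain ⟨-, -, s', -, rfl, -, q1, q2, q3, q4, -⟩ :=
    hs.run_eliminate (ξ := fun _ => 0) (r := fun _ _ => 0) hx u (reward θ x η)
  have hE := fun a ha hact => abs_le.1 (hs.abs_est_sub_le (a := a) hx hd hT hρ1 hθ hη hu ha hact)
  change ∀ a < n, _ = if _ + 8 * (d : ℝ) * gridWidth d T ρ b < _ then _ else _ at q4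
  have h0 := hE a₀ ha₀ hacc.1
  have hc := hE _ q1 q2
  have hbc := hbest _ q1
  refine ⟨?_, fun a ha hact => ?_⟩
  · rw [q4 a₀ ha₀, if_neg]
    · exact hacc.1
    · rw [not_lt]; linarith [h0.1, hc.2]
  · rw [q4 a ha] at hact
    split_ifs at hact with h
    · omega
    · rw [not_lt] at h
      have h1 := hE a ha hact
      have h2 := q3 a₀ ha₀ hacc.1
      have h3 : gapBound d T ρ (b + 1) = 16 * d * gridWidth d T ρ b := by
        rw [gapBound, gridWidth, gridWidth, pow_succ]; ring
      rw [h3]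
      linarith [h1.2, h0.1]

/-- All points are active at the beginning. -/
theorem accurate_initial (hn : 1 ≤ n) (hρ : 0 < ρ) (hρ1 : ρ ≤ 1) (hx : ∀ a < n, ‖x a‖ ≤ 1)
    (hd : 1 ≤ d) (hT : 2 ≤ T) (hθ : ‖θ‖ ≤ 1) {a₀ : ℕ} (ha₀ : a₀ < n) :
    Accurate T ρ n x θ a₀ 0 (initial T ρ n x) := by
  obtain ⟨-, h, -⟩ := initial_spec (T := T) (x := x) hn hρ
  refine ⟨h a₀ ha₀, fun a ha _ => ?_⟩
  have h0 := abs_le.1 (abs_inner_le hθ (hx a ha))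
  have h1 := abs_le.1 (abs_inner_le hθ (hx a₀ ha₀))
  have h2 : (1 / 2 : ℝ) ^ 0 ≤ gridWidth d T ρ 0 := alpha_ge hd hT hρ hρ1
  have h3 : (1 : ℝ) ≤ d := by exact_mod_cast hd
  rw [pow_zero] at h2
  have h4 : (1 : ℝ) ≤ d * gridWidth d T ρ 0 := by nlinarith
  rw [gapBound]
  linarith

theorem accurate_traj (hn : 1 ≤ n) (hρ : 0 < ρ) (hρ1 : ρ ≤ 1) (hx : ∀ a < n, ‖x a‖ ≤ 1)
    (hd : 1 ≤ d) (hT : 2 ≤ T) (hθ : ‖θ‖ ≤ 1) {a₀ : ℕ} (ha₀ : a₀ < n)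
    (hbest : ∀ a < n, inner ℝ θ (x a) ≤ inner ℝ θ (x a₀)) (hη : ∀ c < b, QuietBatch d T η c) :
    Accurate T ρ n x θ a₀ b (traj ξ (reward θ x η) (initial T ρ n x) b) := by
  induction b with
  | zero => exact accurate_initial hn hρ hρ1 hx hd hT hθ ha₀
  | succ b ih =>
    exact (base_traj (initial_spec hn hρ).1 hx b).accurate_batchOut hx hd hT hρ1 hθ
      (hη b (by omega)) (ξ b).2.2 ha₀ hbest (ih fun c hc => hη c (by omega))

/-- The gap of the arm played in round `t` of batch `b`. -/
theorem gap_armAt_le (hn : 1 ≤ n) (hρ : 0 < ρ) (hρ1 : ρ ≤ 1) (hx : ∀ a < n, ‖x a‖ ≤ 1)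
    (hd : 1 ≤ d) (hT : 2 ≤ T) (hθ : ‖θ‖ ≤ 1) {a₀ : ℕ} (ha₀ : a₀ < n)
    (hbest : ∀ a < n, inner ℝ θ (x a) ≤ inner ℝ θ (x a₀))
    (hη : ∀ c < numBatches d T ρ, QuietBatch d T η c) (hb : b ≤ numBatches d T ρ) {t : ℕ}
    (ht : batchStart d T b ≤ t) (ht' : b < numBatches d T ρ → t < batchStart d T (b + 1)) :
    inner ℝ θ (x a₀) - inner ℝ θ (x (armAt ξ (reward θ x η) T ρ n x t)) ≤ gapBound d T ρ b := by
  have hB := (initial_spec (T := T) (x := x) hn hρ).1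
  have hBb := base_traj (ξ := ξ) (r := reward θ x η) hB hx b
  obtain ⟨-, hacc⟩ := accurate_traj (ξ := ξ) (b := b) hn hρ hρ1 hx hd hT hθ ha₀ hbest
    (fun c hc => hη c (by omega))
  rcases hb.lt_or_eq with h | rfl
  · have ht'' := ht' h
    rw [armAt, if_pos (ht''.trans_le (batchStart_mono d T h))]
    obtain ⟨c, rfl⟩ := Nat.exists_eq_add_of_le ht
    rw [batchStart_succ] at ht''
    have hL := slotLen_pos hT b
    have hj : c / slotLen T b < d := by
      rw [Nat.div_lt_iff_lt_mul hL]; omega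
    have := slot_arm_traj (ξ := ξ) (r := reward θ x η) hB hx h hj (Nat.mod_lt c hL)
    rw [add_assoc, Nat.div_add_mod'] at this
    rw [this]
    have h2 := (hBb.prepared hx 0).2.2.2.2.2.2.2 _ hj
    exact hacc _ h2.1 h2.2
  · rw [armAt, if_neg (not_lt.2 ht)]
    exact hacc _ hBb.best_lt hBb.best_act

/-! ### Coupling with the noiseless run -/

/-- Basis arm `j` of batch `b` of the noiseless run. -/
noncomputable def idealArm {d : ℕ} (ξ : ℕ → unitInterval) (T : ℕ) (ρ : ℝ) (n : ℕ)
    (x : ℕ → EuclideanSpace ℝ (Fin d)) (θ : EuclideanSpace ℝ (Fin d)) (b j : ℕ) : ℕ :=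
  (spanned (traj ξ (reward θ x 0) (initial T ρ n x) b)).nat 2 j

/-- The mean `μ` is not close to the grid shifted by `u`. -/
def OffGrid (d T : ℕ) (ρ : ℝ) (b : ℕ) (u μ : ℝ) : Prop :=
  ∀ k : ℕ, (1 / 2) ^ b < |gridWidth d T ρ b * u - gridWidth d T ρ b - 2 + k * gridWidth d T ρ b - μ|

theorem Base.batchOut_eq_ideal (hs : Base T ρ n x b s) (hx : ∀ a < n, ‖x a‖ ≤ 1)
    (hT : 2 ≤ T) (hη : QuietBatch d T η b) {u : ℝ}
    (hu : ∀ j < d, OffGrid d T ρ b u (inner ℝ θ (x ((LinearBandit.spanned s).nat 2 j)))) :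
    LinearBandit.batchOut (reward θ x η) u s = LinearBandit.batchOut (reward θ x 0) u s := by
  unfold LinearBandit.batchOut LinearBandit.measured
  rw [slotIter_congr]
  intro j hj
  rw [hs.dim] at hj
  rw [slotVal_eq hs hx hT, slotVal_eq hs hx hT]
  refine gridRound_congr fun k => ?_
  have h1 := hu j hj k
  have h2 := abs_le.1 (hη.div_le hT hj)
  have h3 : slotNoise d T 0 b j = 0 := by simp [slotNoise]
  rw [h3, zero_div, add_zero]
  rcases lt_abs.1 h1 with h | h
  · constructor <;> intro h' <;> linarith
  · constructor <;> intro h' <;> linarith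

theorem traj_eq_ideal (hn : 1 ≤ n) (hρ : 0 < ρ) (hx : ∀ a < n, ‖x a‖ ≤ 1) (hT : 2 ≤ T)
    (hη : ∀ c < b, QuietBatch d T η c)
    (hξ : ∀ c < b, ∀ j < d, OffGrid d T ρ c (ξ c) (inner ℝ θ (x (idealArm ξ T ρ n x θ c j)))) :
    traj ξ (reward θ x η) (initial T ρ n x) b = traj ξ (reward θ x 0) (initial T ρ n x) b := by
  induction b with
  | zero => rfl
  | succ b ih =>
    have := ih (fun c hc => hη c (by omega)) (fun c hc => hξ c (by omega))
    rw [traj, traj, this]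
    exact (base_traj (initial_spec hn hρ).1 hx b).batchOut_eq_ideal hx hT (hη b (by omega))
      (hξ b (by omega))

theorem armAt_eq_ideal (hn : 1 ≤ n) (hρ : 0 < ρ) (hx : ∀ a < n, ‖x a‖ ≤ 1) (hT : 2 ≤ T)
    (hη : ∀ c < numBatches d T ρ, QuietBatch d T η c)
    (hξ : ∀ c < numBatches d T ρ, ∀ j < d,
      OffGrid d T ρ c (ξ c) (inner ℝ θ (x (idealArm ξ T ρ n x θ c j)))) (t : ℕ) :
    armAt ξ (reward θ x η) T ρ n x t = armAt ξ (reward θ x 0) T ρ n x t := by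
  rw [armAt, armAt, traj_eq_ideal hn hρ hx hT hη hξ]

theorem idealArm_congr {ξ' : ℕ → unitInterval} {j : ℕ} (h : ∀ i < b, ξ i = ξ' i) :
    idealArm ξ T ρ n x θ b j = idealArm ξ' T ρ n x θ b j := by
  rw [idealArm, idealArm, traj_congr h]

theorem idealArm_eq_armAt (hn : 1 ≤ n) (hρ : 0 < ρ) (hx : ∀ a < n, ‖x a‖ ≤ 1) (hT : 2 ≤ T)
    (hb : b < numBatches d T ρ) {j : ℕ} (hj : j < d) :
    idealArm ξ T ρ n x θ b j =
      armAt ξ (reward θ x 0) T ρ n x (batchStart d T b + j * slotLen T b) := by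
  have hL := slotLen_pos hT b
  have h1 : batchStart d T b + j * slotLen T b < batchStart d T (b + 1) := by
    rw [batchStart_succ]
    have := Nat.mul_le_mul_right (slotLen T b) (show j + 1 ≤ d from hj)
    rw [Nat.succ_mul] at this
    omega
  rw [armAt, if_pos (h1.trans_le (batchStart_mono d T hb))]
  exact (slot_arm_traj (initial_spec hn hρ).1 hx hb hj hL).symm

end LinearBandit

namespace RealRAM

/-! ### Measurability of runs -/

theorem measurable_of_cover {Ω ι β : Type*} [MeasurableSpace Ω] [MeasurableSpace β] {c : Ω → ι}
    {S : Set ι} (hS : S.Countable) (hc : ∀ ω, c ω ∈ S) (hm : ∀ i, MeasurableSet {ω | c ω = i})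
    {f : ι → Ω → β} (hf : ∀ i, Measurable (f i)) : Measurable fun ω => f (c ω) ω := by
  intro A hA
  have : (fun ω => f (c ω) ω) ⁻¹' A = ⋃ i ∈ S, ({ω | c ω = i} ∩ f i ⁻¹' A) := by
    ext ω
    simp only [Set.mem_preimage, Set.mem_iUnion, Set.mem_inter_iff, exists_prop]
    constructor
    · exact fun h => ⟨c ω, hc ω, rfl, h⟩
    · rintro ⟨i, -, rfl, h⟩
      exact h
  rw [this]
  exact MeasurableSet.biUnion hS fun i _ => (hm i).inter (hf i hA)

theorem measurable_comp_nat {Ω β : Type*} [MeasurableSpace Ω] [MeasurableSpace β] {c : Ω → ℕ}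
    (hc : Measurable c) {f : ℕ → Ω → β} (hf : ∀ i, Measurable (f i)) :
    Measurable fun ω => f (c ω) ω :=
  measurable_of_cover Set.countable_univ (fun _ => trivial)
    (fun i => hc (measurableSet_singleton i)) hf

variable {Ω : Type*} [MeasurableSpace Ω]

/-- All memory cells and counters are measurable. -/
structure MeasState (s : Ω → State) : Prop where
  nat : ∀ k i, Measurable fun ω => (s ω).nat k i
  real : ∀ k i j, Measurable fun ω => (s ω).real k i j
  draws : Measurable fun ω => (s ω).draws
  rounds : Measurable fun ω => (s ω).rounds
  arm : ∀ t, Measurable fun ω => (s ω).arm t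

/-- The code and the state are measurable. -/
structure MeasConfig (c : Ω → Config) : Prop where
  state : MeasState fun ω => (c ω).state
  range : ∃ S : Set (List Cmd), S.Countable ∧ ∀ ω, (c ω).code ∈ S
  code : ∀ L, MeasurableSet {ω | (c ω).code = L}

theorem MeasState.nexpr {s : Ω → State} (hs : MeasState s) (e : NExpr) :
    Measurable fun ω => e.val (s ω) := by
  induction e with
  | const c => exact measurable_const
  | read k i ih => exact measurable_comp_nat ih (hs.nat k)
  | add a b iha ihb => exact iha.add ihb
  | sub a b iha ihb => exact iha.sub ihb

theorem MeasState.rexpr {s : Ω → State} (hs : MeasState s) (e : RExpr) :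
    Measurable fun ω => e.val (s ω) := by
  induction e with
  | const c => exact measurable_const
  | ofNat a => exact measurable_from_nat.comp (hs.nexpr a)
  | read k i j =>
    exact measurable_comp_nat (f := fun a ω => (s ω).real k a (j.val (s ω))) (hs.nexpr i)
      fun a => measurable_comp_nat (f := fun b ω => (s ω).real k a b) (hs.nexpr j) fun b => hs.real k a b
  | add a b iha ihb => exact iha.add ihb
  | sub a b iha ihb => exact iha.sub ihb
  | mul a b iha ihb => exact iha.mul ihb
  | div a b iha ihb => exact iha.div ihb

theorem MeasState.bexpr {s : Ω → State} (hs : MeasState s) (b : BExpr) :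
    MeasurableSet {ω | b.Holds (s ω)} := by
  induction b with
  | ltN a b => exact measurableSet_lt (hs.nexpr a) (hs.nexpr b)
  | ltR a b => exact measurableSet_lt (hs.rexpr a) (hs.rexpr b)
  | not b ih => exact ih.compl
  | and a b iha ihb => exact iha.inter ihb

theorem MeasState.writeN {s : Ω → State} (hs : MeasState s) (k : ℕ) {i v : Ω → ℕ}
    (hi : Measurable i) (hv : Measurable v) : MeasState fun ω => (s ω).writeN k (i ω) (v ω) := by
  refine ⟨fun k' i' => ?_, hs.real, hs.draws, hs.rounds, hs.arm⟩
  refine Measurable.ite ?_ hv (hs.nat k' i')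
  by_cases h : k' = k
  · simpa [h] using measurableSet_eq_fun measurable_const hi
  · simp [h]

theorem MeasState.writeR {s : Ω → State} (hs : MeasState s) (k : ℕ) {i j : Ω → ℕ} {v : Ω → ℝ}
    (hi : Measurable i) (hj : Measurable j) (hv : Measurable v) :
    MeasState fun ω => (s ω).writeR k (i ω) (j ω) (v ω) := by
  refine ⟨hs.nat, fun k' i' j' => ?_, hs.draws, hs.rounds, hs.arm⟩
  refine Measurable.ite ?_ hv (hs.real k' i' j')
  by_cases h : k' = k
  · have : {ω | k' = k ∧ i' = i ω ∧ j' = j ω} = {ω | i' = i ω} ∩ {ω | j' = j ω} := by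
      ext ω; simp [h]
    rw [this]
    exact (measurableSet_eq_fun measurable_const hi).inter (measurableSet_eq_fun measurable_const hj)
  · simp [h]

variable {ξ : Ω → ℕ → unitInterval} {r : Ω → ℕ → ℕ → ℝ}

theorem MeasState.step {s : Ω → State} (hs : MeasState s) (hξ : ∀ i, Measurable fun ω => ξ ω i)
    (hr : ∀ t a, Measurable fun ω => r ω t a) (L : List Cmd) :
    MeasState (fun ω => (step (ξ ω) (r ω) ⟨L, s ω⟩).state) ∧
    (∃ L₁ L₂, ∀ ω, (RealRAM.step (ξ ω) (r ω) ⟨L, s ω⟩).code = L₁ ∨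
      (RealRAM.step (ξ ω) (r ω) ⟨L, s ω⟩).code = L₂) ∧
    ∀ L', MeasurableSet {ω | (RealRAM.step (ξ ω) (r ω) ⟨L, s ω⟩).code = L'} := by
  match L with
  | [] => exact ⟨hs, ⟨[], [], fun _ => .inl rfl⟩, fun L' => MeasurableSet.const ([] = L')⟩
  | .setN k i e :: R =>
    exact ⟨hs.writeN k (hs.nexpr i) (hs.nexpr e), ⟨R, R, fun _ => .inl rfl⟩,
      fun L' => MeasurableSet.const (R = L')⟩
  | .setR k i j e :: R =>
    exact ⟨hs.writeR k (hs.nexpr i) (hs.nexpr j) (hs.rexpr e), ⟨R, R, fun _ => .inl rfl⟩,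
      fun L' => MeasurableSet.const (R = L')⟩
  | .draw k i j :: R =>
    have hv : Measurable fun ω => ((ξ ω (s ω).draws : unitInterval) : ℝ) :=
      measurable_subtype_coe.comp (measurable_comp_nat hs.draws hξ)
    have := hs.writeR k (hs.nexpr i) (hs.nexpr j) hv
    exact ⟨⟨this.nat, this.real, hs.draws.add_const 1, this.rounds, this.arm⟩,
      ⟨R, R, fun _ => .inl rfl⟩, fun L' => MeasurableSet.const (R = L')⟩
  | .pull a k i j :: R =>
    have hv : Measurable fun ω => r ω (s ω).rounds (a.val (s ω)) :=
      measurable_comp_nat (f := fun t ω => r ω t (a.val (s ω))) hs.rounds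
        fun t => measurable_comp_nat (f := fun b ω => r ω t b) (hs.nexpr a) fun b => hr t b
    have := hs.writeR k (hs.nexpr i) (hs.nexpr j) hv
    refine ⟨⟨this.nat, this.real, this.draws, hs.rounds.add_const 1, fun t => ?_⟩,
      ⟨R, R, fun _ => .inl rfl⟩, fun L' => MeasurableSet.const (R = L')⟩
    simp only [RealRAM.step, Function.update_apply]
    exact Measurable.ite (measurableSet_eq_fun measurable_const hs.rounds) (hs.nexpr a) (hs.arm t)
  | .ite b P Q :: R =>
    refine ⟨hs, ⟨P ++ R, Q ++ R, fun ω => ?_⟩, fun L' => ?_⟩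
    · by_cases h : b.Holds (s ω) <;> simp [RealRAM.step, h]
    · have : {ω | (RealRAM.step (ξ ω) (r ω) ⟨.ite b P Q :: R, s ω⟩).code = L'} =
          ({ω | b.Holds (s ω)} ∩ {_ω | P ++ R = L'}) ∪ ({ω | b.Holds (s ω)}ᶜ ∩ {_ω | Q ++ R = L'}) := by
        ext ω
        by_cases h : b.Holds (s ω) <;> simp [RealRAM.step, h]
      rw [this]
      exact ((hs.bexpr b).inter (.const _)).union ((hs.bexpr b).compl.inter (.const _))
  | .loop b P :: R =>
    refine ⟨hs, ⟨P ++ .loop b P :: R, R, fun ω => ?_⟩, fun L' => ?_⟩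
    · by_cases h : b.Holds (s ω) <;> simp [RealRAM.step, h]
    · have : {ω | (RealRAM.step (ξ ω) (r ω) ⟨.loop b P :: R, s ω⟩).code = L'} =
          ({ω | b.Holds (s ω)} ∩ {_ω | P ++ .loop b P :: R = L'}) ∪
            ({ω | b.Holds (s ω)}ᶜ ∩ {_ω | R = L'}) := by
        ext ω
        by_cases h : b.Holds (s ω) <;> simp [RealRAM.step, h]
      rw [this]
      exact ((hs.bexpr b).inter (.const _)).union ((hs.bexpr b).compl.inter (.const _))

theorem MeasConfig.step {c : Ω → Config} (hc : MeasConfig c) (hξ : ∀ i, Measurable fun ω => ξ ω i)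
    (hr : ∀ t a, Measurable fun ω => r ω t a) :
    MeasConfig fun ω => step (ξ ω) (r ω) (c ω) := by
  obtain ⟨S, hS, hcS⟩ := hc.range
  have key := hc.state.step hξ hr
  have glue : ∀ {β : Type} [MeasurableSpace β] (g : Config → β),
      (∀ L, Measurable fun ω => g (RealRAM.step (ξ ω) (r ω) ⟨L, (c ω).state⟩)) →
      Measurable fun ω => g (RealRAM.step (ξ ω) (r ω) (c ω)) := fun g hg =>
    measurable_of_cover (c := fun ω => (c ω).code) hS hcS hc.code hg
  refine ⟨⟨fun k i => ?_, fun k i j => ?_, ?_, ?_, fun t => ?_⟩, ?_, fun L => ?_⟩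
  · exact glue (fun c => c.state.nat k i) fun L => (key L).1.nat k i
  · exact glue (fun c => c.state.real k i j) fun L => (key L).1.real k i j
  · exact glue (fun c => c.state.draws) fun L => (key L).1.draws
  · exact glue (fun c => c.state.rounds) fun L => (key L).1.rounds
  · exact glue (fun c => c.state.arm t) fun L => (key L).1.arm t
  · choose L₁ L₂ h using fun L => (key L).2.1
    refine ⟨L₁ '' S ∪ L₂ '' S, (hS.image _).union (hS.image _), fun ω => ?_⟩
    rcases h (c ω).code ω with h | h
    · exact .inl ⟨_, hcS ω, h.symm⟩
    · exact .inr ⟨_, hcS ω, h.symm⟩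
  · have : Measurable fun ω => (RealRAM.step (ξ ω) (r ω) (c ω)).code = L :=
      glue (fun c => c.code = L) fun L' => measurableSet_setOfPred.1 ((key L').2.2 L)
    exact measurableSet_setOfPred.2 this

theorem MeasConfig.iterate_step (c₀ : Config) (hξ : ∀ i, Measurable fun ω => ξ ω i)
    (hr : ∀ t a, Measurable fun ω => r ω t a) (m : ℕ) :
    MeasConfig fun ω => (RealRAM.step (ξ ω) (r ω))^[m] c₀ := by
  induction m with
  | zero =>
    exact ⟨⟨fun k i => measurable_const (a := c₀.state.nat k i),
      fun k i j => measurable_const (a := c₀.state.real k i j),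
      measurable_const (a := c₀.state.draws), measurable_const (a := c₀.state.rounds),
      fun t => measurable_const (a := c₀.state.arm t)⟩,
      ⟨{c₀.code}, Set.countable_singleton _, fun _ => rfl⟩,
      fun L => MeasurableSet.const (c₀.code = L)⟩
  | succ m ih =>
    simp only [Function.iterate_succ_apply']
    exact ih.step hξ hr

theorem measurable_final_arm {c₀ : Config} (hξ : ∀ i, Measurable fun ω => ξ ω i)
    (hr : ∀ t a, Measurable fun ω => r ω t a) {m : ℕ} (hm : ∀ ω, HaltsWithin (ξ ω) (r ω) c₀ m) (t : ℕ) :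
    Measurable fun ω => (final (ξ ω) (r ω) c₀).arm t := by
  simp only [fun ω => (final_eq_of_haltsWithin (hm ω)).2]
  exact (MeasConfig.iterate_step c₀ hξ hr m).state.arm t

end RealRAM

namespace LinearBandit
open RealRAM

variable {Ω : Type*} [MeasurableSpace Ω] {ξ : Ω → ℕ → unitInterval} {η : Ω → ℕ → ℝ} {d T n : ℕ} {ρ : ℝ}
  {x : ℕ → EuclideanSpace ℝ (Fin d)} {θ : EuclideanSpace ℝ (Fin d)}

theorem measurable_armAt (hn : 1 ≤ n) (hρ : 0 < ρ) (hx : ∀ a < n, ‖x a‖ ≤ 1) (hd : 1 ≤ d)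
    (hT : 2 ≤ T) (hρ1 : ρ ≤ 1) (hξ : ∀ i, Measurable fun ω => ξ ω i)
    (hη : ∀ t, Measurable fun ω => η ω t) {t : ℕ} (ht : t < T) :
    Measurable fun ω => armAt (ξ ω) (reward θ x (η ω)) T ρ n x t := by
  have h := fun ω => run_phasedElimination (ξ := ξ ω) (r := reward θ x (η ω)) hn hρ hx hd hT hρ1
  have := measurable_final_arm (c₀ := ⟨phasedElimination, (start [] T ρ n x).state⟩)
    (r := fun ω => reward θ x (η ω)) hξ (fun t a => (hη t).const_add _) (fun ω => (h ω).haltsWithin) t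
  simpa only [fun ω => (h ω).final.2 t ht] using this

end LinearBandit

namespace LinearBandit
open RealRAM

instance : IsProbabilityMeasure seedLaw := by unfold seedLaw; infer_instance

instance (ν : ℕ → ProbabilityMeasure ℝ) : IsProbabilityMeasure (noiseLaw ν) := by
  unfold noiseLaw; infer_instance

/-! ### The probability of large noise averages -/

variable {ν : ℕ → ProbabilityMeasure ℝ} {d T n b : ℕ} {ρ : ℝ}
  {x : ℕ → EuclideanSpace ℝ (Fin d)} {θ : EuclideanSpace ℝ (Fin d)}

theorem hasSubgaussianMGF_eval (hν : IsSubgaussianNoise ν) (t : ℕ) :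
    HasSubgaussianMGF (fun η : ℕ → ℝ => η t) 1 (noiseLaw ν) := by
  have h := (hν t).2
  rw [← Measure.infinitePi_map_eval (fun t => (ν t : Measure ℝ)) t] at h
  exact HasSubgaussianMGF.of_map (X := id) (Y := fun η : ℕ → ℝ => η t)
    (measurable_pi_apply t).aemeasurable h

theorem iIndepFun_eval : iIndepFun (fun t (η : ℕ → ℝ) => η t) (noiseLaw ν) :=
  iIndepFun_infinitePi (X := fun _ y => y) fun _ => measurable_id

theorem measureReal_abs_sum_gt (hν : IsSubgaussianNoise ν) (t m : ℕ) {c : ℝ} (hc : 0 ≤ c) :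
    (noiseLaw ν).real {η | c < |∑ i ∈ Finset.range m, η (t + i)|} ≤
      2 * Real.exp (-c ^ 2 / (2 * m)) := by
  have hind : iIndepFun (fun i (η : ℕ → ℝ) => η (t + i)) (noiseLaw ν) :=
    iIndepFun_eval.precomp (g := fun i => t + i) (add_right_injective t)
  have h1 := HasSubgaussianMGF.measure_sum_range_ge_le_of_iIndepFun hind (c := 1) (n := m)
    (fun i _ => hasSubgaussianMGF_eval hν (t + i)) hc
  have hind' : iIndepFun (fun i (η : ℕ → ℝ) => -η (t + i)) (noiseLaw ν) :=
    hind.comp (fun _ y => -y) fun _ => measurable_neg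
  have h2 := HasSubgaussianMGF.measure_sum_range_ge_le_of_iIndepFun hind' (c := 1) (n := m)
    (fun i _ => (hasSubgaussianMGF_eval hν (t + i)).neg) hc
  simp only [NNReal.coe_one, mul_one, Finset.sum_neg_distrib] at h1 h2
  calc _ ≤ (noiseLaw ν).real ({η | c ≤ ∑ i ∈ Finset.range m, η (t + i)} ∪
        {η | c ≤ -∑ i ∈ Finset.range m, η (t + i)}) := by
        refine measureReal_mono ?_
        intro η hη
        rcases lt_abs.1 (show c < |_| from hη) with h | h
        · exact .inl h.le
        · exact .inr h.le
    _ ≤ _ := measureReal_union_le _ _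
    _ ≤ _ := by rw [two_mul]; exact add_le_add h1 h2

/-- The noise average of some slot is large. -/
def Loud (d T : ℕ) (ρ : ℝ) : Set (ℕ → ℝ) :=
  {η | ∃ b < numBatches d T ρ, ∃ j < d, slotLen T b * (1 / 2) ^ b < |slotNoise d T η b j|}

theorem quietBatch_of_notMem {η : ℕ → ℝ} (h : η ∉ Loud d T ρ) (c : ℕ) (hc : c < numBatches d T ρ) :
    QuietBatch d T η c := by
  intro j hj
  by_contra hlt
  exact h ⟨c, hc, j, hj, not_le.1 hlt⟩

theorem measurable_slotNoise (b j : ℕ) : Measurable fun η => slotNoise d T η b j :=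
  Finset.measurable_sum _ fun _ _ => measurable_pi_apply _

theorem Loud_eq : Loud d T ρ = ⋃ b ∈ Finset.range (numBatches d T ρ), ⋃ j ∈ Finset.range d,
    {η | slotLen T b * (1 / 2) ^ b < |slotNoise d T η b j|} := by
  ext η
  simp [Loud]

theorem measurableSet_Loud : MeasurableSet (Loud d T ρ) := by
  rw [Loud_eq]
  refine Finset.measurableSet_biUnion _ fun b _ => Finset.measurableSet_biUnion _ fun j _ => ?_
  exact measurableSet_lt measurable_const (measurable_slotNoise b j).abs

theorem log_le_clog (hT : 2 ≤ T) : Real.log T ≤ Nat.clog 2 T := by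
  have h1 : (T : ℝ) ≤ 2 ^ Nat.clog 2 T := by exact_mod_cast Nat.le_pow_clog (by norm_num) T
  have h2 := Real.log_le_log (by positivity) h1
  rw [Real.log_pow] at h2
  have h3 : Real.log 2 ≤ 1 := by linarith [Real.log_two_lt_d9]
  exact h2.trans (by nlinarith [Nat.cast_nonneg (α := ℝ) (Nat.clog 2 T)])

theorem measureReal_Loud_le (hν : IsSubgaussianNoise ν) (hT : 2 ≤ T) :
    (noiseLaw ν).real (Loud d T ρ) ≤ 2 / T ^ 7 := by
  have hT0 : (0 : ℝ) < T := by positivity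
  have key : ∀ b j, (noiseLaw ν).real {η | slotLen T b * (1 / 2) ^ b < |slotNoise d T η b j|} ≤
      2 * (1 / T ^ 8) := by
    intro b j
    refine (measureReal_abs_sum_gt hν _ _ (by positivity)).trans ?_
    gcongr
    have hm : (0 : ℝ) < slotLen T b := by exact_mod_cast slotLen_pos hT b
    have he : -((slotLen T b : ℝ) * (1 / 2) ^ b) ^ 2 / (2 * slotLen T b) = -(8 * Nat.clog 2 T) := by
      have : ((slotLen T b : ℝ)) * ((1 / 2) ^ b) ^ 2 = 16 * Nat.clog 2 T := by
        rw [slotLen, ell]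
        push_cast
        rw [mul_assoc, ← pow_mul, mul_comm b 2, pow_mul, ← mul_pow]
        norm_num
      rw [mul_pow, div_eq_iff (by positivity)]
      calc _ = -((slotLen T b : ℝ) * (slotLen T b * ((1 / 2) ^ b) ^ 2)) := by ring
        _ = _ := by rw [this]; ring
    rw [he, Real.exp_neg, ← one_div]
    gcongr
    rw [← Real.log_le_log_iff (by positivity) (Real.exp_pos _), Real.log_exp, Real.log_pow]
    push_cast
    linarith [log_le_clog hT]
  have hB : (numBatches d T ρ * d : ℝ) ≤ T := by
    have h1 := le_batchStart (d := d) hT (numBatches d T ρ)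
    have h2 := batchStart_numBatches_le (d := d) (T := T) (ρ := ρ)
    exact_mod_cast (by rw [mul_comm]; omega : numBatches d T ρ * d ≤ T)
  rw [Loud_eq]
  calc _ ≤ ∑ b ∈ Finset.range (numBatches d T ρ), (noiseLaw ν).real (⋃ j ∈ Finset.range d,
        {η | slotLen T b * (1 / 2) ^ b < |slotNoise d T η b j|}) := measureReal_biUnion_finset_le _ _
    _ ≤ ∑ b ∈ Finset.range (numBatches d T ρ), ∑ j ∈ Finset.range d, 2 * (1 / (T : ℝ) ^ 8) :=
        Finset.sum_le_sum fun b _ => (measureReal_biUnion_finset_le _ _).trans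
          (Finset.sum_le_sum fun j _ => key b j)
    _ = (numBatches d T ρ * d : ℝ) * (2 * (1 / (T : ℝ) ^ 8)) := by simp; ring
    _ ≤ T * (2 * (1 / (T : ℝ) ^ 8)) := by gcongr
    _ = 2 / T ^ 7 := by field_simp

/-! ### The probability of hitting the grid -/

theorem volume_abs_sub_le (y w : ℝ) :
    (volume : Measure unitInterval).real {u | |(u : ℝ) - y| ≤ w} ≤ 2 * max w 0 := by
  have h : (volume : Measure unitInterval) {u | |(u : ℝ) - y| ≤ w} ≤ ENNReal.ofReal (2 * max w 0) := by
    rw [unitInterval.volume_apply]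
    calc _ ≤ volume (Set.Icc (y - w) (y + w)) := by
          refine measure_mono ?_
          rintro _ ⟨u, hu, rfl⟩
          have := abs_le.1 (show |(u : ℝ) - y| ≤ w from hu)
          constructor <;> linarith
      _ = ENNReal.ofReal (2 * w) := by rw [Real.volume_Icc]; congr 1; ring
      _ ≤ _ := ENNReal.ofReal_le_ofReal (by gcongr; exact le_max_left _ _)
  exact ENNReal.toReal_le_of_le_ofReal (by positivity) h

theorem measurableSet_onGrid (μ : ℝ) :
    MeasurableSet {u : unitInterval | ¬ OffGrid d T ρ b u μ} := by
  have : {u : unitInterval | ¬ OffGrid d T ρ b u μ} = ⋃ k : ℕ, {u : unitInterval |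
      |gridWidth d T ρ b * u - gridWidth d T ρ b - 2 + k * gridWidth d T ρ b - μ| ≤ (1 / 2) ^ b} := by
    ext u; simp [OffGrid]
  rw [this]
  refine MeasurableSet.iUnion fun k => measurableSet_le ?_ measurable_const
  fun_prop

theorem volume_onGrid_le (hd : 1 ≤ d) (hT : 2 ≤ T) (hρ : 0 < ρ) (hρ1 : ρ ≤ 1) (μ : ℝ) :
    (volume : Measure unitInterval).real {u | ¬ OffGrid d T ρ b u μ} ≤ 6 * (ρ / (ell T * d)) := by
  have hε : (0 : ℝ) < (1 / 2) ^ b := by positivity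
  have hl : (16 : ℝ) ≤ ell T := by exact_mod_cast ell_pos hT
  have hd' : (1 : ℝ) ≤ d := by exact_mod_cast hd
  set w := ρ / (ell T * d) with hw
  have hw0 : 0 ≤ w := by positivity
  have hw1 : w ≤ 1 / 2 := by
    rw [hw, div_le_iff₀ (by positivity)]
    nlinarith
  set W := gridWidth d T ρ b with hWdef
  have hW : 0 < W := by rw [hWdef, gridWidth]; positivity
  have hwW : (1 / 2 : ℝ) ^ b = w * W := by
    rw [hw, hWdef, gridWidth]; field_simp
  set c := 1 + (2 + μ) / W with hc
  have hsub : {u : unitInterval | ¬ OffGrid d T ρ b u μ} ⊆ ⋃ e ∈ ({-1, 0, 1} : Finset ℤ),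
      {u : unitInterval | |(u : ℝ) - (c - (⌊c⌋ + e : ℤ))| ≤ w} := by
    intro u hu
    simp only [OffGrid, not_forall, not_lt, Set.mem_ofPred_eq] at hu
    obtain ⟨k, hk⟩ := hu
    have e1 : W * u - W - 2 + k * W - μ = ((u : ℝ) - (c - k)) * W := by
      rw [hc]; field_simp; ring
    rw [← hWdef, e1, abs_mul, abs_of_pos hW, hwW] at hk
    have hk' := le_of_mul_le_mul_right hk hW
    have h1 := abs_le.1 hk'
    have hu0 := u.2.1
    have hu1 := u.2.2
    have hf1 := Int.floor_le c
    have hf2 := Int.lt_floor_add_one c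
    have h2 : (k : ℤ) < ⌊c⌋ + 2 := by
      have : (k : ℝ) < ⌊c⌋ + 2 := by linarith
      exact_mod_cast this
    have h3 : ⌊c⌋ - 2 < (k : ℤ) := by
      have : (⌊c⌋ : ℝ) - 2 < k := by linarith
      exact_mod_cast this
    simp only [Set.mem_iUnion, exists_prop]
    refine ⟨(k : ℤ) - ⌊c⌋, ?_, ?_⟩
    · simp only [Finset.mem_insert, Finset.mem_singleton]; omega
    · have : ((⌊c⌋ + ((k : ℤ) - ⌊c⌋) : ℤ) : ℝ) = k := by push_cast; ring
      rw [Set.mem_ofPred_eq, this]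
      exact hk'
  calc _ ≤ (volume : Measure unitInterval).real (⋃ e ∈ ({-1, 0, 1} : Finset ℤ),
      {u : unitInterval | |(u : ℝ) - (c - (⌊c⌋ + e : ℤ))| ≤ w}) := measureReal_mono hsub (measure_ne_top _ _)
    _ ≤ ∑ e ∈ ({-1, 0, 1} : Finset ℤ), (volume : Measure unitInterval).real
        {u : unitInterval | |(u : ℝ) - (c - (⌊c⌋ + e : ℤ))| ≤ w} := measureReal_biUnion_finset_le _ _
    _ ≤ ∑ e ∈ ({-1, 0, 1} : Finset ℤ), 2 * w := by
        refine Finset.sum_le_sum fun e _ => (volume_abs_sub_le _ _).trans_eq ?_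
        rw [max_eq_left hw0]
    _ = 6 * w := by simp; ring

/-- Coordinate `b` hits a set that depends only on the earlier coordinates. -/
theorem seedLaw_dependent_le {f : (ℕ → unitInterval) → ℕ} (hf : Measurable f)
    (hfb : ∀ ξ ξ', (∀ i < b, ξ i = ξ' i) → f ξ = f ξ') {S : ℕ → Set unitInterval}
    (hS : ∀ i, MeasurableSet (S i)) {p : ℝ} (hp : ∀ i, (volume : Measure unitInterval).real (S i) ≤ p) :
    MeasurableSet {ξ | ξ b ∈ S (f ξ)} ∧ seedLaw.real {ξ | ξ b ∈ S (f ξ)} ≤ p := by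
  have heq : {ξ : ℕ → unitInterval | ξ b ∈ S (f ξ)} =
      ⋃ i, ({ξ | f ξ = i} ∩ (fun ξ => ξ b) ⁻¹' S i) := by
    ext ξ; simp
  have hm : ∀ i, MeasurableSet {ξ | f ξ = i} := fun i => hf (measurableSet_singleton i)
  have hm' : ∀ i, MeasurableSet ((fun ξ : ℕ → unitInterval => ξ b) ⁻¹' S i) :=
    fun i => measurable_pi_apply b (hS i)
  have hmeas : MeasurableSet {ξ : ℕ → unitInterval | ξ b ∈ S (f ξ)} := by
    rw [heq]; exact MeasurableSet.iUnion fun i => (hm i).inter (hm' i)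
  refine ⟨hmeas, ?_⟩
  have hp0 : 0 ≤ p := measureReal_nonneg.trans (hp 0)
  have hind := iIndepFun.indepFun_finset (Finset.range b) {b} (by simp)
    (iIndepFun_infinitePi (P := fun _ : ℕ => (volume : Measure unitInterval)) (X := fun _ y => y)
      fun _ => measurable_id) (fun i => measurable_pi_apply i)
  let ext : (Finset.range b → unitInterval) → ℕ → unitInterval :=
    fun v i => if h : i ∈ Finset.range b then v ⟨i, h⟩ else 0
  have hext : Measurable ext := by
    refine measurable_pi_lambda _ fun i => ?_
    by_cases h : i ∈ Finset.range b
    · simp only [ext, h, dite_true]; exact measurable_pi_apply _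
    · simp only [ext, h, dite_false]; exact measurable_const
  have hfe : ∀ ξ, f ξ = f (ext fun i : Finset.range b => ξ i) := by
    intro ξ
    refine hfb _ _ fun i hi => ?_
    simp [ext, hi]
  have hmul : ∀ i, seedLaw ({ξ | f ξ = i} ∩ (fun ξ => ξ b) ⁻¹' S i) ≤
      seedLaw {ξ | f ξ = i} * ENNReal.ofReal p := by
    intro i
    have h1 := hind.measure_inter_preimage_eq_mul (s := {v | f (ext v) = i})
      (t := {v | v ⟨b, by simp⟩ ∈ S i}) ((hf.comp hext) (measurableSet_singleton i))
      (measurable_pi_apply (⟨b, by simp⟩ : ({b} : Finset ℕ)) (hS i))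
    have h2 : (fun (ξ : ℕ → unitInterval) (i : Finset.range b) => ξ i) ⁻¹' {v | f (ext v) = i} =
        {ξ | f ξ = i} := by
      ext ξ; simp [hfe ξ]
    have h3 : (fun (ξ : ℕ → unitInterval) (i : ({b} : Finset ℕ)) => ξ i) ⁻¹'
        {v | v ⟨b, by simp⟩ ∈ S i} = (fun ξ => ξ b) ⁻¹' S i := rfl
    rw [h2, h3] at h1
    rw [seedLaw, h1]
    gcongr
    have h4 := (measurePreserving_eval_infinitePi (fun _ : ℕ => (volume : Measure unitInterval))
      b).measure_preimage (hS i).nullMeasurableSet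
    refine h4.le.trans ?_
    exact (ENNReal.le_ofReal_iff_toReal_le (measure_ne_top _ _) hp0).2 (hp i)
  refine ENNReal.toReal_le_of_le_ofReal hp0 ?_
  have hsum : ∑' i, seedLaw {ξ | f ξ = i} = 1 := by
    rw [← measure_iUnion]
    · have : (⋃ i, {ξ | f ξ = i}) = Set.univ := by ext ξ; simp
      rw [this, measure_univ]
    · intro i j hij
      refine Set.disjoint_left.2 fun ξ h h' => hij ?_
      exact (show f ξ = i from h).symm.trans h'
    · exact hm
  rw [heq]
  calc _ ≤ ∑' i, seedLaw ({ξ | f ξ = i} ∩ (fun ξ => ξ b) ⁻¹' S i) := measure_iUnion_le _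
    _ ≤ ∑' i, seedLaw {ξ | f ξ = i} * ENNReal.ofReal p := ENNReal.tsum_le_tsum hmul
    _ = ENNReal.ofReal p := by rw [ENNReal.tsum_mul_right, hsum, one_mul]

/-- The seeds for which some mean of the noiseless run is close to the grid. -/
def OnGrid {d : ℕ} (T : ℕ) (ρ : ℝ) (n : ℕ) (x : ℕ → EuclideanSpace ℝ (Fin d))
    (θ : EuclideanSpace ℝ (Fin d)) : Set (ℕ → unitInterval) :=
  ⋃ b ∈ Finset.range (numBatches d T ρ), ⋃ j ∈ Finset.range d,
    {ξ | ξ b ∈ {u : unitInterval | ¬ OffGrid d T ρ b u (inner ℝ θ (x (idealArm ξ T ρ n x θ b j)))}}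

theorem offGrid_of_notMem {ξ : ℕ → unitInterval} (h : ξ ∉ OnGrid T ρ n x θ) (c : ℕ)
    (hc : c < numBatches d T ρ) (j : ℕ) (hj : j < d) :
    OffGrid d T ρ c (ξ c) (inner ℝ θ (x (idealArm ξ T ρ n x θ c j))) := by
  by_contra hn
  refine h ?_
  simp only [OnGrid, Set.mem_iUnion, Finset.mem_range, exists_prop]
  exact ⟨c, hc, j, hj, hn⟩

/-- There are at most `log T` batches. -/
theorem numBatches_le_clog (hd : 1 ≤ d) (hT : 2 ≤ T) : numBatches d T ρ ≤ Nat.clog 2 T := by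
  rcases Nat.eq_zero_or_pos (numBatches d T ρ) with h | h
  · omega
  obtain ⟨b, hb⟩ := Nat.exists_eq_add_of_le' h
  have h1 := slotLen_le hd (show b < numBatches d T ρ by omega)
  have h2 := Nat.le_pow_clog (b := 2) (by norm_num) T
  have h3 : 16 * 4 ^ b ≤ slotLen T b := Nat.mul_le_mul_right _ (ell_pos hT)
  have h4 : 2 ^ (b + 1) ≤ 2 ^ Nat.clog 2 T := by
    calc 2 ^ (b + 1) = 2 * 2 ^ b := by ring
      _ ≤ 16 * 4 ^ b := Nat.mul_le_mul (by norm_num) (Nat.pow_le_pow_left (by norm_num) b)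
      _ ≤ _ := by omega
  rw [hb]
  exact (Nat.pow_le_pow_iff_right (by norm_num)).1 h4

theorem seedLaw_OnGrid_le (hn : 1 ≤ n) (hρ : 0 < ρ) (hρ1 : ρ ≤ 1) (hx : ∀ a < n, ‖x a‖ ≤ 1)
    (hd : 1 ≤ d) (hT : 2 ≤ T) :
    MeasurableSet (OnGrid T ρ n x θ) ∧ seedLaw.real (OnGrid T ρ n x θ) ≤ ρ / 2 := by
  have key : ∀ b < numBatches d T ρ, ∀ j < d,
      MeasurableSet {ξ : ℕ → unitInterval |
        ξ b ∈ {u : unitInterval | ¬ OffGrid d T ρ b u (inner ℝ θ (x (idealArm ξ T ρ n x θ b j)))}} ∧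
      seedLaw.real {ξ : ℕ → unitInterval |
        ξ b ∈ {u : unitInterval | ¬ OffGrid d T ρ b u (inner ℝ θ (x (idealArm ξ T ρ n x θ b j)))}} ≤
        6 * (ρ / (ell T * d)) := by
    intro b hb j hj
    have hlt : batchStart d T b + j * slotLen T b < T := by
      have h1 := (of_lt_numBatches hb).2
      have h2 := slotLen_pos hT b
      have h3 := Nat.mul_le_mul_right (slotLen T b) (show j + 1 ≤ d from hj)
      rw [batchStart_succ] at h1
      rw [Nat.succ_mul] at h3
      omega
    refine seedLaw_dependent_le (f := fun ξ => idealArm ξ T ρ n x θ b j)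
      (S := fun i => {u : unitInterval | ¬ OffGrid d T ρ b u (inner ℝ θ (x i))}) ?_
      (fun ξ ξ' h => idealArm_congr h) (fun i => measurableSet_onGrid _)
      (fun i => volume_onGrid_le hd hT hρ hρ1 _)
    simp only [fun ξ => idealArm_eq_armAt (ξ := ξ) (θ := θ) hn hρ hx hT hb hj]
    exact measurable_armAt hn hρ hx hd hT hρ1 (fun i => measurable_pi_apply i)
      (fun t => measurable_const) hlt
  refine ⟨Finset.measurableSet_biUnion _ fun b hb => Finset.measurableSet_biUnion _ fun j hj =>
    (key b (Finset.mem_range.1 hb) j (Finset.mem_range.1 hj)).1, ?_⟩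
  have hc : (0 : ℝ) < Nat.clog 2 T := by exact_mod_cast clog_pos hT
  have hd' : (0 : ℝ) < d := by exact_mod_cast hd
  calc _ ≤ ∑ b ∈ Finset.range (numBatches d T ρ), ∑ j ∈ Finset.range d, 6 * (ρ / (ell T * d)) :=
        (measureReal_biUnion_finset_le _ _).trans (Finset.sum_le_sum fun b hb =>
          (measureReal_biUnion_finset_le _ _).trans (Finset.sum_le_sum fun j hj =>
            (key b (Finset.mem_range.1 hb) j (Finset.mem_range.1 hj)).2))
    _ = numBatches d T ρ * (d * (6 * (ρ / (ell T * d)))) := by simp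
    _ ≤ Nat.clog 2 T * (d * (6 * (ρ / (ell T * d)))) := by
        gcongr; exact numBatches_le_clog hd hT
    _ = 6 / 16 * ρ := by rw [ell]; push_cast; field_simp
    _ ≤ ρ / 2 := by linarith

end LinearBandit

namespace LinearBandit
open RealRAM

/-! ### Existence of nets -/

section Net

variable {d T : ℕ}

theorem card_le_of_separated (hT : 1 ≤ T) (s : Finset (EuclideanSpace ℝ (Fin d)))
    (hs : ∀ c ∈ s, ‖c‖ ≤ 1) (h : ∀ c ∈ s, ∀ e ∈ s, c ≠ e → 1 / (T : ℝ) < ‖c - e‖) :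
    s.card ≤ (3 * T) ^ d := by
  have hT0 : (1 : ℝ) ≤ T := by exact_mod_cast hT
  set δ : ℝ := 1 / (2 * T) with hδ
  have hδ0 : 0 < δ := by positivity
  have hdisj : Set.Pairwise (s : Set (EuclideanSpace ℝ (Fin d)))
      (Function.onFun Disjoint fun c => Metric.ball c δ) := by
    intro c hc e he hce
    apply Metric.ball_disjoint_ball
    rw [dist_eq_norm]
    refine le_of_eq_of_le ?_ (h c hc e he hce).le
    rw [hδ]
    field_simp
    norm_num
  have hsub : ⋃ c ∈ s, Metric.ball c δ ⊆ Metric.ball 0 (1 + δ) :=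
    Set.iUnion₂_subset fun c hc => Metric.ball_subset_ball' (by
      rw [dist_zero_right]
      linarith [hs c hc])
  have hle : ENNReal.ofReal (s.card * δ ^ d) * volume (Metric.ball (0 : EuclideanSpace ℝ (Fin d)) 1) ≤
      ENNReal.ofReal ((1 + δ) ^ d) * volume (Metric.ball (0 : EuclideanSpace ℝ (Fin d)) 1) := by
    have h1 := measure_mono (μ := volume) hsub
    rw [measure_biUnion_finset hdisj fun c _ => measurableSet_ball] at h1
    simp only [Measure.addHaar_ball_of_pos _ _ hδ0, finrank_euclideanSpace_fin,
      Measure.addHaar_ball_of_pos _ _ (show 0 < 1 + δ by positivity), Finset.sum_const,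
      nsmul_eq_mul] at h1
    rwa [ENNReal.ofReal_mul (by positivity), ENNReal.ofReal_natCast, mul_assoc]
  rw [ENNReal.mul_le_mul_iff_left (Metric.measure_ball_pos _ _ zero_lt_one).ne'
    measure_ball_lt_top.ne, ENNReal.ofReal_le_ofReal_iff (by positivity)] at hle
  have h3 : (s.card : ℝ) ≤ (3 * T) ^ d := by
    refine le_of_mul_le_mul_right (hle.trans ?_) (pow_pos hδ0 d)
    rw [← mul_pow]
    refine pow_le_pow_left₀ (by positivity) ?_ d
    rw [hδ]
    field_simp
    linarith
  exact_mod_cast h3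

theorem exists_isNet (hT : 1 ≤ T) {A : Set (EuclideanSpace ℝ (Fin d))} (hA : ∀ a ∈ A, ‖a‖ ≤ 1) :
    ∃ (n : ℕ) (x : ℕ → EuclideanSpace ℝ (Fin d)), IsNet A T n x := by
  classical
  let Sep : Finset (EuclideanSpace ℝ (Fin d)) → Prop := fun s =>
    (∀ c ∈ s, c ∈ A) ∧ ∀ c ∈ s, ∀ e ∈ s, c ≠ e → 1 / (T : ℝ) < ‖c - e‖
  have hcard : ∀ s, Sep s → s.card ≤ (3 * T) ^ d := fun s hs =>
    card_le_of_separated hT s (fun c hc => hA c (hs.1 c hc)) hs.2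
  obtain ⟨s, hs, hmax⟩ : sSup {m | ∃ s, Sep s ∧ s.card = m} ∈ {m | ∃ s, Sep s ∧ s.card = m} := by
    refine Nat.sSup_mem ⟨0, ∅, ⟨by simp, by simp⟩, rfl⟩ ⟨(3 * T) ^ d, ?_⟩
    rintro _ ⟨s, hs, rfl⟩
    exact hcard s hs
  have hcover : ∀ a ∈ A, ∃ c ∈ s, ‖a - c‖ ≤ 1 / (T : ℝ) := by
    intro a ha
    by_contra! hfar
    have has : a ∉ s := fun h => by
      have := hfar a h
      rw [sub_self, norm_zero] at this
      exact absurd this (not_lt.2 (by positivity))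
    have hins : Sep (insert a s) := by
      refine ⟨fun c hc => ?_, fun c hc e he hce => ?_⟩
      · rcases Finset.mem_insert.1 hc with rfl | hc
        exacts [ha, hs.1 c hc]
      · rcases Finset.mem_insert.1 hc with rfl | hc' <;> rcases Finset.mem_insert.1 he with rfl | he'
        · exact absurd rfl hce
        · exact hfar e he'
        · rw [norm_sub_rev]
          exact hfar c hc'
        · exact hs.2 c hc' e he' hce
    have hle := le_csSup (s := {m | ∃ s, Sep s ∧ s.card = m})
      ⟨(3 * T) ^ d, by rintro _ ⟨s, hs, rfl⟩; exact hcard s hs⟩ ⟨insert a s, hins, rfl⟩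
    rw [Finset.card_insert_of_notMem has, ← hmax] at hle
    omega
  refine ⟨s.card, fun i => s.toList.getD i 0, ⟨fun i hi => ?_, fun a ha => ?_, hcard s hs⟩⟩
  · have hi' : i < s.toList.length := by simpa using hi
    rw [List.getD_eq_getElem _ _ hi']
    exact hs.1 _ (Finset.mem_toList.1 (List.getElem_mem hi'))
  · obtain ⟨c, hc, hac⟩ := hcover a ha
    obtain ⟨i, hi, rfl⟩ := List.getElem_of_mem (Finset.mem_toList.2 hc)
    refine ⟨i, by simpa using hi, ?_⟩
    rwa [List.getD_eq_getElem _ _ hi]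

end Net

/-! ### Polynomial running time -/

/-- `f` grows at most polynomially. -/
def PolyBounded (f : ℕ → ℕ) : Prop := ∃ K k, ∀ y, 1 ≤ y → f y ≤ K * y ^ k

theorem PolyBounded.const (c : ℕ) : PolyBounded fun _ => c := ⟨c, 0, fun y _ => by simp⟩

theorem PolyBounded.id : PolyBounded fun y => y := ⟨1, 1, fun y _ => by simp⟩

theorem PolyBounded.add {f g : ℕ → ℕ} (hf : PolyBounded f) (hg : PolyBounded g) :
    PolyBounded fun y => f y + g y := by
  obtain ⟨K, k, h⟩ := hf
  obtain ⟨L, l, h'⟩ := hg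
  refine ⟨K + L, k + l, fun y hy => ?_⟩
  rw [add_mul]
  exact add_le_add ((h y hy).trans (Nat.mul_le_mul_left _ (Nat.pow_le_pow_right hy (by omega))))
    ((h' y hy).trans (Nat.mul_le_mul_left _ (Nat.pow_le_pow_right hy (by omega))))

theorem PolyBounded.mul {f g : ℕ → ℕ} (hf : PolyBounded f) (hg : PolyBounded g) :
    PolyBounded fun y => f y * g y := by
  obtain ⟨K, k, h⟩ := hf
  obtain ⟨L, l, h'⟩ := hg
  refine ⟨K * L, k + l, fun y hy => ?_⟩
  rw [pow_add, mul_mul_mul_comm]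
  exact Nat.mul_le_mul (h y hy) (h' y hy)

theorem polyBounded_programTime : PolyBounded fun y => programTime y y y := by
  unfold programTime batchTime spanTime elimTime
  repeat' first
    | exact PolyBounded.const _
    | exact PolyBounded.id
    | apply PolyBounded.add
    | apply PolyBounded.mul

theorem programTime_le {d T n y : ℕ} (hd : d ≤ y) (hT : T ≤ y) (hn : n ≤ y) :
    programTime d T n ≤ programTime y y y := by
  unfold programTime batchTime spanTime elimTime
  gcongr

/-- The running time of the program is polynomial in `T ^ d`. -/
theorem exists_programTime_le : ∃ K k : ℕ, ∀ (d T n : ℕ) (ρ : ℝ), 1 ≤ d → 2 ≤ T → 0 < ρ → ρ ≤ 1 →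
    n ≤ (3 * T) ^ d → (programTime d T n : ℝ) ≤ K * ((T : ℝ) ^ d) ^ k * (1 / ρ) ^ k := by
  obtain ⟨K, k, h⟩ := polyBounded_programTime
  refine ⟨K, 3 * k, fun d T n ρ hd hT hρ hρ1 hn => ?_⟩
  have hX : 1 ≤ T ^ d := Nat.one_le_pow _ _ (by omega)
  have hX3 : T ^ d ≤ (T ^ d) ^ 3 := Nat.le_self_pow (by norm_num) _
  have hdX : d ≤ T ^ d := (Nat.lt_pow_self (by omega)).le
  have hTX : T ≤ T ^ d := Nat.le_self_pow (by omega) _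
  have hnX : n ≤ (T ^ d) ^ 3 := by
    refine hn.trans ?_
    rw [← pow_mul, mul_comm d 3, pow_mul]
    exact Nat.pow_le_pow_left (by nlinarith [Nat.mul_le_mul hT hT]) d
  have h1 := (programTime_le (hdX.trans hX3) (hTX.trans hX3) hnX).trans
    (h _ (Nat.one_le_pow _ _ hX))
  rw [← pow_mul] at h1
  have h2 : (1 : ℝ) ≤ (1 / ρ) ^ (3 * k) := one_le_pow₀ (by rw [le_div_iff₀ hρ]; linarith)
  calc (programTime d T n : ℝ) ≤ K * ((T : ℝ) ^ d) ^ (3 * k) := by exact_mod_cast h1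
    _ ≤ _ := le_mul_of_one_le_right (by positivity) h2

end LinearBandit

namespace LinearBandit
open RealRAM

variable {ν : ℕ → ProbabilityMeasure ℝ} {d T n b : ℕ} {ρ : ℝ}
  {x : ℕ → EuclideanSpace ℝ (Fin d)} {θ : EuclideanSpace ℝ (Fin d)}
  {ξ : ℕ → unitInterval} {η : ℕ → ℝ}

theorem play_eq (hn : 1 ≤ n) (hρ : 0 < ρ) (hρ1 : ρ ≤ 1) (hx : ∀ a < n, ‖x a‖ ≤ 1) (hd : 1 ≤ d)
    (hT : 2 ≤ T) {t : ℕ} (ht : t < T) :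
    play phasedElimination T ρ n x θ ξ η t = x (armAt ξ (reward θ x η) T ρ n x t) :=
  congrArg x ((run_phasedElimination (ξ := ξ) (r := reward θ x η) hn hρ hx hd hT hρ1).final.2 t ht)

theorem runsWithin_phasedElimination (hn : 1 ≤ n) (hρ : 0 < ρ) (hρ1 : ρ ≤ 1)
    (hx : ∀ a < n, ‖x a‖ ≤ 1) (hd : 1 ≤ d) (hT : 2 ≤ T) :
    RunsWithin phasedElimination T ρ n x (programTime d T n) := by
  intro ξ r
  have h := run_phasedElimination (ξ := ξ) (r := r) hn hρ hx hd hT hρ1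
  refine ⟨⟨_, h.haltsWithin⟩, ?_, h.final.1, fun t ht => ?_⟩
  · exact_mod_cast (final_eq_of_haltsWithin h.haltsWithin).1
  · exact (h.final.2 t ht).trans_lt (armAt_lt hn hρ hx t)

theorem measurable_play (hn : 1 ≤ n) (hρ : 0 < ρ) (hρ1 : ρ ≤ 1) (hx : ∀ a < n, ‖x a‖ ≤ 1)
    (hd : 1 ≤ d) (hT : 2 ≤ T) {Ω : Type*} [MeasurableSpace Ω] {ξ : Ω → ℕ → unitInterval}
    {η : Ω → ℕ → ℝ} (hξ : Measurable ξ) (hη : Measurable η) {t : ℕ} (ht : t < T) :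
    Measurable fun ω => play phasedElimination T ρ n x θ (ξ ω) (η ω) t := by
  simp only [play_eq hn hρ hρ1 hx hd hT ht]
  exact (measurable_of_countable x).comp (measurable_armAt hn hρ hx hd hT hρ1
    (fun i => (measurable_pi_apply i).comp hξ) (fun t => (measurable_pi_apply t).comp hη) ht)

theorem play_eq_play (hn : 1 ≤ n) (hρ : 0 < ρ) (hρ1 : ρ ≤ 1) (hx : ∀ a < n, ‖x a‖ ≤ 1)
    (hd : 1 ≤ d) (hT : 2 ≤ T) (hξ : ξ ∉ OnGrid T ρ n x θ) {η' : ℕ → ℝ} (hη : η ∉ Loud d T ρ)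
    (hη' : η' ∉ Loud d T ρ) {t : ℕ} (ht : t < T) :
    play phasedElimination T ρ n x θ ξ η t = play phasedElimination T ρ n x θ ξ η' t := by
  rw [play_eq hn hρ hρ1 hx hd hT ht, play_eq hn hρ hρ1 hx hd hT ht,
    armAt_eq_ideal hn hρ hx hT (quietBatch_of_notMem hη) (offGrid_of_notMem hξ),
    armAt_eq_ideal hn hρ hx hT (quietBatch_of_notMem hη') (offGrid_of_notMem hξ)]

theorem Loud_eq_empty (h : numBatches d T ρ = 0) : Loud d T ρ = ∅ := by
  rw [Loud_eq, h]
  simp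

theorem measureReal_Loud_le_quarter (hν : IsSubgaussianNoise ν) (hρ : 0 < ρ) (hT : 2 ≤ T) :
    (noiseLaw ν).real (Loud d T ρ) ≤ ρ / 4 := by
  rcases Nat.eq_zero_or_pos (numBatches d T ρ) with h | h
  · rw [Loud_eq_empty h, measureReal_empty]
    positivity
  · have hρT := (of_lt_numBatches h).1
    have hT' : (2 : ℝ) ≤ T := by exact_mod_cast hT
    refine (measureReal_Loud_le hν hT).trans ?_
    have h6 : (2 : ℝ) ^ 6 ≤ (T : ℝ) ^ 6 := by gcongr
    rw [div_le_iff₀ (by positivity)]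
    calc (2 : ℝ) ≤ 1 / 4 * 2 ^ 6 := by norm_num
      _ ≤ (ρ * T) / 4 * T ^ 6 := by gcongr
      _ = ρ / 4 * T ^ 7 := by ring

theorem isReproducible_phasedElimination (hn : 1 ≤ n) (hρ : 0 < ρ) (hρ1 : ρ ≤ 1)
    (hx : ∀ a < n, ‖x a‖ ≤ 1) (hd : 1 ≤ d) (hT : 2 ≤ T) :
    IsReproducible phasedElimination T ρ n x := by
  intro θ hθ ν hν
  set S := {ω : (ℕ → unitInterval) × (ℕ → ℝ) × (ℕ → ℝ) | ∀ t < T,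
    play phasedElimination T ρ n x θ ω.1 ω.2.1 t = play phasedElimination T ρ n x θ ω.1 ω.2.2 t}
    with hS
  have hmeas : MeasurableSet S := by
    have : S = ⋂ t ∈ Finset.range T, {ω : (ℕ → unitInterval) × (ℕ → ℝ) × (ℕ → ℝ) |
        play phasedElimination T ρ n x θ ω.1 ω.2.1 t =
          play phasedElimination T ρ n x θ ω.1 ω.2.2 t} := by
      ext ω
      simp [hS]
    rw [this]
    refine Finset.measurableSet_biInter _ fun t ht => ?_
    exact measurableSet_eq_fun
      (measurable_play hn hρ hρ1 hx hd hT measurable_fst (measurable_fst.comp measurable_snd)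
        (Finset.mem_range.1 ht))
      (measurable_play hn hρ hρ1 hx hd hT measurable_fst (measurable_snd.comp measurable_snd)
        (Finset.mem_range.1 ht))
  refine ⟨hmeas, ?_⟩
  set μ := seedLaw.prod ((noiseLaw ν).prod (noiseLaw ν)) with hμ
  have hsub : Sᶜ ⊆ OnGrid T ρ n x θ ×ˢ Set.univ ∪
      (Set.univ ×ˢ (Loud d T ρ ×ˢ Set.univ) ∪ Set.univ ×ˢ (Set.univ ×ˢ Loud d T ρ)) := by
    intro ω hω
    by_contra hgood
    simp only [Set.mem_union, Set.mem_prod, Set.mem_univ, and_true, true_and, not_or] at hgood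
    exact hω fun t ht => play_eq_play hn hρ hρ1 hx hd hT hgood.1 hgood.2.1 hgood.2.2 ht
  have h1 : μ.real (OnGrid T ρ n x θ ×ˢ Set.univ) ≤ ρ / 2 := by
    rw [hμ, measureReal_prod_prod, probReal_univ, mul_one]
    exact (seedLaw_OnGrid_le hn hρ hρ1 hx hd hT).2
  have h2 : μ.real (Set.univ ×ˢ (Loud d T ρ ×ˢ Set.univ)) ≤ ρ / 4 := by
    rw [hμ, measureReal_prod_prod, measureReal_prod_prod, probReal_univ, probReal_univ, mul_one,
      one_mul]
    exact measureReal_Loud_le_quarter hν hρ hT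
  have h3 : μ.real (Set.univ ×ˢ (Set.univ ×ˢ Loud d T ρ)) ≤ ρ / 4 := by
    rw [hμ, measureReal_prod_prod, measureReal_prod_prod, probReal_univ, probReal_univ, one_mul,
      one_mul]
    exact measureReal_Loud_le_quarter hν hρ hT
  have h4 : μ.real Sᶜ ≤ ρ := by
    refine (measureReal_mono hsub).trans ((measureReal_union_le _ _).trans ?_)
    linarith [measureReal_union_le (μ := μ) (Set.univ ×ˢ (Loud d T ρ ×ˢ Set.univ))
      (Set.univ ×ˢ (Set.univ ×ˢ Loud d T ρ))]
  rw [probReal_compl_eq_one_sub hmeas] at h4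
  linarith

/-! ### Regret -/

theorem sum_gapBound (hρ : 0 < ρ) (B : ℕ) :
    ∑ b ∈ Finset.range B, d * slotLen T b * gapBound d T ρ b ≤
      32 * d ^ 3 * (ell T : ℝ) ^ 2 / ρ * 2 ^ B := by
  have h : ∀ b, (d * slotLen T b * gapBound d T ρ b : ℝ) = 32 * d ^ 3 * (ell T : ℝ) ^ 2 / ρ * 2 ^ b := by
    intro b
    have h4 : (4 : ℝ) ^ b * (1 / 2) ^ b = 2 ^ b := by rw [← mul_pow]; norm_num
    rw [← h4, gapBound, gridWidth, slotLen]
    push_cast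
    ring
  simp only [h]
  rw [← Finset.mul_sum]
  gcongr
  rw [geom_sum_eq (by norm_num)]
  norm_num

/-- Splitting a horizon of `T` rounds into batches. -/
theorem sum_le_of_batches {f : ℕ → ℝ} {g : ℕ → ℝ} (hg : ∀ b, 0 ≤ g b) {B : ℕ}
    (hB : batchStart d T B ≤ T) (hB' : T ≤ batchStart d T (B + 1))
    (hf : ∀ b ≤ B, ∀ t, batchStart d T b ≤ t → t < batchStart d T (b + 1) → t < T → f t ≤ g b) :
    ∑ t ∈ Finset.range T, f t ≤ ∑ b ∈ Finset.range (B + 1), d * slotLen T b * g b := by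
  have key : ∀ c ≤ B, ∑ t ∈ Finset.range (batchStart d T c), f t ≤
      ∑ b ∈ Finset.range c, d * slotLen T b * g b := by
    intro c
    induction c with
    | zero => simp [batchStart]
    | succ c ih =>
      intro hc
      have hlen : batchStart d T (c + 1) ≤ T := (batchStart_mono d T hc).trans hB
      rw [batchStart_succ, Finset.sum_range_add, Finset.sum_range_succ]
      refine add_le_add (ih (by omega)) ?_
      calc _ ≤ ∑ _i ∈ Finset.range (d * slotLen T c), g c := Finset.sum_le_sum fun i hi => by
            rw [Finset.mem_range] at hi
            rw [batchStart_succ] at hlen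
            exact hf c (by omega) _ (by omega) (by rw [batchStart_succ]; omega) (by omega)
        _ = _ := by simp
  obtain ⟨m, hm⟩ := Nat.exists_eq_add_of_le hB
  have hmle : m ≤ d * slotLen T B := by rw [batchStart_succ] at hB'; omega
  rw [show Finset.range T = Finset.range (batchStart d T B + m) from by rw [← hm],
    Finset.sum_range_add, Finset.sum_range_succ]
  refine add_le_add (key B le_rfl) ?_
  calc _ ≤ ∑ _i ∈ Finset.range m, g B := Finset.sum_le_sum fun i hi => by
        rw [Finset.mem_range] at hi
        exact hf B le_rfl _ (by omega) (by omega) (by omega)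
    _ = m * g B := by simp
    _ ≤ _ := by
        gcongr
        · exact hg B
        · exact_mod_cast hmle

theorem two_pow_numBatches_le (hd : 1 ≤ d) (hT : 2 ≤ T) :
    2 ^ numBatches d T ρ * √(ell T : ℝ) ≤ 4 * √(T : ℝ) := by
  have h : 4 ^ numBatches d T ρ * ell T ≤ 16 * T := by
    rcases Nat.eq_zero_or_pos (numBatches d T ρ) with h | h
    · rw [h, pow_zero, one_mul, ell]
      exact Nat.mul_le_mul_left _ (clog_le T)
    · have := slotLen_le hd (show numBatches d T ρ - 1 < numBatches d T ρ by omega)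
      obtain ⟨c, hc⟩ := Nat.exists_eq_add_of_le' h
      rw [hc] at this ⊢
      rw [slotLen, Nat.add_sub_cancel] at this
      rw [pow_succ]
      nlinarith
  have h' : ((2 : ℝ) ^ numBatches d T ρ) ^ 2 * ell T ≤ 4 ^ 2 * T := by
    rw [← pow_mul, mul_comm _ 2, pow_mul]
    norm_num
    exact_mod_cast h
  have := Real.sqrt_le_sqrt h'
  rwa [Real.sqrt_mul (by positivity), Real.sqrt_mul (by positivity), Real.sqrt_sq (by positivity),
    Real.sqrt_sq (by positivity)] at this

theorem ell_le (hT : 2 ≤ T) : (ell T : ℝ) ≤ 48 * Real.log T := by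
  have hT' : (2 : ℝ) ≤ T := by exact_mod_cast hT
  have h1 : 2 ^ (Nat.clog 2 T - 1) < T := Nat.pow_pred_clog_lt_self (by norm_num) hT
  obtain ⟨c, hc⟩ := Nat.exists_eq_add_of_le' (clog_pos hT)
  rw [hc, Nat.add_sub_cancel] at h1
  have h2 : c * Real.log 2 ≤ Real.log T := by
    rw [← Real.log_pow]
    exact Real.log_le_log (by positivity) (by exact_mod_cast h1.le)
  have h3 : Real.log 2 ≤ Real.log T := Real.log_le_log (by norm_num) hT'
  rw [ell, hc]
  push_cast
  nlinarith [Real.log_two_gt_d9, Nat.cast_nonneg (α := ℝ) c]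

/-- The pseudo-regret against the best net point when the noise is quiet. -/
theorem sum_gap_le (hn : 1 ≤ n) (hρ : 0 < ρ) (hρ1 : ρ ≤ 1) (hx : ∀ a < n, ‖x a‖ ≤ 1)
    (hd : 1 ≤ d) (hT : 2 ≤ T) (hθ : ‖θ‖ ≤ 1) {a₀ : ℕ} (ha₀ : a₀ < n)
    (hbest : ∀ a < n, inner ℝ θ (x a) ≤ inner ℝ θ (x a₀)) (hρT : 1 ≤ ρ * T)
    (hη : η ∉ Loud d T ρ) :
    ∑ t ∈ Finset.range T,
        (inner ℝ θ (x a₀) - inner ℝ θ (play phasedElimination T ρ n x θ ξ η t)) ≤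
      256 * d ^ 3 / ρ * (ell T * √(ell T : ℝ)) * √(T : ℝ) := by
  have hB' : T ≤ batchStart d T (numBatches d T ρ + 1) := by
    by_contra! h
    exact numBatches_spec (ρ := ρ) hd hT ⟨hρT, h.le⟩
  refine (sum_le_of_batches (g := gapBound d T ρ) (fun b => by unfold gapBound gridWidth; positivity)
    batchStart_numBatches_le hB' fun b hb t h1 h2 ht => ?_).trans
      ((sum_gapBound hρ _).trans ?_)
  · rw [play_eq hn hρ hρ1 hx hd hT ht]
    exact gap_armAt_le hn hρ hρ1 hx hd hT hθ ha₀ hbest (quietBatch_of_notMem hη) hb h1 fun _ => h2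
  · have hs : (ell T : ℝ) ^ 2 = ell T * √(ell T : ℝ) * √(ell T : ℝ) := by
      rw [mul_assoc, Real.mul_self_sqrt (by positivity), sq]
    calc 32 * d ^ 3 * (ell T : ℝ) ^ 2 / ρ * 2 ^ (numBatches d T ρ + 1)
        = 64 * d ^ 3 / ρ * (ell T * √(ell T : ℝ)) *
            (2 ^ numBatches d T ρ * √(ell T : ℝ)) := by
          rw [pow_succ, hs]
          ring
      _ ≤ 64 * d ^ 3 / ρ * (ell T * √(ell T : ℝ)) * (4 * √(T : ℝ)) :=
          mul_le_mul_of_nonneg_left (two_pow_numBatches_le hd hT) (by positivity)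
      _ = _ := by ring

end LinearBandit

namespace LinearBandit
open RealRAM

variable {ν : ℕ → ProbabilityMeasure ℝ} {d T n b : ℕ} {ρ : ℝ}
  {x : ℕ → EuclideanSpace ℝ (Fin d)} {θ : EuclideanSpace ℝ (Fin d)}
  {ξ : ℕ → unitInterval} {η : ℕ → ℝ}

theorem norm_play_le (hn : 1 ≤ n) (hρ : 0 < ρ) (hρ1 : ρ ≤ 1) (hx : ∀ a < n, ‖x a‖ ≤ 1)
    (hd : 1 ≤ d) (hT : 2 ≤ T) {t : ℕ} (ht : t < T) :
    ‖play phasedElimination T ρ n x θ ξ η t‖ ≤ 1 := by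
  rw [play_eq hn hρ hρ1 hx hd hT ht]
  exact hx _ (armAt_lt hn hρ hx t)

theorem integrable_meanReward (hn : 1 ≤ n) (hρ : 0 < ρ) (hρ1 : ρ ≤ 1) (hx : ∀ a < n, ‖x a‖ ≤ 1)
    (hd : 1 ≤ d) (hT : 2 ≤ T) (hθ : ‖θ‖ ≤ 1) :
    Integrable (meanReward phasedElimination T ρ n x θ) (seedLaw.prod (noiseLaw ν)) := by
  refine integrable_finsetSum _ fun t ht => ?_
  rw [Finset.mem_range] at ht
  refine Integrable.of_bound (C := 1) ?_ (.of_forall fun ω => ?_)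
  · exact (measurable_const.inner
      (measurable_play hn hρ hρ1 hx hd hT measurable_fst measurable_snd ht)).aestronglyMeasurable
  · exact abs_inner_le hθ (norm_play_le hn hρ hρ1 hx hd hT ht)

/-- `meanReward` is `T` times the best value, up to a constant and to the loss on loud noise. -/
theorem le_integral_meanReward (hν : IsSubgaussianNoise ν) (hn : 1 ≤ n) (hρ : 0 < ρ) (hρ1 : ρ ≤ 1)
    (hx : ∀ a < n, ‖x a‖ ≤ 1) (hd : 1 ≤ d) (hT : 2 ≤ T) (hθ : ‖θ‖ ≤ 1) {v M : ℝ} (hv : v ≤ 1)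
    (hM : 0 ≤ M) (h : ∀ ξ, ∀ η ∉ Loud d T ρ, T * v - M ≤
      meanReward phasedElimination T ρ n x θ (ξ, η)) :
    T * v - (M + 1) ≤ ∫ ω, meanReward phasedElimination T ρ n x θ ω ∂(seedLaw.prod (noiseLaw ν)) := by
  have hT' : (2 : ℝ) ≤ T := by exact_mod_cast hT
  have hL : MeasurableSet (Set.univ ×ˢ Loud d T ρ : Set ((ℕ → unitInterval) × (ℕ → ℝ))) :=
    MeasurableSet.univ.prod measurableSet_Loud
  have hp : (seedLaw.prod (noiseLaw ν)).real (Set.univ ×ˢ Loud d T ρ) ≤ 2 / T ^ 7 := by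
    rw [measureReal_prod_prod, probReal_univ, one_mul]
    exact measureReal_Loud_le hν hT
  have hle : ∀ ω, T * v - M - (Set.univ ×ˢ Loud d T ρ).indicator (fun _ => 2 * (T : ℝ)) ω ≤
      meanReward phasedElimination T ρ n x θ ω := by
    rintro ⟨ξ, η⟩
    by_cases hη : η ∈ Loud d T ρ
    · rw [Set.indicator_of_mem (by simpa using hη)]
      have : -(T : ℝ) ≤ meanReward phasedElimination T ρ n x θ (ξ, η) := by
        calc -(T : ℝ) = ∑ _t ∈ Finset.range T, (-1 : ℝ) := by simp
          _ ≤ _ := Finset.sum_le_sum fun t ht => (abs_le.1 (abs_inner_le hθ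
              (norm_play_le hn hρ hρ1 hx hd hT (Finset.mem_range.1 ht)))).1
      nlinarith
    · rw [Set.indicator_of_notMem (by simpa using hη), sub_zero]
      exact h ξ η hη
  have hi : Integrable ((Set.univ ×ˢ Loud d T ρ).indicator fun _ => 2 * (T : ℝ))
      (seedLaw.prod (noiseLaw ν)) := (integrable_const _).indicator hL
  have hint := integral_mono (f := fun ω => T * v - M -
    (Set.univ ×ˢ Loud d T ρ).indicator (fun _ => 2 * (T : ℝ)) ω)
    ((integrable_const _).sub hi) (integrable_meanReward (ν := ν) hn hρ hρ1 hx hd hT hθ) hle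
  rw [integral_sub (integrable_const _) hi, integral_indicator_const _ hL, integral_const,
    probReal_univ, one_smul, smul_eq_mul] at hint
  have h1 : 2 / (T : ℝ) ^ 7 * (2 * T) ≤ 1 := by
    have h6 : (2 : ℝ) ^ 6 ≤ (T : ℝ) ^ 6 := by gcongr
    rw [div_mul_eq_mul_div, div_le_one (by positivity), pow_succ _ 6, ← mul_assoc]
    gcongr
    linarith
  have h2 := mul_le_mul_of_nonneg_right hp (show (0 : ℝ) ≤ 2 * T by positivity)
  linarith

theorem iSup_inner_le {A : Set (EuclideanSpace ℝ (Fin d))} (hA : A.Nonempty) (hnet : IsNet A T n x)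
    (hθ : ‖θ‖ ≤ 1) (hT : 2 ≤ T) {v : ℝ} (hv : ∀ a < n, inner ℝ θ (x a) ≤ v) :
    T * (⨆ a : A, inner ℝ θ (a : EuclideanSpace ℝ (Fin d))) ≤ T * v + 1 := by
  have hT0 : (0 : ℝ) < T := by positivity
  have := hA.to_subtype
  have h : (⨆ a : A, inner ℝ θ (a : EuclideanSpace ℝ (Fin d))) ≤ v + 1 / T := by
    refine ciSup_le fun ⟨a, ha⟩ => ?_
    obtain ⟨i, hi, hai⟩ := hnet.cover a ha
    have h1 : inner ℝ θ a = inner ℝ θ (x i) + inner ℝ θ (a - x i) := by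
      rw [← inner_add_right, add_sub_cancel]
    have h2 := real_inner_le_norm θ (a - x i)
    have h3 : ‖θ‖ * ‖a - x i‖ ≤ ‖a - x i‖ := mul_le_of_le_one_left (norm_nonneg _) hθ
    rw [h1]
    linarith [hv i hi]
  calc _ ≤ (T : ℝ) * (v + 1 / T) := by gcongr
    _ = _ := by field_simp

theorem one_le_sqrt_mul_log (hT : 2 ≤ T) : 1 ≤ 4 * (√(T : ℝ) * Real.log T ^ (3 / 2 : ℝ)) := by
  have hT' : (2 : ℝ) ≤ T := by exact_mod_cast hT
  have h1 : 1 ≤ √(T : ℝ) := Real.one_le_sqrt.2 (by linarith)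
  have h2 : (1 / 2 : ℝ) ≤ Real.log T :=
    (by linarith [Real.log_two_gt_d9] : (1 / 2 : ℝ) ≤ Real.log 2).trans
      (Real.log_le_log (by norm_num) hT')
  have h3 : (1 / 4 : ℝ) ≤ Real.log T ^ (3 / 2 : ℝ) := by
    calc (1 / 4 : ℝ) = (1 / 2) ^ (2 : ℝ) := by norm_num
      _ ≤ (1 / 2) ^ (3 / 2 : ℝ) :=
        Real.rpow_le_rpow_of_exponent_ge (by norm_num) (by norm_num) (by norm_num)
      _ ≤ _ := Real.rpow_le_rpow (by norm_num) h2 (by norm_num)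
  nlinarith

theorem ell_mul_sqrt_le (hT : 2 ≤ T) :
    ell T * √(ell T : ℝ) ≤ 336 * Real.log T ^ (3 / 2 : ℝ) := by
  have hlog : 0 < Real.log T := Real.log_pos (by exact_mod_cast hT)
  have h1 : √(ell T : ℝ) ≤ 7 * √(Real.log T) := by
    refine (Real.sqrt_le_sqrt (ell_le hT)).trans ?_
    rw [Real.sqrt_mul (by norm_num)]
    gcongr
    exact Real.sqrt_le_iff.2 (by norm_num)
  calc ell T * √(ell T : ℝ) ≤ 48 * Real.log T * (7 * √(Real.log T)) := by
        gcongr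
        exact ell_le hT
    _ = 336 * (Real.log T ^ (1 : ℝ) * Real.log T ^ (1 / 2 : ℝ)) := by
        rw [Real.rpow_one, ← Real.sqrt_eq_rpow]
        ring
    _ = _ := by
        rw [← Real.rpow_add hlog]
        norm_num

theorem expectedRegret_le {A : Set (EuclideanSpace ℝ (Fin d))} (hA : A.Nonempty)
    (hnet : IsNet A T n x) (hν : IsSubgaussianNoise ν) (hn : 1 ≤ n) (hρ : 0 < ρ) (hρ1 : ρ ≤ 1)
    (hx : ∀ a < n, ‖x a‖ ≤ 1) (hd : 1 ≤ d) (hT : 2 ≤ T) (hθ : ‖θ‖ ≤ 1) :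
    expectedRegret A phasedElimination T ρ n x θ ν ≤
      86024 * (d ^ 3 / ρ) * (√(T : ℝ) * Real.log T ^ (3 / 2 : ℝ)) := by
  obtain ⟨a₀, ha₀, hbest⟩ := Finset.exists_max_image (Finset.range n) (fun a => inner ℝ θ (x a))
    ⟨0, Finset.mem_range.2 hn⟩
  simp only [Finset.mem_range] at ha₀ hbest
  have hsup := iSup_inner_le hA hnet hθ hT hbest
  have hv : inner ℝ θ (x a₀) ≤ 1 := (abs_le.1 (abs_inner_le hθ (hx a₀ ha₀))).2
  set W := √(T : ℝ) * Real.log T ^ (3 / 2 : ℝ) with hW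
  have hW1 : 1 ≤ 4 * W := one_le_sqrt_mul_log hT
  have hd1 : (1 : ℝ) ≤ d ^ 3 := one_le_pow₀ (by exact_mod_cast hd)
  have hρ' : 1 ≤ 1 / ρ := by rw [le_div_iff₀ hρ]; linarith
  have hdρ : 1 / ρ ≤ d ^ 3 / ρ := by gcongr
  have hmean : ∀ ξ η, meanReward phasedElimination T ρ n x θ (ξ, η) = T * inner ℝ θ (x a₀) -
      ∑ t ∈ Finset.range T,
        (inner ℝ θ (x a₀) - inner ℝ θ (play phasedElimination T ρ n x θ ξ η t)) := by
    intro ξ η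
    simp [meanReward, Finset.sum_sub_distrib]
  unfold expectedRegret
  by_cases hρT : 1 ≤ ρ * T
  · have hmain := le_integral_meanReward hν hn hρ hρ1 hx hd hT hθ hv
      (M := 256 * d ^ 3 / ρ * (ell T * √(ell T : ℝ)) * √(T : ℝ)) (by positivity)
      fun ξ η hη => by
        rw [hmean]
        linarith [sum_gap_le (ξ := ξ) hn hρ hρ1 hx hd hT hθ ha₀ hbest hρT hη]
    have hM : 256 * d ^ 3 / ρ * (ell T * √(ell T : ℝ)) * √(T : ℝ) ≤ 86016 * (d ^ 3 / ρ) * W := by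
      calc _ ≤ 256 * d ^ 3 / ρ * (336 * Real.log T ^ (3 / 2 : ℝ)) * √(T : ℝ) :=
            mul_le_mul_of_nonneg_right
              (mul_le_mul_of_nonneg_left (ell_mul_sqrt_le hT) (by positivity)) (by positivity)
        _ = _ := by rw [hW]; ring
    nlinarith
  · have hmain := le_integral_meanReward hν hn hρ hρ1 hx hd hT hθ hv
      (M := 2 * T) (by positivity) fun ξ η hη => by
        rw [hmean]
        have : ∑ t ∈ Finset.range T, (inner ℝ θ (x a₀) -
            inner ℝ θ (play phasedElimination T ρ n x θ ξ η t)) ≤ ∑ _t ∈ Finset.range T, (2 : ℝ) :=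
          Finset.sum_le_sum fun t ht => by
            linarith [(abs_le.1 (abs_inner_le hθ (norm_play_le (θ := θ) (ξ := ξ) (η := η) hn hρ hρ1 hx
              hd hT (Finset.mem_range.1 ht)))).1]
        rw [Finset.sum_const, Finset.card_range, nsmul_eq_mul] at this
        linarith
    have hTρ : (T : ℝ) ≤ 1 / ρ := by
      rw [le_div_iff₀ hρ]
      linarith
    nlinarith

theorem logFactor_lower_bound : ∃ c : ℝ, 0 < c ∧ ∀ d, c ≤ logFactor d := by
  have h16 : Real.exp 1 < Real.log 16 := by
    rw [show (16 : ℝ) = 2 ^ 4 by norm_num, Real.log_pow]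
    push_cast
    linarith [Real.log_two_gt_d9, Real.exp_one_lt_d9]
  have h1 : 1 < Real.log 16 := by linarith [Real.add_one_le_exp (1 : ℝ)]
  have h2 : 1 < Real.log (Real.log 16) := (Real.lt_log_iff_exp_lt (by linarith)).2 h16
  have h3 : 0 < Real.log (Real.log (Real.log 16)) := Real.log_pos h2
  refine ⟨min 1 (Real.log (Real.log (Real.log 16))), lt_min one_pos h3, fun d => ?_⟩
  unfold logFactor
  split_ifs with hd
  · have e1 : Real.log 16 ≤ Real.log d := Real.log_le_log (by norm_num) (by exact_mod_cast hd)
    have e2 : Real.log (Real.log 16) ≤ Real.log (Real.log d) := Real.log_le_log (by linarith) e1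
    have e3 : Real.log (Real.log (Real.log 16)) ≤ Real.log (Real.log (Real.log d)) :=
      Real.log_le_log (by linarith) e2
    refine (min_le_right _ _).trans (e3.trans (le_mul_of_one_le_left (by linarith) ?_))
    exact one_le_mul_of_one_le_of_one_le (by linarith) (one_le_pow₀ (by linarith))
  · exact min_le_left _ _

end LinearBandit

theorem mainTheorem3 :
    ∃ (P : List RealRAM.Cmd) (C : ℝ) (K k : ℕ), 0 < C ∧
      ∀ (d T : ℕ) (ρ : ℝ) (A : Set (EuclideanSpace ℝ (Fin d))),
        1 ≤ d → 2 ≤ T → 0 < ρ → ρ ≤ 1 → A.Nonempty → (∀ a ∈ A, ‖a‖ ≤ 1) →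
        (∃ (n : ℕ) (x : ℕ → EuclideanSpace ℝ (Fin d)), LinearBandit.IsNet A T n x) ∧
        ∀ (n : ℕ) (x : ℕ → EuclideanSpace ℝ (Fin d)), LinearBandit.IsNet A T n x →
          LinearBandit.RunsWithin P T ρ n x (K * ((T : ℝ) ^ d) ^ k * (1 / ρ) ^ k) ∧
          LinearBandit.IsReproducible P T ρ n x ∧
          ∀ θ : EuclideanSpace ℝ (Fin d), ‖θ‖ ≤ 1 →
            ∀ ν : ℕ → ProbabilityMeasure ℝ, LinearBandit.IsSubgaussianNoise ν →
              Integrable (LinearBandit.meanReward P T ρ n x θ)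
                (LinearBandit.seedLaw.prod (LinearBandit.noiseLaw ν)) ∧
              LinearBandit.expectedRegret A P T ρ n x θ ν ≤
                C * ((d : ℝ) ^ 4 * LinearBandit.logFactor d / ρ ^ 2) * √(T : ℝ) *
                  Real.log T ^ (3 / 2 : ℝ) := by
  obtain ⟨K, k, htime⟩ := LinearBandit.exists_programTime_le
  obtain ⟨c, hc, hlog⟩ := LinearBandit.logFactor_lower_bound
  refine ⟨LinearBandit.phasedElimination, 86024 / c, K, k, by positivity, ?_⟩
  intro d T ρ A hd hT hρ hρ1 hA hA1
  refine ⟨LinearBandit.exists_isNet (by omega) hA1, fun n x hnet => ?_⟩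
  have hx : ∀ a < n, ‖x a‖ ≤ 1 := fun a ha => hA1 _ (hnet.mem a ha)
  have hn : 1 ≤ n := by
    obtain ⟨a, ha⟩ := hA
    obtain ⟨i, hi, -⟩ := hnet.cover a ha
    omega
  refine ⟨fun ξ r => ?_, LinearBandit.isReproducible_phasedElimination hn hρ hρ1 hx hd hT,
    fun θ hθ ν hν => ⟨LinearBandit.integrable_meanReward hn hρ hρ1 hx hd hT hθ, ?_⟩⟩
  · obtain ⟨h1, h2, h3⟩ := LinearBandit.runsWithin_phasedElimination hn hρ hρ1 hx hd hT ξ r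
    exact ⟨h1, h2.trans (htime d T n ρ hd hT hρ hρ1 hnet.card_le), h3⟩
  · refine (LinearBandit.expectedRegret_le hA hnet hν hn hρ hρ1 hx hd hT hθ).trans ?_
    have hd1 : (1 : ℝ) ≤ d := by exact_mod_cast hd
    have hlogT : 0 ≤ Real.log T := Real.log_nonneg (by exact_mod_cast (by omega : 1 ≤ T))
    have hlog' := hlog d
    have h1 : (d : ℝ) ^ 3 / ρ ≤ d ^ 4 / ρ ^ 2 := by
      gcongr
      · norm_num
      · nlinarith
    have h2 : 86024 * ((d : ℝ) ^ 3 / ρ) ≤ 86024 / c * (d ^ 4 * LinearBandit.logFactor d / ρ ^ 2) := by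
      calc 86024 * ((d : ℝ) ^ 3 / ρ) ≤ 86024 * (d ^ 4 / ρ ^ 2) := by gcongr
        _ = 86024 / c * (d ^ 4 * c / ρ ^ 2) := by field_simp
        _ ≤ _ := mul_le_mul_of_nonneg_left (by gcongr) (by positivity)
    rw [mul_assoc (86024 / c * _)]
    exact mul_le_mul_of_nonneg_right h2 (by positivity)
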